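/- **Setting.** Fix integers $d\ge 1$ and $p,q,m,n\ge 0$ not all zero, integers $d'\ge 1$, $p',q',m',n'\ge 0$, and put $\ell=p'+q'+m'+n'$. Let $\xi_1,\dots,\xi_{d'}$ and $\gamma_1,\dots,\gamma_\ell$ be positive integers with $\sum_a\xi_a=d$ and $$\sum_{i\le p'}\gamma_i=p,\quad \sum_{p'<i\le p'+q'}\gamma_i=q,\quad \sum_{p'+q'<i\le p'+q'+m'}\gamma_i=m,\quad \sum_{p'+q'+m'<i\le \ell}\gamma_i=n .$$ Let $\mathbf w=(w_a)\in\mathbb C^{d'}$ and $\mathbf z=(z_i)\in\mathbb C^{\ell}$ be arbitrary, $d_a=\sum_{b<a}\xi_b$, $l_i=\sum_{j<i}\gamma_j$. For $1\le i\le p+q+m+n$ let $|i|=0$ if $i\le p$ or $p+q<i\le p+q+m$, and $|i|=1$ otherwise; $\mathbf s=(|1|,\dots,|p+q+m+n|)=(0^p,1^q,0^m,1^n)$. Put $[\gamma_i]=\gamma_i$ if $i\le p'$ or $p'+q'<i\le p'+q'+m'$, and $[\gamma_i]=-\gamma_i$ otherwise. **Algebras.** $\mathcal D$ is the Weyl superalgebra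 over $\mathbb C$ generated by variables $y^a_r$ ($1\le r\le p+q$, parity $|r|$) and $x^a_i$ ($1\le i\le m+n$, parity $|p+q+i|$), $1\le a\le d$, and their derivatives, subject to the canonical supercommutation relations. The Lie superalgebra $\mathfrak{gl}_\diamondsuit=\mathfrak{gl}_{p+m|q+n}$ has basis $E^i_j$ with $[E^i_j,E^r_s]=\delta_{jr}E^i_s-(-1)^{(|i|+|j|)(|r|+|s|)}\delta_{is}E^r_j$, and $\mathfrak{gl}_d$ has basis $e_{ab}$. For $\mathfrak g$ one of these, $\mathfrak g(\mathbf z,\gamma)=\bigoplus_i\mathfrak g[t_{z_i}]/t_{z_i}^{\gamma_i}\mathfrak g[t_{z_i}]$ with $t_{z_i}=t-z_i$; bars denote classes. For an associative superalgebra $A$, $A((z^{-1},\partial_z^{-1}))$ is the algebra of series $\sum_{i\le r,\,j\le s}a_{ij}z^i\partial_z^j$ ($r,s\in\mathbb Z$, $a_{ij}\in A$), with $z,\partial_z$ even and commuting with $A$ and $\partial_z^iz^j=\sum_{k\ge0}\binom ik\binom jk k!\,z^{j-k}\partial_z^{i-k}$; reordering identifies it with $A((\partial_z^{-1},z^{-1}))$,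 the algebra of series $\sum_{i\le r,\,j\le s}a_{ij}\partial_z^iz^j$. Homomorphisms of coefficient algebras are extended coefficientwise. **Homomorphisms.** $\phi:U(\mathfrak{gl}_d(\mathbf z,\gamma))\to\mathcal D$ is given, for $0\le k<\gamma_i$, by $$e_{ab}\otimes\bar t_{z_i}^k\mapsto-\sum_{r=l_i+1}^{l_{i+1}-k}y^b_r\,\partial_{y^a_{r+k}}\ (i\le p'+q'),\qquad e_{ab}\otimes\bar t_{z_i}^k\mapsto\sum_{r=l_i+1-p-q}^{l_{i+1}-k-p-q}(-1)^{|p+q+r|}\partial_{x^b_r}x^a_{r+k}\ (i>p'+q'),$$ and $\varphi:U(\mathfrak{gl}_\diamondsuit(\mathbf w,\xi))\to\mathcal D$, for $0\le k<\xi_a$, $1\le r,s\le p+q$, $1\le i,j\le m+n$, with all sums over $d_a+1\le\alpha\le d_{a+1}-k$, by $$E^r_s\otimes\bar t_{w_a}^k\mapsto\sum_\alpha(-1)^{|s|+1}\partial_{y^{\alpha+k}_r}y^\alpha_s,\qquad E^r_{p+q+j}\otimes\bar t_{w_a}^k\mapsto\sum_\alpha\partial_{y^{\alpha+k}_r}\partial_{x^\alpha_j},$$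 $$E^{p+q+i}_s\otimes\bar t_{w_a}^k\mapsto\sum_\alpha(-1)^{|s|+1}x^{\alpha+k}_iy^\alpha_s,\qquad E^{p+q+i}_{p+q+j}\otimes\bar t_{w_a}^k\mapsto\sum_\alpha x^{\alpha+k}_i\partial_{x^\alpha_j}.$$ **Matrices.** Let $J_\xi(\mathbf w)$ and $J_\gamma(\mathbf z)$ be the block diagonal matrices of upper triangular Jordan blocks of sizes $\xi_a$ (resp. $\gamma_i$) with eigenvalues $w_a$ (resp. $z_i$). Set $$\widehat{\mathcal L}_d=\Big[\delta_{ab}\,z-J_\xi(\mathbf w)_{ba}-\sum_{i=1}^{\ell}\sum_{k=0}^{\gamma_i-1}(e_{ba}\otimes\bar t_{z_i}^k)(\partial_z-z_i)^{-k-1}\Big]_{a,b=1}^{d}\ \text{ over } U(\mathfrak{gl}_d(\mathbf z,\gamma))((\partial_z^{-1},z^{-1})),$$ $$\mathcal L_\diamondsuit=\Big[\delta_{ij}\,\partial_z-J_\gamma(\mathbf z)_{ij}-(-1)^{|i|}\sum_{a=1}^{d'}\sum_{k=0}^{\xi_a-1}(E^i_j\otimes\bar t_{w_a}^k)(z-w_a)^{-k-1}\Big]_{i,j=1}^{p+q+m+n}\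 \text{ over } U(\mathfrak{gl}_\diamondsuit(\mathbf w,\xi))((z^{-1},\partial_z^{-1})).$$ The column determinant is $\operatorname{cdet}A=\sum_\sigma(-1)^{l(\sigma)}a_{\sigma(1),1}\cdots a_{\sigma(k),k}$. A square matrix $A$ is sufficiently invertible if each leading submatrix $A_{(i)}$ (first $i$ rows and columns) has a two-sided inverse whose $(i,i)$ entry is invertible; $d_i(A)$ is the inverse of that entry, and $\operatorname{Ber}^{\mathbf s}(A)=d_1(A)^{(-1)^{s_1}}d_2(A)^{(-1)^{s_2}}\cdots$, the factors being ordered by increasing index. **Theorem.** The matrix $\mathcal L_\diamondsuit$ is sufficiently invertible, each $\partial_z-z_i$ is invertible, and $$\prod_{i=1}^{\ell}(\partial_z-z_i)^{[\gamma_i]}\cdot\phi\big(\operatorname{cdet}\widehat{\mathcal L}_d\big)=\prod_{a=1}^{d'}(z-w_a)^{\xi_a}\cdot\varphi\big(\operatorname{Ber}^{\mathbf s}\mathcal L_\diamondsuit\big)$$ in $\mathcal D((\partial_z^{-1},z^{-1}))=\mathcal D((z^{-1},\partial_z^{-1}))$. -/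

import Mathlib

noncomputable section
namespace PDO

/-- `k! * binom(j,k) * binom(i,k)`. -/
def wc (j i : ℤ) (k : ℕ) : ℤ := (k.factorial : ℤ) * Ring.choose j k * Ring.choose i k

theorem choose_aux (j : ℤ) (k s : ℕ) :
    Ring.choose j k * Ring.choose (j - k) s = ((k + s).choose k : ℤ) * Ring.choose j (k + s) := by
  have h := Ring.choose_smul_choose j (Nat.le_add_right k s)
  rw [Nat.add_sub_cancel_left, nsmul_eq_mul] at h
  exact h.symm

theorem fact_aux (k s t : ℕ) :
    (k.factorial : ℤ) * (s + t).factorial * (k + s).choose k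
      = t.factorial * (k + s).factorial * (t + s).choose t := by
  have h1 := Nat.choose_mul_factorial_mul_factorial (Nat.le_add_right k s)
  have h2 := Nat.choose_mul_factorial_mul_factorial (Nat.le_add_right t s)
  rw [Nat.add_sub_cancel_left] at h1 h2
  have hs : (s.factorial : ℤ) ≠ 0 := by exact_mod_cast s.factorial_ne_zero
  apply mul_right_cancel₀ hs
  rw [add_comm s t]
  have h1' : ((k + s).choose k : ℤ) * k.factorial * s.factorial = (k + s).factorial := by
    exact_mod_cast h1
  have h2' : ((t + s).choose t : ℤ) * t.factorial * s.factorial = (t + s).factorial := by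
    exact_mod_cast h2
  rw [← h1', ← h2']; ring

theorem wc_assoc (j i₁ j₁ i₂ : ℤ) (n : ℕ) :
    ∑ x ∈ Finset.HasAntidiagonal.antidiagonal n, wc j i₁ x.1 * wc (j + j₁ - x.1) i₂ x.2
      = ∑ x ∈ Finset.HasAntidiagonal.antidiagonal n, wc j₁ i₂ x.2 * wc j (i₁ + i₂ - x.2) x.1 := by
  have hL : ∀ x : ℕ × ℕ, wc j i₁ x.1 * wc (j + j₁ - x.1) i₂ x.2 =
      ∑ y ∈ Finset.HasAntidiagonal.antidiagonal x.2, (x.1.factorial * (y.1 + y.2).factorial *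
        ((x.1 + y.1).choose x.1 : ℤ)) * (Ring.choose j (x.1 + y.1) * Ring.choose i₁ x.1 *
          Ring.choose j₁ y.2 * Ring.choose i₂ (y.1 + y.2)) := by
    intro x
    have : j + j₁ - x.1 = (j - x.1) + j₁ := by ring
    rw [wc, wc, this, Ring.add_choose_eq _ (Commute.all _ _), Finset.mul_sum, Finset.sum_mul,
      Finset.mul_sum]
    refine Finset.sum_congr rfl fun y hy => ?_
    rw [Finset.HasAntidiagonal.mem_antidiagonal] at hy
    rw [hy]
    linear_combination (x.1.factorial * Ring.choose i₁ x.1 * x.2.factorial * Ring.choose j₁ y.2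
      * Ring.choose i₂ x.2 : ℤ) * choose_aux j x.1 y.1
  have hR : ∀ x : ℕ × ℕ, wc j₁ i₂ x.2 * wc j (i₁ + i₂ - x.2) x.1 =
      ∑ y ∈ Finset.HasAntidiagonal.antidiagonal x.1, (x.2.factorial * (y.1 + y.2).factorial *
        ((x.2 + y.2).choose x.2 : ℤ)) * (Ring.choose j (y.1 + y.2) * Ring.choose i₁ y.1 *
          Ring.choose j₁ x.2 * Ring.choose i₂ (x.2 + y.2)) := by
    intro x
    have : i₁ + i₂ - x.2 = i₁ + (i₂ - x.2) := by ring
    rw [wc, wc, this, Ring.add_choose_eq _ (Commute.all _ _), Finset.mul_sum,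
      Finset.mul_sum]
    refine Finset.sum_congr rfl fun y hy => ?_
    rw [Finset.HasAntidiagonal.mem_antidiagonal] at hy
    rw [hy]
    linear_combination (x.2.factorial * Ring.choose j₁ x.2 * x.1.factorial * Ring.choose j x.1
      * Ring.choose i₁ y.1 : ℤ) * choose_aux i₂ x.2 y.2
  simp_rw [hL, hR]
  rw [Finset.sum_sigma', Finset.sum_sigma']
  refine Finset.sum_nbij' (fun x => ⟨(x.1.1 + x.2.1, x.2.2), (x.1.1, x.2.1)⟩)
    (fun x => ⟨(x.2.1, x.2.2 + x.1.2), (x.2.2, x.1.2)⟩) ?_ ?_ ?_ ?_ ?_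
  · rintro ⟨⟨a, b⟩, ⟨c, e⟩⟩ h
    simp only [Finset.mem_sigma, Finset.HasAntidiagonal.mem_antidiagonal] at h ⊢
    obtain ⟨rfl, rfl⟩ := h
    exact ⟨by ring, trivial⟩
  · rintro ⟨⟨a, b⟩, ⟨c, e⟩⟩ h
    simp only [Finset.mem_sigma, Finset.HasAntidiagonal.mem_antidiagonal] at h ⊢
    obtain ⟨rfl, rfl⟩ := h
    exact ⟨by ring, trivial⟩
  · rintro ⟨⟨a, b⟩, ⟨c, e⟩⟩ h
    simp only [Finset.mem_sigma, Finset.HasAntidiagonal.mem_antidiagonal] at h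
    obtain ⟨h1, h2⟩ := h
    subst h2; rfl
  · rintro ⟨⟨a, b⟩, ⟨c, e⟩⟩ h
    simp only [Finset.mem_sigma, Finset.HasAntidiagonal.mem_antidiagonal] at h
    obtain ⟨h1, h2⟩ := h
    subst h2; rfl
  · rintro ⟨⟨a, b⟩, ⟨c, e⟩⟩ h
    simp only
    rw [fact_aux, add_comm e c]


end PDO

/-- The pseudo-differential operators `A((z⁻¹, ∂⁻¹))`: formal series `∑ a_{ij} z^i ∂^j` over
`i ≤ r`, `j ≤ s` for some integers `r`, `s`; `coeff i j` is the coefficient `a_{ij}`. -/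
structure PDO (A : Type*) [Zero A] where
  coeff : ℤ → ℤ → A
  bdd : ∃ r s : ℤ, ∀ i j, coeff i j ≠ 0 → i ≤ r ∧ j ≤ s

namespace PDO

@[ext]
theorem ext {A : Type*} [Zero A] {f g : PDO A} (h : ∀ i j, f.coeff i j = g.coeff i j) : f = g := by
  cases f; cases g
  congr
  funext i j
  exact h i j

theorem exists_ne_of_finsum {ι M : Type*} [AddCommMonoid M] {f : ι → M} (h : ∑ᶠ i, f i ≠ 0) :
    ∃ i, f i ≠ 0 := by
  by_contra! h'
  exact h (by simp [h'])

section Additive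

variable {A : Type*} [Ring A]

instance : Zero (PDO A) := ⟨⟨fun _ _ => 0, 0, 0, fun _ _ h => (h rfl).elim⟩⟩

instance : Add (PDO A) := ⟨fun f g => ⟨fun i j => f.coeff i j + g.coeff i j, by
  obtain ⟨r, s, hf⟩ := f.bdd
  obtain ⟨r', s', hg⟩ := g.bdd
  refine ⟨max r r', max s s', fun i j h => ?_⟩
  by_cases h1 : f.coeff i j = 0
  · have := hg i j (by rwa [h1, zero_add] at h)
    omega
  · have := hf i j h1
    omega⟩⟩

instance : Neg (PDO A) := ⟨fun f => ⟨fun i j => -f.coeff i j, by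
  obtain ⟨r, s, hf⟩ := f.bdd
  exact ⟨r, s, fun i j h => hf i j (by simpa using h)⟩⟩⟩

@[simp] theorem coeff_zero (i j : ℤ) : (0 : PDO A).coeff i j = 0 := rfl
@[simp] theorem coeff_add (f g : PDO A) (i j : ℤ) :
    (f + g).coeff i j = f.coeff i j + g.coeff i j := rfl
@[simp] theorem coeff_neg (f : PDO A) (i j : ℤ) : (-f).coeff i j = -f.coeff i j := rfl

/-- The monomial `a z^i ∂^j`. -/
def mono (i j : ℤ) (a : A) : PDO A :=
  ⟨fun i' j' => if i' = i ∧ j' = j then a else 0, i, j, fun i' j' h => by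
    by_cases h' : i' = i ∧ j' = j
    · omega
    · simp [h'] at h⟩

theorem coeff_mono (i j : ℤ) (a : A) (i' j' : ℤ) :
    (mono i j a).coeff i' j' = if i' = i ∧ j' = j then a else 0 := rfl

instance : One (PDO A) := ⟨mono 0 0 1⟩

theorem coeff_one (i j : ℤ) : (1 : PDO A).coeff i j = if i = 0 ∧ j = 0 then 1 else 0 := rfl

/-- The terms contributing to the coefficient of `z^a ∂^b` in `f * g`, according to
`∂^j z^i = ∑_k k! binom(j,k) binom(i,k) z^{i-k} ∂^{j-k}`. The index `(k, i, j)` picks the term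
`z^i ∂^j` of `f` and the `k`-th summand of this rule. -/
def mulTerm (f g : PDO A) (a b : ℤ) (t : ℕ × ℤ × ℤ) : A :=
  wc t.2.2 (a + t.1 - t.2.1) t.1 •
    (f.coeff t.2.1 t.2.2 * g.coeff (a + t.1 - t.2.1) (b + t.1 - t.2.2))

theorem mulTerm_finite (f g : PDO A) (a b : ℤ) :
    Function.HasFiniteSupport (mulTerm f g a b) := by
  obtain ⟨r, s, hf⟩ := f.bdd
  obtain ⟨r', s', hg⟩ := g.bdd
  refine Set.Finite.subset (Finset.finite_toSet
    (Finset.range (r + r' - a + 1).toNat ×ˢ Finset.Icc (a - r') r ×ˢ Finset.Icc (b - s') s)) ?_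
  rintro ⟨k, i, j⟩ h
  have h1 : f.coeff i j ≠ 0 := fun h0 => h (by simp [mulTerm, h0])
  have h2 : g.coeff (a + k - i) (b + k - j) ≠ 0 := fun h0 => h (by simp [mulTerm, h0])
  have := hf _ _ h1
  have := hg _ _ h2
  simp only [Finset.coe_product, Set.mem_prod, Finset.mem_coe, Finset.mem_range, Finset.mem_Icc]
  omega

instance : Mul (PDO A) := ⟨fun f g => ⟨fun a b => ∑ᶠ t, mulTerm f g a b t, by
  obtain ⟨r, s, hf⟩ := f.bdd
  obtain ⟨r', s', hg⟩ := g.bdd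
  refine ⟨r + r', s + s', fun a b h => ?_⟩
  obtain ⟨⟨k, i, j⟩, h⟩ := exists_ne_of_finsum h
  have h1 : f.coeff i j ≠ 0 := fun h0 => h (by simp [mulTerm, h0])
  have h2 : g.coeff (a + k - i) (b + k - j) ≠ 0 := fun h0 => h (by simp [mulTerm, h0])
  have := hf _ _ h1
  have := hg _ _ h2
  omega⟩⟩

theorem coeff_mul (f g : PDO A) (a b : ℤ) :
    (f * g).coeff a b = ∑ᶠ t, mulTerm f g a b t := rfl

theorem mul_add' (f g h : PDO A) : f * (g + h) = f * g + f * h := by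
  ext a b
  simp only [coeff_mul, coeff_add]
  rw [← finsum_add_distrib (mulTerm_finite _ _ _ _) (mulTerm_finite _ _ _ _)]
  refine finsum_congr fun t => ?_
  simp [mulTerm, mul_add, smul_add]

theorem add_mul' (f g h : PDO A) : (f + g) * h = f * h + g * h := by
  ext a b
  simp only [coeff_mul, coeff_add]
  rw [← finsum_add_distrib (mulTerm_finite _ _ _ _) (mulTerm_finite _ _ _ _)]
  refine finsum_congr fun t => ?_
  simp [mulTerm, add_mul, smul_add]

theorem one_mul' (f : PDO A) : 1 * f = f := by
  ext a b
  rw [coeff_mul, finsum_eq_single _ (0, 0, 0)]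
  · simp [mulTerm, coeff_one, wc]
  · rintro ⟨k, i, j⟩ h
    by_cases hij : i = 0 ∧ j = 0
    · obtain ⟨rfl, rfl⟩ := hij
      have hk : 0 < k := by
        rcases Nat.eq_zero_or_pos k with rfl | hk
        · simp at h
        · exact hk
      simp [mulTerm, wc, Ring.choose_zero_pos ℤ hk]
    · simp [mulTerm, coeff_one, hij]

theorem mul_one' (f : PDO A) : f * 1 = f := by
  ext a b
  rw [coeff_mul, finsum_eq_single _ (0, a, b)]
  · simp [mulTerm, coeff_one, wc]
  · rintro ⟨k, i, j⟩ h
    by_cases hij : a + k - i = 0 ∧ b + k - j = 0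
    · have hk : 0 < k := by
        rcases Nat.eq_zero_or_pos k with rfl | hk
        · exfalso
          apply h
          have h1 : i = a := by have := hij.1; push_cast at this; omega
          have h2 : j = b := by have := hij.2; push_cast at this; omega
          rw [h1, h2]
        · exact hk
      simp [mulTerm, wc, hij.1, Ring.choose_zero_pos ℤ hk]
    · simp [mulTerm, coeff_one, hij]

/-- The terms of a triple product. -/
def tri (f g h : PDO A) (a b : ℤ) (c : ℤ → ℤ → ℤ → ℤ → ℤ → ℕ → ℕ → ℤ)
    (u : (ℤ × ℤ × ℤ × ℤ) × ℕ × ℕ) : A :=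
  c u.1.1 u.1.2.1 u.1.2.2.1 u.1.2.2.2 (a + (u.2.1 + u.2.2 : ℕ) - u.1.1 - u.1.2.2.1) u.2.1 u.2.2 •
    (f.coeff u.1.1 u.1.2.1 * g.coeff u.1.2.2.1 u.1.2.2.2 *
      h.coeff (a + (u.2.1 + u.2.2 : ℕ) - u.1.1 - u.1.2.2.1)
        (b + (u.2.1 + u.2.2 : ℕ) - u.1.2.1 - u.1.2.2.2))

theorem tri_bound (f g h : PDO A) (a b : ℤ) :
    ∃ (K : ℕ) (S : Finset (ℤ × ℤ × ℤ × ℤ)), ∀ c u, tri f g h a b c u ≠ 0 →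
      u.1 ∈ S ∧ u.2.1 + u.2.2 < K := by
  obtain ⟨r, s, hf⟩ := f.bdd
  obtain ⟨r', s', hg⟩ := g.bdd
  obtain ⟨r'', s'', hh⟩ := h.bdd
  refine ⟨(r + r' + r'' - a + 1).toNat, Finset.Icc (a - r' - r'') r ×ˢ
    Finset.Icc (b - s' - s'') s ×ˢ Finset.Icc (a - r - r'') r' ×ˢ Finset.Icc (b - s - s'') s',
    fun c u hu => ?_⟩
  obtain ⟨⟨i, j, i', j'⟩, k, l⟩ := u
  have h1 : f.coeff i j ≠ 0 := fun h0 => hu (by simp [tri, h0])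
  have h2 : g.coeff i' j' ≠ 0 := fun h0 => hu (by simp [tri, h0])
  have h3 : h.coeff (a + (k + l : ℕ) - i - i') (b + (k + l : ℕ) - j - j') ≠ 0 :=
    fun h0 => hu (by simp only [tri, h0, mul_zero, smul_zero])
  have := hf _ _ h1
  have := hg _ _ h2
  have := hh _ _ h3
  simp only [Finset.mem_product, Finset.mem_Icc]
  omega

theorem tri_finite (f g h : PDO A) (a b : ℤ) (c) :
    Function.HasFiniteSupport (tri f g h a b c) := by
  obtain ⟨K, S, hS⟩ := tri_bound f g h a b
  refine Set.Finite.subset (Finset.finite_toSet (S ×ˢ Finset.range K ×ˢ Finset.range K)) ?_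
  intro u hu
  have := hS c u hu
  simp only [Finset.coe_product, Set.mem_prod, Finset.mem_coe, Finset.mem_range]
  exact ⟨this.1, by omega, by omega⟩

theorem tri_sum (f g h : PDO A) (a b : ℤ) (c) (K : ℕ) (S : Finset (ℤ × ℤ × ℤ × ℤ))
    (hS : ∀ u, tri f g h a b c u ≠ 0 → u.1 ∈ S ∧ u.2.1 + u.2.2 < K) :
    ∑ᶠ u, tri f g h a b c u = ∑ v ∈ S, ∑ n ∈ Finset.range K,
      (∑ x ∈ Finset.HasAntidiagonal.antidiagonal n,
        c v.1 v.2.1 v.2.2.1 v.2.2.2 (a + n - v.1 - v.2.2.1) x.1 x.2) •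
      (f.coeff v.1 v.2.1 * g.coeff v.2.2.1 v.2.2.2 *
      h.coeff (a + n - v.1 - v.2.2.1) (b + n - v.2.1 - v.2.2.2)) := by
  rw [finsum_eq_finsetSum_of_support_subset (s := S ×ˢ
    ((Finset.range K ×ˢ Finset.range K).filter fun x => x.1 + x.2 < K))]
  · rw [Finset.sum_product]
    refine Finset.sum_congr rfl fun v _ => ?_
    rw [← Finset.sum_fiberwise_of_maps_to (t := Finset.range K) (g := fun x => x.1 + x.2)
      (by intro x hx; simp only [Finset.mem_filter] at hx; exact Finset.mem_range.2 hx.2)]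
    refine Finset.sum_congr rfl fun n hn => ?_
    rw [Finset.sum_smul]
    refine Finset.sum_congr ?_ ?_
    · ext x
      simp only [Finset.mem_filter, Finset.mem_product, Finset.mem_range,
        Finset.HasAntidiagonal.mem_antidiagonal] at hn ⊢
      omega
    · intro x hx
      rw [Finset.HasAntidiagonal.mem_antidiagonal] at hx
      rw [tri, ← hx]
  · intro u hu
    have := hS u hu
    simp only [Finset.coe_product, Finset.coe_filter, Finset.mem_product, Set.mem_prod,
      Finset.mem_coe, Finset.mem_range, Set.mem_ofPred_eq]
    exact ⟨this.1, ⟨by omega, by omega⟩, this.2⟩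

theorem mul_assoc_left (f g h : PDO A) (a b : ℤ) :
    ((f * g) * h).coeff a b = ∑ᶠ u, tri f g h a b
      (fun _ j i' j' i'' k l => wc j i' k * wc (j + j' - k) i'' l) u := by
  let e : (ℕ × ℤ × ℤ) × (ℕ × ℤ × ℤ) ≃ (ℤ × ℤ × ℤ × ℤ) × ℕ × ℕ :=
    { toFun := fun x => ((x.2.2.1, x.2.2.2, x.1.2.1 + x.2.1 - x.2.2.1, x.1.2.2 + x.2.1 - x.2.2.2),
        x.2.1, x.1.1)
      invFun := fun u => ((u.2.2, u.1.1 + u.1.2.2.1 - u.2.1, u.1.2.1 + u.1.2.2.2 - u.2.1),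
        u.2.1, u.1.1, u.1.2.1)
      left_inv := by
        rintro ⟨⟨l, i, j⟩, k, i', j'⟩
        simp only [Prod.mk.injEq, true_and, and_true]
        constructor <;> ring
      right_inv := by
        rintro ⟨⟨i, j, i', j'⟩, k, l⟩
        simp only [Prod.mk.injEq, true_and, and_true]
        constructor <;> ring }
  rw [← finsum_comp_equiv e, finsum_curry _ (by
    exact (tri_finite f g h a b _).comp_of_injective (g := e) e.injective), coeff_mul]
  refine finsum_congr fun t => ?_
  obtain ⟨l, i₁, j₁⟩ := t
  rw [mulTerm, coeff_mul, finsum_mul' _ _ (mulTerm_finite _ _ _ _), smul_finsum']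
  · refine finsum_congr fun t => ?_
    obtain ⟨k, i, j⟩ := t
    simp only [tri, mulTerm, e, Equiv.coe_fn_mk]
    rw [smul_mul_assoc, smul_smul]
    have e1 : a + ((k + l : ℕ) : ℤ) - i - (i₁ + k - i) = a + l - i₁ := by push_cast; ring
    have e2 : b + ((k + l : ℕ) : ℤ) - j - (j₁ + k - j) = b + l - j₁ := by push_cast; ring
    have e3 : j + (j₁ + k - j) - k = j₁ := by ring
    rw [e1, e2, e3, mul_comm]
  · refine Set.Finite.subset (mulTerm_finite f g i₁ j₁) ?_
    intro t ht h0
    exact ht (by simp only [h0, zero_mul])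

theorem mul_assoc_right (f g h : PDO A) (a b : ℤ) :
    (f * (g * h)).coeff a b = ∑ᶠ u, tri f g h a b
      (fun _ j i' j' i'' k l => wc j' i'' l * wc j (i' + i'' - l) k) u := by
  let e : (ℕ × ℤ × ℤ) × (ℕ × ℤ × ℤ) ≃ (ℤ × ℤ × ℤ × ℤ) × ℕ × ℕ :=
    { toFun := fun x => ((x.1.2.1, x.1.2.2, x.2.2.1, x.2.2.2), x.1.1, x.2.1)
      invFun := fun u => ((u.2.1, u.1.1, u.1.2.1), u.2.2, u.1.2.2.1, u.1.2.2.2)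
      left_inv := fun _ => rfl
      right_inv := fun _ => rfl }
  rw [← finsum_comp_equiv e, finsum_curry _ (by
    exact (tri_finite f g h a b _).comp_of_injective (g := e) e.injective), coeff_mul]
  refine finsum_congr fun t => ?_
  obtain ⟨k, i, j⟩ := t
  rw [mulTerm, coeff_mul, mul_finsum' _ _ (mulTerm_finite _ _ _ _), smul_finsum']
  · refine finsum_congr fun t => ?_
    obtain ⟨l, i', j'⟩ := t
    simp only [tri, mulTerm, e, Equiv.coe_fn_mk]
    rw [mul_smul_comm, smul_smul, mul_assoc]
    have e1 : a + k - i + l - i' = a + ((k + l : ℕ) : ℤ) - i - i' := by push_cast; ring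
    have e2 : b + k - j + l - j' = b + ((k + l : ℕ) : ℤ) - j - j' := by push_cast; ring
    have e3 : i' + (a + ((k + l : ℕ) : ℤ) - i - i') - l = a + k - i := by push_cast; ring
    rw [e1, e2, e3, mul_comm]
  · refine Set.Finite.subset (mulTerm_finite g h (a + k - i) (b + k - j)) ?_
    intro t ht h0
    exact ht (by simp only [h0, mul_zero])

theorem mul_assoc' (f g h : PDO A) : (f * g) * h = f * (g * h) := by
  ext a b
  obtain ⟨K, S, hS⟩ := tri_bound f g h a b
  rw [mul_assoc_left, mul_assoc_right, tri_sum _ _ _ _ _ _ K S (hS _),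
    tri_sum _ _ _ _ _ _ K S (hS _)]
  refine Finset.sum_congr rfl fun v _ => Finset.sum_congr rfl fun n _ => ?_
  rw [wc_assoc]

instance : Ring (PDO A) where
  add_assoc f g h := by ext; simp [add_assoc]
  zero_add f := by ext; simp
  add_zero f := by ext; simp
  add_comm f g := by ext; simp [add_comm]
  neg_add_cancel f := by ext; simp
  nsmul := nsmulRec
  zsmul := zsmulRec
  left_distrib := mul_add'
  right_distrib := add_mul'
  zero_mul f := by ext; simp [coeff_mul, mulTerm]
  mul_zero f := by ext; simp [coeff_mul, mulTerm]
  mul_assoc := mul_assoc'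
  one_mul := one_mul'
  mul_one := mul_one'

/-- The homomorphism `A((z⁻¹, ∂⁻¹)) → B((z⁻¹, ∂⁻¹))` applying `φ : A → B` to each coefficient. -/
def map {B : Type*} [Ring B] (φ : A →+* B) : PDO A →+* PDO B where
  toFun f := ⟨fun i j => φ (f.coeff i j), by
    obtain ⟨r, s, hf⟩ := f.bdd
    exact ⟨r, s, fun i j h => hf i j fun h0 => h (by rw [h0, map_zero])⟩⟩
  map_zero' := by ext; simp
  map_add' f g := by ext; simp
  map_one' := by ext i j; simp only [coeff_one]; split_ifs <;> simp
  map_mul' f g := by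
    ext a b
    simp only [coeff_mul]
    have := (φ : A →+ B).map_finsum (mulTerm_finite f g a b)
    simp only [AddMonoidHom.coe_coe] at this
    rw [this]
    refine finsum_congr fun t => ?_
    simp [mulTerm]

/-- The series `∑ c_{ij} ∂^i z^j`, rewritten with powers of `z` on the left by means of
`∂^i z^j = ∑_k k! binom(i,k) binom(j,k) z^{j-k} ∂^{i-k}`. Every element can be written uniquely in
either of the two orders, so `A((z⁻¹, ∂⁻¹))` and `A((∂⁻¹, z⁻¹))` are the same algebra. -/
def antinormal (c : ℤ → ℤ → A) (hc : ∃ r s : ℤ, ∀ i j, c i j ≠ 0 → i ≤ r ∧ j ≤ s) : PDO A :=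
  ⟨fun a b => ∑ᶠ k : ℕ, wc (b + k) (a + k) k • c (b + k) (a + k), by
    obtain ⟨r, s, hc⟩ := hc
    refine ⟨s, r, fun a b h => ?_⟩
    obtain ⟨k, h⟩ := exists_ne_of_finsum h
    have := hc (b + k) (a + k) fun h0 => h (by rw [h0, smul_zero])
    omega⟩

/-- The map `ω`, with `ω(z) = ∂` and `ω(∂) = -z`: it sends `∑ a_{ij} z^i ∂^j` to
`∑ a_{ij} ∂^i (-z)^j`. -/
def fourier (f : PDO A) : PDO A :=
  antinormal (fun i j => ((Int.negOnePow j : ℤˣ) : ℤ) • f.coeff i j) (by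
    obtain ⟨r, s, hf⟩ := f.bdd
    exact ⟨r, s, fun i j h => hf i j fun h0 => h (by rw [h0, smul_zero])⟩)

/-- The variable `z`. -/
def zvar : PDO A := mono 1 0 1

/-- The derivation `∂`. -/
def del : PDO A := mono 0 1 1

/-- The scalar `c`. -/
def const [Algebra ℂ A] (c : ℂ) : PDO A := mono 0 0 (algebraMap ℂ A c)

end Additive

end PDO

namespace Gaudin

section Berezinian

variable {R : Type*} [Ring R] {k : ℕ}

/-- The column determinant `∑_σ sgn(σ) a_{σ(1),1} ⋯ a_{σ(k),k}` over a noncommutative ring. -/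
def cdet (A : Matrix (Fin k) (Fin k) R) : R :=
  ∑ σ : Equiv.Perm (Fin k), ((Equiv.Perm.sign σ : ℤˣ) : ℤ) • (List.ofFn fun i => A (σ i) i).prod

/-- The leading `(i+1) × (i+1)` submatrix (rows and columns `0, …, i`). -/
def leading (A : Matrix (Fin k) (Fin k) R) (i : Fin k) :
    Matrix (Fin ((i : ℕ) + 1)) (Fin ((i : ℕ) + 1)) R :=
  A.submatrix (Fin.castLE i.isLt) (Fin.castLE i.isLt)

/-- The quasideterminant `|A|_{ij} = ((A⁻¹)_{ji})⁻¹`. It is meaningful when `A` has a two-sided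
inverse and the entry `(A⁻¹)_{ji}` is invertible (`Ring.inverse` is then the actual inverse). -/
def quasidet (A : Matrix (Fin k) (Fin k) R) (i j : Fin k) : R :=
  Ring.inverse (Ring.inverse A j i)

/-- The principal quasiminor `d_i(A)`. -/
def quasiminor (A : Matrix (Fin k) (Fin k) R) (i : Fin k) : R :=
  quasidet (leading A i) (Fin.last i) (Fin.last i)

/-- Every principal quasiminor is well defined. -/
def SufficientlyInvertible (A : Matrix (Fin k) (Fin k) R) : Prop :=
  ∀ i : Fin k, IsUnit (leading A i) ∧
    IsUnit (Ring.inverse (leading A i) (Fin.last i) (Fin.last i))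

/-- The Berezinian of type `s` (a sequence of zeros and ones) of a sufficiently invertible matrix:
the ordered product `d_1(A)^{±1} ⋯ d_k(A)^{±1}` with exponent `1` when `s_i = 0` and `-1` when
`s_i = 1`. -/
def ber (s : Fin k → ℕ) (A : Matrix (Fin k) (Fin k) R) : R :=
  (List.ofFn fun i => if s i = 0 then quasiminor A i else Ring.inverse (quasiminor A i)).prod

end Berezinian

section Blocks

variable {c N : ℕ}

/-- The partial sum `γ_0 + ⋯ + γ_{i-1}`; the `i`-th block consists of the (zero-based) indices `r`
with `blockStart γ i ≤ r < blockStart γ (i + 1)`. -/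
def blockStart (γ : Fin c → ℕ) (i : ℕ) : ℕ := ∑ j : Fin c, if (j : ℕ) < i then γ j else 0

/-- `r` and `r'` belong to the `i`-th block, and `r' = r + k`. -/
def Shift (γ : Fin c → ℕ) (i : Fin c) (k : ℕ) (r r' : ℕ) : Prop :=
  blockStart γ i ≤ r ∧ r + k = r' ∧ r' < blockStart γ (i + 1)

instance (γ : Fin c → ℕ) (i : Fin c) (k r r' : ℕ) : Decidable (Shift γ i k r r') := by
  unfold Shift; infer_instance

/-- The Jordan matrix with blocks of size `γ_i` and eigenvalue `z_i`. -/
def jordan (γ : Fin c → ℕ) (z : Fin c → ℂ) : Matrix (Fin N) (Fin N) ℂ :=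
  Matrix.of fun r r' => ∑ i,
    ((if Shift γ i 0 r r' then z i else 0) + (if Shift γ i 1 r r' then 1 else 0))

end Blocks

section Enveloping

/-- Defining relations of the enveloping algebra of the direct sum of the Takiff superalgebras
`gl[t]/t^{γ_c} gl[t]`. The generator `(c, k, i, j)` is `E^i_j ⊗ t^k` in the `c`-th summand, and
`s i` is the parity of the `i`-th basis vector. -/
inductive TakiffRel {I : Type} [DecidableEq I] (s : I → ℕ) {l : ℕ} (γ : Fin l → ℕ) :
    FreeAlgebra ℂ (Fin l × ℕ × I × I) → FreeAlgebra ℂ (Fin l × ℕ × I × I) → Prop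
  | trunc (c : Fin l) (k : ℕ) (i j : I) (h : γ c ≤ k) :
      TakiffRel s γ (FreeAlgebra.ι ℂ (c, k, i, j)) 0
  | comm (c c' : Fin l) (k k' : ℕ) (i j i' j' : I) :
      TakiffRel s γ
        (FreeAlgebra.ι ℂ (c, k, i, j) * FreeAlgebra.ι ℂ (c', k', i', j'))
        ((-1 : ℂ) ^ ((s i + s j) * (s i' + s j')) •
            (FreeAlgebra.ι ℂ (c', k', i', j') * FreeAlgebra.ι ℂ (c, k, i, j)) +
          if c = c' then
            (if j = i' then FreeAlgebra.ι ℂ (c, k + k', i, j') else 0) -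
            (-1 : ℂ) ^ ((s i + s j) * (s i' + s j')) •
              (if i = j' then FreeAlgebra.ι ℂ (c, k + k', i', j) else 0)
          else 0)

/-- The universal enveloping algebra of `⨁_c gl_I[t]/t^{γ_c} gl_I[t]`. -/
abbrev TakiffU {I : Type} [DecidableEq I] (s : I → ℕ) {l : ℕ} (γ : Fin l → ℕ) : Type :=
  RingQuot (TakiffRel s γ)

variable {I : Type} [DecidableEq I] (s : I → ℕ) {l : ℕ} (γ : Fin l → ℕ)

/-- The element `E^i_j ⊗ t^k` of the `c`-th summand. -/
def gen (c : Fin l) (k : ℕ) (i j : I) : TakiffU s γ :=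
  RingQuot.mkAlgHom ℂ (TakiffRel s γ) (FreeAlgebra.ι ℂ (c, k, i, j))

/-- The image of `E^i_j ⊗ t^r` under the evaluation map of order `γ` at `z`:
the expansion of `t^r = (z_c + (t - z_c))^r` in each summand. -/
def evalCurrent (z : Fin l → ℂ) (r : ℕ) (i j : I) : TakiffU s γ :=
  ∑ c, ∑ k ∈ Finset.range (r + 1), ((r.choose k : ℂ) * z c ^ (r - k)) • gen s γ c k i j

/-- The image of `E^i_j ⊗ t⁻¹` under `Ψ^μ_{(z, γ)}`, that is
`E^i_j ⊗ (t - z)⁻¹ + μ(E^i_j) = - ∑_r (E^i_j ⊗ t^r) z^{-r-1} + μ(E^i_j)` with the evaluation map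
applied to every coefficient. -/
def psi (z : Fin l → ℂ) (μ : I → I → ℂ) (i j : I) : PDO (TakiffU s γ) where
  coeff a b :=
    if b = 0 then
      if a = 0 then algebraMap ℂ _ (μ i j)
      else if a < 0 then -evalCurrent s γ z (-a - 1).toNat i j
      else 0
    else 0
  bdd := ⟨0, 0, fun a b h => by
    by_cases hb : b = 0
    · rcases lt_trichotomy a 0 with ha | ha | ha
      · omega
      · omega
      · simp [ha.ne', ha.not_gt] at h
    · simp [hb] at h⟩

end Enveloping

section Weyl

/-- The generators of a Weyl superalgebra: variables and the corresponding derivatives. -/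
inductive WeylGen (V : Type) : Type
  | var (v : V) : WeylGen V
  | der (v : V) : WeylGen V

/-- The canonical supercommutation relations; `s v` is the parity of the variable `v`. -/
inductive WeylRel {V : Type} [DecidableEq V] (s : V → ℕ) :
    FreeAlgebra ℂ (WeylGen V) → FreeAlgebra ℂ (WeylGen V) → Prop
  | var_var (u v : V) : WeylRel s
      (FreeAlgebra.ι ℂ (.var u) * FreeAlgebra.ι ℂ (.var v))
      ((-1 : ℂ) ^ (s u * s v) • (FreeAlgebra.ι ℂ (.var v) * FreeAlgebra.ι ℂ (.var u)))
  | der_der (u v : V) : WeylRel s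
      (FreeAlgebra.ι ℂ (.der u) * FreeAlgebra.ι ℂ (.der v))
      ((-1 : ℂ) ^ (s u * s v) • (FreeAlgebra.ι ℂ (.der v) * FreeAlgebra.ι ℂ (.der u)))
  | der_var (u v : V) : WeylRel s
      (FreeAlgebra.ι ℂ (.der u) * FreeAlgebra.ι ℂ (.var v))
      ((-1 : ℂ) ^ (s u * s v) • (FreeAlgebra.ι ℂ (.var v) * FreeAlgebra.ι ℂ (.der u)) +
        if u = v then 1 else 0)

/-- The Weyl superalgebra on variables `v : V` of parity `s v`. -/
abbrev Weyl {V : Type} [DecidableEq V] (s : V → ℕ) : Type := RingQuot (WeylRel s)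

variable {V : Type} [DecidableEq V] (s : V → ℕ)

/-- The variable `v`. -/
def var (v : V) : Weyl s := RingQuot.mkAlgHom ℂ (WeylRel s) (FreeAlgebra.ι ℂ (.var v))

/-- The derivative `∂/∂v`. -/
def der (v : V) : Weyl s := RingQuot.mkAlgHom ℂ (WeylRel s) (FreeAlgebra.ι ℂ (.der v))

theorem var_var (u v : V) : var s u * var s v = (-1 : ℂ) ^ (s u * s v) • (var s v * var s u) := by
  have := RingQuot.mkAlgHom_rel ℂ (WeylRel.var_var (s := s) u v)
  rw [map_mul, map_smul, map_mul] at this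
  exact this

theorem der_der (u v : V) : der s u * der s v = (-1 : ℂ) ^ (s u * s v) • (der s v * der s u) := by
  have := RingQuot.mkAlgHom_rel ℂ (WeylRel.der_der (s := s) u v)
  rw [map_mul, map_smul, map_mul] at this
  exact this

theorem der_var (u v : V) : der s u * var s v =
    (-1 : ℂ) ^ (s u * s v) • (var s v * der s u) + if u = v then 1 else 0 := by
  have := RingQuot.mkAlgHom_rel ℂ (WeylRel.der_var (s := s) u v)
  rw [map_mul, map_add, map_smul, map_mul, apply_ite (RingQuot.mkAlgHom ℂ (WeylRel s)), map_one,
    map_zero] at this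
  exact this

end Weyl

section Rho

variable {B V : Type*} [Ring B] [Algebra ℂ B] [Fintype V] [DecidableEq V]

/-- The element `∑ W(u,v) P_u Q_v`. -/
def rho (P Q : V → B) (W : Matrix V V ℂ) : B := ∑ u, ∑ v, W u v • (P u * Q v)

theorem rho_add (P Q : V → B) (W W' : Matrix V V ℂ) :
    rho P Q (W + W') = rho P Q W + rho P Q W' := by
  simp [rho, add_smul, Finset.sum_add_distrib]

theorem rho_smul (P Q : V → B) (e : ℂ) (W : Matrix V V ℂ) :
    rho P Q (e • W) = e • rho P Q W := by
  simp [rho, Finset.smul_sum, smul_smul]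

theorem rho_zero (P Q : V → B) : rho P Q (0 : Matrix V V ℂ) = 0 := by simp [rho]

/-- Elements satisfying the canonical supercommutation relations. -/
structure CCR (s : V → ℕ) (P Q : V → B) : Prop where
  pp : ∀ u v, P u * P v = (-1 : ℂ) ^ (s u * s v) • (P v * P u)
  qq : ∀ u v, Q u * Q v = (-1 : ℂ) ^ (s u * s v) • (Q v * Q u)
  qp : ∀ u v, Q u * P v = (-1 : ℂ) ^ (s u * s v) • (P v * Q u) + if u = v then 1 else 0

theorem neg_one_pow_congr {a b : ℕ} (h : (a : ZMod 2) = b) : (-1 : ℂ) ^ a = (-1) ^ b := by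
  have := (ZMod.natCast_eq_natCast_iff' a b 2).1 h
  rw [neg_one_pow_eq_pow_mod_two, this, ← neg_one_pow_eq_pow_mod_two]

theorem CCR.quad {s : V → ℕ} {P Q : V → B} (h : CCR s P Q) (u v u' v' : V) :
    (P u * Q v) * (P u' * Q v') =
      (-1 : ℂ) ^ ((s u + s v) * (s u' + s v')) • ((P u' * Q v') * (P u * Q v)) +
      (if v = u' then P u * Q v' else 0) -
      (-1 : ℂ) ^ ((s u + s v) * (s u' + s v')) • (if v' = u then P u' * Q v else 0) := by
  have e1 : (P u * Q v) * (P u' * Q v') = (-1 : ℂ) ^ (s v * s u') • (P u * P u' * (Q v * Q v')) +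
      (if v = u' then P u * Q v' else 0) := by
    calc (P u * Q v) * (P u' * Q v') = P u * (Q v * P u') * Q v' := by noncomm_ring
      _ = _ := by
        rw [h.qp]
        split_ifs <;> simp [mul_add, add_mul, mul_assoc]
  have e2 : (P u' * Q v') * (P u * Q v) =
      ((-1 : ℂ) ^ (s v' * s u) * ((-1 : ℂ) ^ (s u' * s u) * (-1 : ℂ) ^ (s v' * s v))) •
        (P u * P u' * (Q v * Q v')) + (if v' = u then P u' * Q v else 0) := by
    calc (P u' * Q v') * (P u * Q v) = P u' * (Q v' * P u) * Q v := by noncomm_ring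
      _ = (-1 : ℂ) ^ (s v' * s u) • ((P u' * P u) * (Q v' * Q v)) +
          (if v' = u then P u' * Q v else 0) := by
        rw [h.qp]
        split_ifs <;> simp [mul_add, add_mul, mul_assoc]
      _ = _ := by
        rw [h.pp u' u, h.qq v' v, smul_mul_smul_comm, smul_smul]
  rw [e1, e2, smul_add, smul_smul]
  have e3 : (-1 : ℂ) ^ ((s u + s v) * (s u' + s v')) *
      ((-1 : ℂ) ^ (s v' * s u) * ((-1 : ℂ) ^ (s u' * s u) * (-1 : ℂ) ^ (s v' * s v)))
      = (-1) ^ (s v * s u') := by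
    rw [← pow_add, ← pow_add, ← pow_add]
    apply neg_one_pow_congr
    have h2 : (2 : ZMod 2) = 0 := rfl
    push_cast
    linear_combination ((s v' : ZMod 2) * s u + s u' * s u + s v' * s v) * h2
  rw [e3]
  abel

theorem sum_contract (W W' : Matrix V V ℂ) (F : V → V → B) :
    ∑ x : V × V, ∑ y : V × V, (if x.2 = y.1 then (W x.1 x.2 * W' y.1 y.2) • F x.1 y.2 else 0) =
      ∑ u, ∑ v, (W * W') u v • F u v := by
  simp only [Fintype.sum_prod_type]
  refine Finset.sum_congr rfl fun u _ => ?_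
  have : ∀ w : V, (∑ u' : V, ∑ v : V, if w = u' then (W u w * W' u' v) • F u v else 0) =
      ∑ v : V, (W u w * W' w v) • F u v := fun w => by
    rw [Finset.sum_eq_single w (fun u' _ h => by simp [h.symm]) (by simp)]
    simp
  simp only [this]
  rw [Finset.sum_comm]
  simp only [Matrix.mul_apply, Finset.sum_smul]

theorem CCR.rho_mul {s : V → ℕ} {P Q : V → B} (h : CCR s P Q) (W W' : Matrix V V ℂ) (e : ℕ)
    (he : ∀ u v u' v', W u v ≠ 0 → W' u' v' ≠ 0 →
      (((s u + s v) * (s u' + s v') : ℕ) : ZMod 2) = e) :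
    rho P Q W * rho P Q W' = (-1 : ℂ) ^ e • (rho P Q W' * rho P Q W) +
      rho P Q (W * W') - (-1 : ℂ) ^ e • rho P Q (W' * W) := by
  have hW : ∀ W : Matrix V V ℂ, rho P Q W = ∑ x : V × V, W x.1 x.2 • (P x.1 * Q x.2) := fun W => by
    rw [rho, Fintype.sum_prod_type]
  have key : rho P Q W * rho P Q W' = ∑ x : V × V, ∑ y : V × V,
      ((-1 : ℂ) ^ e • ((W' y.1 y.2 • (P y.1 * Q y.2)) * (W x.1 x.2 • (P x.1 * Q x.2))) +
        (if x.2 = y.1 then (W x.1 x.2 * W' y.1 y.2) • (P x.1 * Q y.2) else 0) -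
        (-1 : ℂ) ^ e • (if y.2 = x.1 then (W' y.1 y.2 * W x.1 x.2) • (P y.1 * Q x.2) else 0)) := by
    rw [hW, hW, Finset.sum_mul_sum]
    refine Finset.sum_congr rfl fun x _ => Finset.sum_congr rfl fun y _ => ?_
    obtain ⟨u, v⟩ := x
    obtain ⟨u', v'⟩ := y
    dsimp only
    by_cases h1 : W u v = 0
    · simp [h1]
    by_cases h2 : W' u' v' = 0
    · simp [h2]
    rw [smul_mul_smul_comm, smul_mul_smul_comm, h.quad u v u' v',
      neg_one_pow_congr (he u v u' v' h1 h2), mul_comm (W' u' v')]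
    simp only [smul_add, smul_sub, smul_ite, smul_zero]
    rw [smul_comm (W u v * W' u' v') ((-1 : ℂ) ^ e), smul_comm (W u v * W' u' v') ((-1 : ℂ) ^ e)]
  rw [key]
  simp only [Finset.sum_add_distrib, Finset.sum_sub_distrib, ← Finset.smul_sum]
  congr 1
  · congr 1
    · congr 1
      rw [hW W, hW W', Finset.sum_mul_sum, Finset.sum_comm]
    · exact sum_contract W W' fun u v => P u * Q v
  · congr 1
    rw [Finset.sum_comm]
    exact sum_contract W' W fun u v => P u * Q v

end Rho

section ShiftMatrices

variable {c N : ℕ}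

theorem blockStart_mono (γ : Fin c → ℕ) {i j : ℕ} (h : i ≤ j) :
    blockStart γ i ≤ blockStart γ j := by
  refine Finset.sum_le_sum fun a _ => ?_
  split_ifs <;> omega

theorem blockStart_succ (γ : Fin c → ℕ) (i : Fin c) :
    blockStart γ (i + 1) = blockStart γ i + γ i := by
  have h : γ i = ∑ j : Fin c, if j = i then γ j else 0 := by simp
  rw [blockStart, blockStart]
  conv_rhs => rw [h]
  rw [← Finset.sum_add_distrib]
  refine Finset.sum_congr rfl fun j _ => ?_
  have : j = i ↔ (j : ℕ) = i := Fin.ext_iff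
  split_ifs <;> omega

/-- The matrix of the relation `Shift γ i k`. -/
def shiftMat (γ : Fin c → ℕ) (i : Fin c) (k : ℕ) : Matrix (Fin N) (Fin N) ℂ :=
  Matrix.of fun r r' => if Shift γ i k r r' then 1 else 0

theorem shiftMat_mul (γ : Fin c → ℕ) (i i' : Fin c) (k k' : ℕ) :
    (shiftMat γ i k * shiftMat γ i' k' : Matrix (Fin N) (Fin N) ℂ) =
      if i = i' then shiftMat γ i (k + k') else 0 := by
  ext r r'
  rw [Matrix.mul_apply]
  by_cases h : i = i'
  · subst h
    rw [if_pos rfl]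
    simp only [shiftMat, Matrix.of_apply]
    by_cases hs : Shift γ i (k + k') r r'
    · rw [if_pos hs]
      obtain ⟨h1, h2, h3⟩ := hs
      have hlt : (r : ℕ) + k < N := by have := r'.isLt; omega
      rw [Finset.sum_eq_single ⟨r + k, hlt⟩]
      · rw [if_pos ⟨h1, rfl, by dsimp only; omega⟩,
          if_pos ⟨by dsimp only; omega, by dsimp only; omega, h3⟩, one_mul]
      · intro x _ hx
        rw [if_neg, zero_mul]
        rintro ⟨-, h5, -⟩
        exact hx (Fin.ext h5.symm)
      · simp
    · rw [if_neg hs]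
      refine Finset.sum_eq_zero fun x _ => ?_
      by_cases h1 : Shift γ i k r x
      · rw [if_neg (c := Shift γ i k' x r'), mul_zero]
        rintro ⟨h4, h5, h6⟩
        obtain ⟨h1, h2, h3⟩ := h1
        exact hs ⟨h1, by omega, h6⟩
      · rw [if_neg h1, zero_mul]
  · rw [if_neg h]
    refine Finset.sum_eq_zero fun x _ => ?_
    simp only [shiftMat, Matrix.of_apply]
    by_cases h1 : Shift γ i k r x
    · rw [if_neg (c := Shift γ i' k' x r'), mul_zero]
      rintro ⟨h4, h5, h6⟩
      obtain ⟨h1, h2, h3⟩ := h1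
      have hne : (i : ℕ) ≠ i' := fun h' => h (Fin.ext h')
      rcases lt_or_gt_of_ne hne with h' | h'
      · have := blockStart_mono γ (show (i : ℕ) + 1 ≤ i' by omega)
        omega
      · have := blockStart_mono γ (show (i' : ℕ) + 1 ≤ i by omega)
        omega
    · rw [if_neg h1, zero_mul]

theorem shiftMat_trunc (γ : Fin c → ℕ) (i : Fin c) (k : ℕ) (h : γ i ≤ k) :
    (shiftMat γ i k : Matrix (Fin N) (Fin N) ℂ) = 0 := by
  ext r r'
  simp only [shiftMat, Matrix.of_apply, Matrix.zero_apply]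
  rw [if_neg]
  rintro ⟨h1, h2, h3⟩
  rw [blockStart_succ] at h3
  omega

end ShiftMatrices

section Fock

variable (d p q m n : ℕ)

/-- The parity of the (zero-based) index `i`: the indices split consecutively into `p` even,
`q` odd, `m` even and then odd ones. -/
def parity (p q m : ℕ) (i : ℕ) : ℕ := if i < p ∨ (p + q ≤ i ∧ i < p + q + m) then 0 else 1

/-- The variables: `(r, a)` is `y^a_r` for `r < p + q`, and `x^a_{r - (p + q)}` otherwise. -/
abbrev FockVar : Type := Fin (p + q + m + n) × Fin d

/-- The parity of a variable. -/
def fockParity (v : FockVar d p q m n) : ℕ := parity p q m v.1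

/-- The Weyl superalgebra of `d(p+m)` bosonic and `d(q+n)` fermionic oscillators. -/
abbrev FockWeyl : Type := Weyl (fockParity d p q m n)

/-- Creation operators of the oscillator realization. -/
def creation (v : FockVar d p q m n) : FockWeyl d p q m n :=
  if (v.1 : ℕ) < p + q then der _ v else var _ v

/-- Annihilation operators of the oscillator realization. -/
def annihilation (v : FockVar d p q m n) : FockWeyl d p q m n :=
  if (v.1 : ℕ) < p + q then (-1 : ℂ) ^ (parity p q m v.1 + 1) • var _ v else der _ v

theorem fock_ccr :
    CCR (fockParity d p q m n) (creation d p q m n) (annihilation d p q m n) := by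
  have sq : ∀ k : ℕ, (-1 : ℂ) ^ k * (-1) ^ k = 1 := fun k => by
    rw [← mul_pow]; simp
  have vd : ∀ u v : FockVar d p q m n, var (fockParity d p q m n) v * der _ u =
      (-1 : ℂ) ^ (fockParity d p q m n u * fockParity d p q m n v) •
        (der _ u * var _ v - if u = v then 1 else 0) := fun u v => by
    rw [der_var, add_sub_cancel_right, smul_smul, sq, one_smul]
  refine ⟨fun u v => ?_, fun u v => ?_, fun u v => ?_⟩
  · unfold creation
    split_ifs with h1 h2 h2
    · exact der_der _ u v
    · rw [der_var, if_neg (by rintro rfl; exact h2 h1), add_zero]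
    · rw [vd, if_neg (by rintro rfl; exact h1 h2), sub_zero, mul_comm (fockParity _ _ _ _ _ v)]
    · exact var_var _ u v
  · unfold annihilation
    split_ifs with h1 h2 h2
    · rw [smul_mul_smul_comm, smul_mul_smul_comm, var_var, smul_comm, mul_comm ((-1 : ℂ) ^ _)]
    · rw [smul_mul_assoc, vd, if_neg (by rintro rfl; exact h2 h1), sub_zero, mul_smul_comm,
        smul_comm, mul_comm (fockParity _ _ _ _ _ v)]
    · rw [smul_mul_assoc, mul_smul_comm, der_var, if_neg (by rintro rfl; exact h1 h2), add_zero,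
        smul_comm]
    · exact der_der _ u v
  · unfold annihilation creation
    by_cases h1 : (u.1 : ℕ) < p + q <;> by_cases h2 : (v.1 : ℕ) < p + q
    · rw [if_pos h1, if_pos h2, smul_mul_assoc, vd, mul_smul_comm, smul_sub, smul_sub, smul_comm,
        mul_comm (fockParity _ _ _ _ _ v), sub_eq_add_neg]
      congr 1
      by_cases h : u = v
      · subst h
        rw [if_pos rfl, smul_smul, ← neg_smul, ← pow_add, neg_eq_neg_one_mul, ← pow_succ',
          neg_one_pow_congr (b := 0), pow_zero, one_smul]
        rw [fockParity]
        generalize parity p q m u.1 = k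
        rw [Nat.cast_zero, ZMod.natCast_eq_zero_iff_even]
        have := Nat.even_mul_succ_self k
        have h3 : k + 1 + k * k + 1 = k * (k + 1) + 2 := by ring
        rw [h3]
        exact this.add even_two
      · rw [if_neg h, if_neg (Ne.symm h)]
        simp
    · rw [if_pos h1, if_neg h2, smul_mul_assoc, var_var, mul_smul_comm, smul_comm,
        if_neg (by rintro rfl; exact h2 h1), add_zero]
    · rw [if_neg h1, if_pos h2, der_der, if_neg (by rintro rfl; exact h1 h2), add_zero]
    · rw [if_neg h1, if_neg h2, der_var]

variable {d p q m n}

/-- With zero-based indices, the image of `E^r_s ⊗ t^k` (in the `a`-th summand, for `x = (a, k, r, s)`) in the Weyl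
superalgebra, for the realization of the enveloping algebra of `⨁_a gl_{p+m|q+n}[t]/t^{ξ_a}`. -/
def varphiGen {d' : ℕ} (ξ : Fin d' → ℕ)
    (x : Fin d' × ℕ × Fin (p + q + m + n) × Fin (p + q + m + n)) : FockWeyl d p q m n :=
  match x with
  | (a, k, r, s) =>
    ∑ α : Fin d, ∑ β : Fin d,
      if Shift ξ a k α β then
        if (r : ℕ) < p + q then
          if (s : ℕ) < p + q then
            (-1 : ℂ) ^ (parity p q m s + 1) • (der _ (r, β) * var _ (s, α))
          else der _ (r, β) * der _ (s, α)
        else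
          if (s : ℕ) < p + q then
            (-1 : ℂ) ^ (parity p q m s + 1) • (var _ (r, β) * var _ (s, α))
          else var _ (r, β) * der _ (s, α)
      else 0

theorem varphiGen_eq {d' : ℕ} (ξ : Fin d' → ℕ) (a : Fin d') (k : ℕ)
    (r s : Fin (p + q + m + n)) :
    (varphiGen ξ (a, k, r, s) : FockWeyl d p q m n) =
      rho (creation d p q m n) (annihilation d p q m n)
        (Matrix.kronecker (Matrix.single r s 1) (shiftMat ξ a k).transpose) := by
  rw [rho, Fintype.sum_prod_type, Finset.sum_eq_single r, varphiGen, Finset.sum_comm]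
  · refine Finset.sum_congr rfl fun β _ => ?_
    rw [Fintype.sum_prod_type, Finset.sum_eq_single s]
    · refine Finset.sum_congr rfl fun α _ => ?_
      simp only [Matrix.kronecker, Matrix.kroneckerMap_apply, Matrix.single_apply_same, one_mul,
        Matrix.transpose_apply, shiftMat, Matrix.of_apply, ite_smul, one_smul, zero_smul,
        creation, annihilation]
      split_ifs <;> simp
    · intro s' _ hs
      simp [Matrix.kronecker, Matrix.single_apply, hs.symm]
    · simp
  · intro r' _ hr
    simp [Matrix.kronecker, Matrix.single_apply, hr.symm]
  · simp

theorem kron_single_ne {c : ℕ} (γ : Fin c → ℕ) {N M : ℕ} (i : Fin c) (k : ℕ) (r s : Fin N)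
    (u v : Fin N × Fin M)
    (h : Matrix.kronecker (Matrix.single r s (1 : ℂ)) (shiftMat γ i k).transpose u v ≠ 0) :
    u.1 = r ∧ v.1 = s := by
  by_contra h'
  apply h
  have : ¬ (r = u.1 ∧ s = v.1) := fun h2 => h' ⟨h2.1.symm, h2.2.symm⟩
  simp [Matrix.kronecker, Matrix.single_apply, this]

theorem kron_mul {c : ℕ} (γ : Fin c → ℕ) {N M : ℕ} (i i' : Fin c) (k k' : ℕ) (r s r' s' : Fin N) :
    (Matrix.kronecker (Matrix.single r s (1 : ℂ)) (shiftMat γ i k).transpose *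
      Matrix.kronecker (Matrix.single r' s' (1 : ℂ)) (shiftMat γ i' k').transpose :
        Matrix (Fin N × Fin M) (Fin N × Fin M) ℂ) =
      if i = i' ∧ s = r' then
        Matrix.kronecker (Matrix.single r s' (1 : ℂ)) (shiftMat γ i (k + k')).transpose else 0 := by
  unfold Matrix.kronecker
  rw [← Matrix.mul_kronecker_mul, ← Matrix.transpose_mul, shiftMat_mul]
  by_cases h : s = r'
  · subst h
    rw [Matrix.single_mul_single_same, mul_one]
    by_cases hi : i = i'
    · subst hi; simp [add_comm]
    · simp [hi, Ne.symm hi]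
  · rw [Matrix.single_mul_single_of_ne _ _ _ _ h]
    simp [h]

theorem rho_ite (P : Prop) [Decidable P] {B V : Type*} [Ring B] [Algebra ℂ B] [Fintype V]
    (f g : V → B) (W : Matrix V V ℂ) :
    rho f g (if P then W else 0) = if P then rho f g W else 0 := by
  split_ifs
  · rfl
  · simp [rho]

/-- The homomorphism from the enveloping algebra of `⨁_a gl_{p+m|q+n}[t]/t^{ξ_a}` to the Weyl
superalgebra. -/
def varphi {d' : ℕ} (ξ : Fin d' → ℕ) :
    TakiffU (fun r : Fin (p + q + m + n) => parity p q m r) ξ →ₐ[ℂ] FockWeyl d p q m n :=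
  RingQuot.liftAlgHom ℂ ⟨FreeAlgebra.lift ℂ (varphiGen ξ), by
    intro x y h
    induction h with
    | trunc c k i j h =>
      rw [FreeAlgebra.lift_ι_apply, map_zero, varphiGen_eq, shiftMat_trunc _ _ _ h]
      simp [Matrix.kronecker, rho_zero]
    | comm c c' k k' i j i' j' =>
      simp only [map_add, map_mul, map_sub, map_smul, FreeAlgebra.lift_ι_apply, map_zero,
        apply_ite (FreeAlgebra.lift ℂ (varphiGen (d := d) (p := p) (q := q) (m := m) (n := n) ξ)),
        varphiGen_eq]
      rw [(fock_ccr d p q m n).rho_mul _ _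
        ((parity p q m i + parity p q m j) * (parity p q m i' + parity p q m j')), kron_mul,
        kron_mul, rho_ite, rho_ite, add_sub_assoc]
      · congr 1
        by_cases hc : c = c'
        · subst hc
          simp [add_comm k' k, eq_comm]
        · simp [hc, Ne.symm hc]
      · intro u v u' v' h1 h2
        obtain ⟨e1, e2⟩ := kron_single_ne _ _ _ _ _ _ _ h1
        obtain ⟨e3, e4⟩ := kron_single_ne _ _ _ _ _ _ _ h2
        simp only [fockParity, e1, e2, e3, e4]⟩

/-- The sequence `γ` decomposes `p`, `q`, `m`, `n` into sums of `p'`, `q'`, `m'`, `n'` terms. -/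
def BlockSums (p q m n p' q' m' n' : ℕ) (γ : Fin (p' + q' + m' + n') → ℕ) : Prop :=
  (∑ i : Fin (p' + q' + m' + n'), if (i : ℕ) < p' then γ i else 0) = p ∧
  (∑ i : Fin (p' + q' + m' + n'), if p' ≤ (i : ℕ) ∧ (i : ℕ) < p' + q' then γ i else 0) = q ∧
  (∑ i : Fin (p' + q' + m' + n'), if p' + q' ≤ (i : ℕ) ∧ (i : ℕ) < p' + q' + m' then γ i else 0) = m ∧
  (∑ i : Fin (p' + q' + m' + n'), if p' + q' + m' ≤ (i : ℕ) then γ i else 0) = n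

variable {p' q' m' n' : ℕ} {γ : Fin (p' + q' + m' + n') → ℕ}

theorem BlockSums.starts (hγ : BlockSums p q m n p' q' m' n' γ) :
    blockStart γ p' = p ∧ blockStart γ (p' + q') = p + q ∧
      blockStart γ (p' + q' + m') = p + q + m := by
  obtain ⟨h1, h2, h3, -⟩ := hγ
  refine ⟨h1, ?_, ?_⟩
  · rw [← h1, ← h2, ← Finset.sum_add_distrib, blockStart]
    refine Finset.sum_congr rfl fun i _ => ?_
    split_ifs <;> omega
  · rw [← h1, ← h2, ← h3, ← Finset.sum_add_distrib, ← Finset.sum_add_distrib, blockStart]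
    refine Finset.sum_congr rfl fun i _ => ?_
    split_ifs <;> omega

theorem BlockSums.shift (hγ : BlockSums p q m n p' q' m' n' γ) {i : Fin (p' + q' + m' + n')}
    {k r r' : ℕ} (h : Shift γ i k r r') :
    (r < p + q ↔ r' < p + q) ∧ parity p q m r = parity p q m r' := by
  obtain ⟨e1, e2, e3⟩ := hγ.starts
  obtain ⟨h1, h2, h3⟩ := h
  have key : ∀ a : ℕ, (r < blockStart γ a ↔ r' < blockStart γ a) := fun a => by
    rcases Nat.lt_or_ge (i : ℕ) a with ha | ha
    · have := blockStart_mono γ (show (i : ℕ) + 1 ≤ a from ha)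
      omega
    · have := blockStart_mono γ ha
      omega
  have k1 := key p'
  have k2 := key (p' + q')
  have k3 := key (p' + q' + m')
  rw [e1] at k1
  rw [e2] at k2
  rw [e3] at k3
  refine ⟨k2, ?_⟩
  unfold parity
  congr 1
  apply propext
  omega

/-- The image of `e_{ab} ⊗ t^k` (in the `i`-th summand, for `x = (i, k, a, b)`) in the Weyl
superalgebra, for the realization of the enveloping algebra of `⨁_i gl_d[t]/t^{γ_i}`. -/
def phiGen {l : ℕ} (γ : Fin l → ℕ) (x : Fin l × ℕ × Fin d × Fin d) : FockWeyl d p q m n :=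
  match x with
  | (i, k, a, b) =>
    ∑ r : Fin (p + q + m + n), ∑ r' : Fin (p + q + m + n),
      if Shift γ i k r r' then
        if (r : ℕ) < p + q then -(var _ (r, b) * der _ (r', a))
        else (-1 : ℂ) ^ parity p q m r • (der _ (r, b) * var _ (r', a))
      else 0

theorem phiGen_eq (hγ : BlockSums p q m n p' q' m' n' γ) (i : Fin (p' + q' + m' + n')) (k : ℕ) :
    ∃ κ : ℂ, ∀ a b : Fin d, (phiGen γ (i, k, a, b) : FockWeyl d p q m n) =
      rho (creation d p q m n) (annihilation d p q m n)
        (Matrix.kronecker (shiftMat γ i k).transpose (Matrix.single a b 1)) +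
      if a = b then algebraMap ℂ _ κ else 0 := by
  refine ⟨∑ r : Fin (p + q + m + n), ∑ r' : Fin (p + q + m + n),
    if Shift γ i k r r' ∧ r = r' then (-1 : ℂ) ^ parity p q m r else 0, fun a b => ?_⟩
  have h1 : rho (creation d p q m n) (annihilation d p q m n)
      (Matrix.kronecker (shiftMat γ i k).transpose (Matrix.single a b 1)) =
      ∑ r : Fin (p + q + m + n), ∑ r' : Fin (p + q + m + n), if Shift γ i k r r' then
        creation d p q m n (r', a) * annihilation d p q m n (r, b) else 0 := by
    rw [rho, Fintype.sum_prod_type]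
    conv_rhs => rw [Finset.sum_comm]
    refine Finset.sum_congr rfl fun r' _ => ?_
    rw [Finset.sum_eq_single a, Fintype.sum_prod_type]
    · refine Finset.sum_congr rfl fun r _ => ?_
      rw [Finset.sum_eq_single b]
      · simp [Matrix.kronecker, shiftMat]
      · intro b' _ hb
        simp [Matrix.kronecker, Matrix.single_apply, hb.symm]
      · simp
    · intro a' _ ha
      simp [Matrix.kronecker, Matrix.single_apply, ha.symm]
    · simp
  have h2 : (if a = b then algebraMap ℂ (FockWeyl d p q m n)
      (∑ r : Fin (p + q + m + n), ∑ r' : Fin (p + q + m + n),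
        if Shift γ i k r r' ∧ r = r' then (-1 : ℂ) ^ parity p q m r else 0) else 0) =
      ∑ r : Fin (p + q + m + n), ∑ r' : Fin (p + q + m + n), if Shift γ i k r r' then
        (-1 : ℂ) ^ parity p q m r • (if (r, b) = (r', a) then 1 else 0) else 0 := by
    by_cases hab : a = b
    · subst hab
      simp only [if_true, map_sum, Prod.mk.injEq, and_true]
      refine Finset.sum_congr rfl fun r _ => Finset.sum_congr rfl fun r' _ => ?_
      by_cases hs : Shift γ i k r r' <;> by_cases hr : r = r' <;>
        simp [hs, hr, Algebra.algebraMap_eq_smul_one]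
    · simp [hab, Ne.symm hab]
  rw [h1, h2, phiGen, ← Finset.sum_add_distrib]
  refine Finset.sum_congr rfl fun r _ => ?_
  rw [← Finset.sum_add_distrib]
  refine Finset.sum_congr rfl fun r' _ => ?_
  by_cases hs : Shift γ i k r r'
  · rw [if_pos hs, if_pos hs, if_pos hs]
    obtain ⟨g1, g2⟩ := hγ.shift hs
    have hq := (fock_ccr d p q m n).qp (r, b) (r', a)
    have e1 : (if (r : ℕ) < p + q then -(var (fockParity d p q m n) (r, b) * der _ (r', a))
        else (-1 : ℂ) ^ parity p q m r • (der _ (r, b) * var _ (r', a))) =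
        (-1 : ℂ) ^ parity p q m r •
          (annihilation d p q m n (r, b) * creation d p q m n (r', a)) := by
      unfold annihilation creation
      by_cases hr : (r : ℕ) < p + q
      · have hr' := g1.1 hr
        simp only [hr, hr', if_true]
        rw [smul_mul_assoc, smul_smul, ← pow_add, neg_one_pow_congr (b := 1), pow_one, neg_one_smul]
        have h2 : (2 : ZMod 2) = 0 := rfl
        push_cast
        linear_combination (parity p q m r : ZMod 2) * h2
      · have hr' : ¬ (r' : ℕ) < p + q := fun h => hr (g1.2 h)
        simp only [hr, hr', if_false]
    rw [e1, hq, smul_add, smul_smul, ← pow_add]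
    congr 1
    have : (-1 : ℂ) ^ (parity p q m r +
        fockParity d p q m n (r, b) * fockParity d p q m n (r', a)) = (-1) ^ 0 := by
      apply neg_one_pow_congr
      simp only [fockParity, ← g2]
      rw [Nat.cast_zero, ZMod.natCast_eq_zero_iff_even]
      have := Nat.even_mul_succ_self (parity p q m r)
      convert this using 1
      ring
    rw [this, pow_zero, one_smul]
  · simp [hs]

theorem kron_mul' {c : ℕ} (γ : Fin c → ℕ) {N M : ℕ} (i i' : Fin c) (k k' : ℕ) (r s r' s' : Fin N) :
    (Matrix.kronecker (shiftMat γ i k).transpose (Matrix.single r s (1 : ℂ)) *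
      Matrix.kronecker (shiftMat γ i' k').transpose (Matrix.single r' s' (1 : ℂ)) :
        Matrix (Fin M × Fin N) (Fin M × Fin N) ℂ) =
      if i = i' ∧ s = r' then
        Matrix.kronecker (shiftMat γ i (k + k')).transpose (Matrix.single r s' (1 : ℂ)) else 0 := by
  unfold Matrix.kronecker
  rw [← Matrix.mul_kronecker_mul, ← Matrix.transpose_mul, shiftMat_mul]
  by_cases h : s = r'
  · subst h
    rw [Matrix.single_mul_single_same, mul_one]
    by_cases hi : i = i'
    · subst hi; simp [add_comm]
    · simp [hi, Ne.symm hi]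
  · rw [Matrix.single_mul_single_of_ne _ _ _ _ h]
    simp [h]

/-- The homomorphism from the enveloping algebra of `⨁_i gl_d[t]/t^{γ_i}` to the Weyl
superalgebra. -/
def phi (hγ : BlockSums p q m n p' q' m' n' γ) :
    TakiffU (fun _ : Fin d => 0) γ →ₐ[ℂ] FockWeyl d p q m n :=
  RingQuot.liftAlgHom ℂ ⟨FreeAlgebra.lift ℂ (phiGen γ), by
    choose κ hκ using fun i k => phiGen_eq (d := d) hγ i k
    intro x y h
    induction h with
    | trunc c k i j h =>
      rw [FreeAlgebra.lift_ι_apply, map_zero, phiGen]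
      refine Finset.sum_eq_zero fun r _ => Finset.sum_eq_zero fun r' _ => if_neg ?_
      rintro ⟨h1, h2, h3⟩
      rw [blockStart_succ] at h3
      omega
    | comm c c' k k' i j i' j' =>
      simp only [map_add, map_mul, map_sub, FreeAlgebra.lift_ι_apply, map_zero,
        apply_ite (FreeAlgebra.lift ℂ (phiGen (d := d) (p := p) (q := q) (m := m) (n := n) γ)),
        hκ, add_zero, mul_zero, pow_zero, one_smul]
      have hq := (fock_ccr d p q m n).rho_mul
        (Matrix.kronecker (shiftMat γ c k).transpose (Matrix.single i j 1))
        (Matrix.kronecker (shiftMat γ c' k').transpose (Matrix.single i' j' 1)) 0 (by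
          intro u v u' v' h1 h2
          have : (shiftMat γ c k : Matrix (Fin (p + q + m + n)) (Fin (p + q + m + n)) ℂ)
              v.1 u.1 ≠ 0 := fun h0 => h1 (by simp [Matrix.kronecker, h0])
          have h3 : Shift γ c k v.1 u.1 := by
            by_contra h0
            exact this (by simp [shiftMat, h0])
          have := (hγ.shift h3).2
          rw [Nat.cast_zero, ZMod.natCast_eq_zero_iff_even]
          refine Even.mul_right ?_ _
          simp only [fockParity, this]
          exact ⟨_, rfl⟩)
      rw [kron_mul', kron_mul', rho_ite, rho_ite, pow_zero, one_smul, one_smul] at hq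
      have comm1 : ∀ (P : Prop) [Decidable P] (e : ℂ) (y : FockWeyl d p q m n),
          y * (if P then algebraMap ℂ _ e else 0) = (if P then algebraMap ℂ _ e else 0) * y := by
        intro P _ e y
        split_ifs
        · exact (Algebra.commutes e y).symm
        · simp
      rw [add_mul, mul_add, mul_add, add_mul, mul_add, mul_add, hq,
        comm1 _ _ (rho _ _ (Matrix.kronecker (shiftMat γ c k).transpose (Matrix.single i j 1))),
        comm1 (i = j) _ (if i' = j' then _ else _),
        comm1 _ _ (rho _ _ (Matrix.kronecker (shiftMat γ c' k').transpose (Matrix.single i' j' 1)))]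
      by_cases hc : c = c'
      · subst hc
        simp only [true_and, if_true, add_comm k' k, eq_comm (a := j') (b := i)]
        by_cases h1 : j = i' <;> by_cases h2 : i = j'
        · subst h1 h2
          simp only [if_true, eq_comm (a := j) (b := i)]
          abel
        · have h3 : ¬ j' = i := fun h => h2 h.symm
          simp only [h1, h2, if_true, if_false]
          abel
        · have h3 : ¬ i' = j := fun h => h1 h.symm
          simp only [h1, h2, h3, if_true, if_false]
          abel
        · simp only [h1, h2, if_false]
          abel
      · simp only [hc, Ne.symm hc, false_and, if_false]
        abel⟩

end Fock

section Operators

variable {d p q m n : ℕ}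

/-- The matrix `- [ω(δ_{ij} ∂ - Ψ^μ_{(z, γ)}(e_{ji} ⊗ t⁻¹))]`. -/
def Lhat {l : ℕ} (γ : Fin l → ℕ) (z : Fin l → ℂ) (μ : Fin d → Fin d → ℂ) :
    Matrix (Fin d) (Fin d) (PDO (TakiffU (fun _ : Fin d => 0) γ)) :=
  Matrix.of fun i j =>
    -PDO.fourier ((if i = j then PDO.del else 0) - psi (fun _ => 0) γ z μ j i)

/-- The matrix `[Ψ^ν_{(w, ξ)}(δ_{ij} τ + (-1)^{|i|} E^i_j ⊗ t⁻¹)]`, where `τ ↦ ∂`. -/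
def Lsuper {l : ℕ} (ξ : Fin l → ℕ) (w : Fin l → ℂ)
    (ν : Fin (p + q + m + n) → Fin (p + q + m + n) → ℂ) :
    Matrix (Fin (p + q + m + n)) (Fin (p + q + m + n))
      (PDO (TakiffU (fun r : Fin (p + q + m + n) => parity p q m r) ξ)) :=
  Matrix.of fun i j =>
    (if i = j then PDO.del else 0) + (-1) ^ parity p q m i * psi _ ξ w ν i j

/-- The functional `μ(e_{ab}) = - J_ξ(w)_{ab}`. -/
def muJordan {l : ℕ} (ξ : Fin l → ℕ) (w : Fin l → ℂ) (a b : Fin d) : ℂ := -jordan ξ w a b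

variable (p q m n) in
/-- The functional `ν(E^i_j) = (-1)^{|i|+1} J_γ(z)_{ij}`. -/
def nuJordan {l : ℕ} (γ : Fin l → ℕ) (z : Fin l → ℂ) (i j : Fin (p + q + m + n)) : ℂ :=
  (-1) ^ (parity p q m i + 1) * jordan γ z i j

/-- The signed order `[γ_i]`: it is `γ_i` for the even blocks and `-γ_i` for the odd ones. -/
def signedOrder (p' q' m' : ℕ) {l : ℕ} (γ : Fin l → ℕ) (i : Fin l) : ℤ :=
  if (i : ℕ) < p' ∨ (p' + q' ≤ (i : ℕ) ∧ (i : ℕ) < p' + q' + m') then (γ i : ℤ) else -(γ i : ℤ)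

end Operators

end Gaudin

end

/-!
# Duality of Lax matrices for the Gaudin models of `gl_d` and `gl_{p+m|q+n}`

Both sides of the identity come from one block matrix over the pseudo-differential operators with
coefficients in the Weyl superalgebra,
`M = [[z - J_ξᵀ, X], [Y, ∂ - J_γ]]`,
where `X` consists of the annihilation operators and `Y` of the creation operators, up to signs
(`oscMatrix`). Expanding the resolvents `(∂ - J_γ)⁻¹` and `(z - J_ξᵀ)⁻¹` as series identifies the two
Schur complements of `M` with the images of the two Lax matrices:
`z - J_ξᵀ - X (∂ - J_γ)⁻¹ Y` is the image of `Lhat` (`map_phi_Lhat`), and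
`∂ - J_γ - Y (z - J_ξᵀ)⁻¹ X` is the image of `Lsuper` (`map_varphi_Lsuper`).

The matrix `M` can be eliminated one index at a time along any lattice path from `(0, 0)` to
`(d, p + q + m + n)`, each step contributing a quasideterminant, inverted when the index is odd.
The product does not depend on the path (`quasiminor_prod`), because the two ways around a unit
square agree (`quasidet_exchange`). This local statement is a computation with the entries of the
inverse `N` of a submatrix of `M`, and it only needs that `N` is a super Manin matrix. That in turn
holds because the supercommutators of the entries of `M` are constants, given by an antisymmetric
form (`CentralRel`): the defect of the Manin relation for `N` then reproduces itself multiplied by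
two further entries of `N` (`CentralRel.maninDefect_inverse`). As the entries of `N` have negative
total degree in `z` and `∂`, the defect has arbitrarily low degree and vanishes.

On one extreme path the first block is eliminated at the start, with quasideterminants the diagonal
entries `z - w_a` since `J_ξ` is triangular, and the rest of the product is the Berezinian of the
image of `Lsuper`. On the other one the factors `∂ - z_i` come first, followed by the principal
quasiminors of the image of `Lhat`. The latter multiply to its column determinant, because this
matrix has the Manin property (`schur_isManin`, `IsManin.cdet_eq_prod_quasiminor`). Comparing the
two paths is `oscillator_duality`; grouping the linear factors by Jordan blocks gives the theorem.
-/

noncomputable section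

namespace PDO

/-! ### Pseudo-differential operators -/

section Basic

variable {A : Type*} [Ring A]

@[simp] theorem coeff_sub (f g : PDO A) (i j : ℤ) :
    (f - g).coeff i j = f.coeff i j - g.coeff i j := by
  rw [sub_eq_add_neg, coeff_add, coeff_neg, sub_eq_add_neg]

@[simp] theorem coeff_sum {ι : Type*} (s : Finset ι) (f : ι → PDO A) (i j : ℤ) :
    (∑ x ∈ s, f x).coeff i j = ∑ x ∈ s, (f x).coeff i j := by
  classical
  induction s using Finset.induction_on with
  | empty => simp
  | insert a s ha ih => rw [Finset.sum_insert ha, Finset.sum_insert ha, coeff_add, ih]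

@[simp] theorem coeff_map {B : Type*} [Ring B] (φ : A →+* B) (f : PDO A) (i j : ℤ) :
    (map φ f).coeff i j = φ (f.coeff i j) := rfl

theorem coeff_mono_mul (i : ℤ) (x : A) (f : PDO A) (a b : ℤ) :
    (mono i 0 x * f).coeff a b = x * f.coeff (a - i) b := by
  rw [coeff_mul, finsum_eq_single _ (0, i, 0)]
  · simp [mulTerm, coeff_mono, wc]
  · rintro ⟨k, i', j'⟩ h
    by_cases hij : i' = i ∧ j' = 0
    · obtain ⟨rfl, rfl⟩ := hij
      have hk : 0 < k := Nat.pos_of_ne_zero (by rintro rfl; exact h rfl)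
      simp [mulTerm, wc, Ring.choose_zero_pos ℤ hk]
    · simp [mulTerm, coeff_mono, hij]

theorem coeff_mul_mono (j : ℤ) (x : A) (f : PDO A) (a b : ℤ) :
    (f * mono 0 j x).coeff a b = f.coeff a (b - j) * x := by
  rw [coeff_mul, finsum_eq_single _ (0, a, b - j)]
  · simp [mulTerm, coeff_mono, wc]
  · rintro ⟨k, i', j'⟩ h
    by_cases hij : a + k - i' = 0 ∧ b + k - j' = j
    · have hk : 0 < k := by
        refine Nat.pos_of_ne_zero ?_
        rintro rfl
        apply h
        simp only [Nat.cast_zero, add_zero] at hij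
        simp only [Prod.mk.injEq, true_and]
        omega
      simp [mulTerm, wc, hij.1, Ring.choose_zero_pos ℤ hk]
    · simp [mulTerm, coeff_mono, hij]

theorem coeff_zvar_mul (f : PDO A) (a b : ℤ) : (zvar * f).coeff a b = f.coeff (a - 1) b := by
  rw [zvar, coeff_mono_mul, one_mul]

theorem coeff_mul_del (f : PDO A) (a b : ℤ) : (f * del).coeff a b = f.coeff a (b - 1) := by
  rw [del, coeff_mul_mono, mul_one]

theorem coeff_del_mul (f : PDO A) (a b : ℤ) :
    (del * f).coeff a b = f.coeff a (b - 1) + (a + 1) • f.coeff (a + 1) b := by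
  classical
  rw [coeff_mul, finsum_eq_finsetSum_of_support_subset (s := {(0, 0, 1), (1, 0, 1)})]
  · rw [Finset.sum_pair (by simp)]
    simp [mulTerm, del, coeff_mono, wc]
  · rintro ⟨k, i', j'⟩ h
    by_cases hij : i' = 0 ∧ j' = 1
    · obtain ⟨rfl, rfl⟩ := hij
      have hk : k < 2 := by
        by_contra hk
        apply h
        have : Ring.choose (1 : ℤ) k = 0 := by
          have := Ring.choose_natCast (R := ℤ) 1 k
          rw [Nat.cast_one] at this
          rw [this, Nat.choose_eq_zero_of_lt (by omega), Nat.cast_zero]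
        simp [mulTerm, wc, this]
      interval_cases k <;> simp
    · exact (h (by simp [mulTerm, del, coeff_mono, hij])).elim

theorem coeff_mul_zvar (f : PDO A) (a b : ℤ) :
    (f * zvar).coeff a b = f.coeff (a - 1) b + (b + 1) • f.coeff a (b + 1) := by
  classical
  rw [coeff_mul, finsum_eq_finsetSum_of_support_subset (s := {(0, a - 1, b), (1, a, b + 1)})]
  · rw [Finset.sum_pair (by simp)]
    simp [mulTerm, zvar, coeff_mono, wc]
  · rintro ⟨k, i', j'⟩ h
    by_cases hij : a + k - i' = 1 ∧ b + k - j' = 0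
    · have hk : k < 2 := by
        by_contra hk
        apply h
        have : Ring.choose (1 : ℤ) k = 0 := by
          have := Ring.choose_natCast (R := ℤ) 1 k
          rw [Nat.cast_one] at this
          rw [this, Nat.choose_eq_zero_of_lt (by omega), Nat.cast_zero]
        simp [mulTerm, wc, hij.1, this]
      simp only [Finset.coe_insert, Finset.coe_singleton, Set.mem_insert_iff, Prod.mk.injEq,
        Set.mem_singleton_iff]
      omega
    · exact (h (by simp [mulTerm, zvar, coeff_mono, hij])).elim

theorem mono_mul_mono (i i' j : ℤ) (x y : A) :
    mono i 0 x * mono i' j y = mono (i + i') j (x * y) := by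
  ext a b
  rw [coeff_mono_mul, coeff_mono, coeff_mono, mul_ite, mul_zero]
  refine if_congr ?_ rfl rfl
  omega

theorem mono_mul_mono' (i j j' : ℤ) (x y : A) :
    mono i j x * mono 0 j' y = mono i (j + j') (x * y) := by
  ext a b
  rw [coeff_mul_mono, coeff_mono, coeff_mono, ite_mul, zero_mul]
  refine if_congr ?_ rfl rfl
  omega

/-- The canonical commutation relation `∂ z - z ∂ = 1`. -/
theorem del_mul_zvar : (del * zvar : PDO A) = zvar * del + 1 := by
  ext a b
  rw [coeff_del_mul, coeff_add, coeff_mul_del, coeff_one]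
  simp only [zvar, coeff_mono]
  congr 1
  by_cases h : a = 0 ∧ b = 0
  · simp [h]
  · rw [if_neg h]
    by_cases h' : a + 1 = 1 ∧ b = 0
    · exact absurd ⟨by omega, h'.2⟩ h
    · rw [if_neg h', smul_zero]

/-- The inverse of `z`. -/
def zinv : PDO A := mono (-1) 0 1

/-- The inverse of `∂`. -/
def delinv : PDO A := mono 0 (-1) 1

theorem zinv_mul_zvar : (zinv * zvar : PDO A) = 1 := by
  rw [zinv, zvar, mono_mul_mono]; simp only [neg_add_cancel, mul_one]; rfl

theorem zvar_mul_zinv : (zvar * zinv : PDO A) = 1 := by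
  rw [zinv, zvar, mono_mul_mono]; simp only [add_neg_cancel, mul_one]; rfl

theorem delinv_mul_del : (delinv * del : PDO A) = 1 := by
  rw [delinv, del, mono_mul_mono']; simp only [neg_add_cancel, mul_one]; rfl

theorem del_mul_delinv : (del * delinv : PDO A) = 1 := by
  rw [delinv, del, mono_mul_mono']; simp only [add_neg_cancel, mul_one]; rfl

theorem coeff_const_mul (x : A) (f : PDO A) (a b : ℤ) :
    (mono 0 0 x * f).coeff a b = x * f.coeff a b := by
  rw [coeff_mono_mul, sub_zero]

theorem coeff_mul_const (x : A) (f : PDO A) (a b : ℤ) :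
    (f * mono 0 0 x).coeff a b = f.coeff a b * x := by
  rw [coeff_mul_mono, sub_zero]

/-- A coefficient commutes with a series as soon as it commutes with all of its coefficients. -/
theorem mono_commute {x : A} {f : PDO A} (h : ∀ a b, Commute x (f.coeff a b)) :
    Commute (mono 0 0 x) f := by
  ext a b
  rw [coeff_const_mul, coeff_mul_const, (h a b).eq]

theorem mono_commute_zvar (x : A) : Commute (mono 0 0 x) zvar :=
  mono_commute fun a b => by
    rw [zvar, coeff_mono]; split_ifs
    · exact Commute.one_right x
    · exact Commute.zero_right x

theorem mono_commute_del (x : A) : Commute (mono 0 0 x) del :=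
  mono_commute fun a b => by
    rw [del, coeff_mono]; split_ifs
    · exact Commute.one_right x
    · exact Commute.zero_right x

theorem const_commute [Algebra ℂ A] (c : ℂ) (f : PDO A) : Commute (const c) f :=
  mono_commute fun _ _ => Algebra.commutes c _

theorem mono_add (x y : A) : (mono 0 0 (x + y) : PDO A) = mono 0 0 x + mono 0 0 y := by
  ext a b; simp only [coeff_mono, coeff_add]; split_ifs <;> simp

theorem mono_zero : (mono 0 0 0 : PDO A) = 0 := by
  ext a b; simp only [coeff_mono, coeff_zero]; split_ifs <;> rfl

/-- The inclusion of the coefficients. -/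
def constHom : A →+* PDO A where
  toFun := mono 0 0
  map_one' := rfl
  map_zero' := mono_zero
  map_mul' x y := by rw [mono_mul_mono, add_zero]
  map_add' := mono_add

theorem constHom_apply (x : A) : constHom x = mono 0 0 x := rfl

theorem map_zvar {B : Type*} [Ring B] (φ : A →+* B) : map φ zvar = zvar := by
  ext a b; simp only [coeff_map, zvar, coeff_mono]; split_ifs <;> simp

theorem map_del {B : Type*} [Ring B] (φ : A →+* B) : map φ del = del := by
  ext a b; simp only [coeff_map, del, coeff_mono]; split_ifs <;> simp

end Basic

/-! ### The filtration by total degree -/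

section Filtration

variable {A : Type*} [Ring A]

/-- The series in `z⁻¹` and `∂⁻¹` without terms of total degree above `-n`. Only nonpositive powers
of each variable are allowed, so that a coefficientwise limit of such series is again one. -/
def fil (A : Type*) [Ring A] (n : ℕ) : AddSubgroup (PDO A) where
  carrier := {f | ∀ i j, f.coeff i j ≠ 0 → i ≤ 0 ∧ j ≤ 0 ∧ i + j ≤ -n}
  zero_mem' := fun i j h => (h rfl).elim
  add_mem' := by
    intro f g hf hg i j h
    by_cases h1 : f.coeff i j = 0
    · exact hg i j (by rwa [coeff_add, h1, zero_add] at h)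
    · exact hf i j h1
  neg_mem' := by
    intro f hf i j h
    exact hf i j (by simpa using h)

theorem fil_anti {n m : ℕ} (h : n ≤ m) {f : PDO A} (hf : f ∈ fil A m) : f ∈ fil A n := by
  intro i j hij
  have := hf i j hij
  omega

/-- Reordering `∂^j z^i` only produces further terms of lower degree. -/
theorem mul_mem_fil {n m : ℕ} {f g : PDO A} (hf : f ∈ fil A n) (hg : g ∈ fil A m) :
    f * g ∈ fil A (n + m) := by
  intro a b h
  obtain ⟨⟨k, i, j⟩, h⟩ := exists_ne_of_finsum h
  have h1 : f.coeff i j ≠ 0 := fun h0 => h (by simp [mulTerm, h0])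
  have h2 : g.coeff (a + k - i) (b + k - j) ≠ 0 := fun h0 => h (by simp [mulTerm, h0])
  have := hf _ _ h1
  have := hg _ _ h2
  push_cast
  omega

theorem one_mem_fil : (1 : PDO A) ∈ fil A 0 := by
  intro i j h
  rw [coeff_one] at h
  by_cases h' : i = 0 ∧ j = 0
  · simp [h']
  · simp [h'] at h

theorem mono_mem_fil (x : A) : mono 0 0 x ∈ fil A 0 := by
  intro i j h
  rw [coeff_mono] at h
  by_cases h' : i = 0 ∧ j = 0
  · simp [h']
  · simp [h'] at h

theorem zinv_mem_fil : (zinv : PDO A) ∈ fil A 1 := by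
  intro i j h
  rw [zinv, coeff_mono] at h
  by_cases h' : i = -1 ∧ j = 0
  · simp [h']
  · simp [h'] at h

theorem delinv_mem_fil : (delinv : PDO A) ∈ fil A 1 := by
  intro i j h
  rw [delinv, coeff_mono] at h
  by_cases h' : i = 0 ∧ j = -1
  · simp [h']
  · simp [h'] at h

theorem eq_zero_of_mem_fil {f : PDO A} (h : ∀ n, f ∈ fil A n) : f = 0 := by
  ext i j
  by_contra h0
  have := h (-(i + j) + 1).toNat i j h0
  omega

variable {κ : Type*} [Fintype κ] [DecidableEq κ]

theorem matrix_mul_mem_fil {n m : ℕ} {F G : Matrix κ κ (PDO A)} (hF : ∀ i j, F i j ∈ fil A n)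
    (hG : ∀ i j, G i j ∈ fil A m) (i j : κ) : (F * G) i j ∈ fil A (n + m) := by
  rw [Matrix.mul_apply]
  exact AddSubgroup.sum_mem _ fun x _ => mul_mem_fil (hF i x) (hG x j)

theorem matrix_one_mem_fil (i j : κ) : (1 : Matrix κ κ (PDO A)) i j ∈ fil A 0 := by
  rw [Matrix.one_apply]
  split_ifs
  · exact one_mem_fil
  · exact AddSubgroup.zero_mem _

theorem matrix_pow_mem_fil {F : Matrix κ κ (PDO A)} (hF : ∀ i j, F i j ∈ fil A 1) (n : ℕ)
    (i j : κ) : (F ^ n) i j ∈ fil A n := by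
  induction n generalizing i j with
  | zero => rw [pow_zero]; exact matrix_one_mem_fil i j
  | succ n ih => rw [pow_succ]; exact matrix_mul_mem_fil ih hF i j

theorem matrix_geom_mem_fil {F : Matrix κ κ (PDO A)} (hF : ∀ i j, F i j ∈ fil A 1) {n m : ℕ}
    (h : n ≤ m) (i j : κ) :
    (∑ k ∈ Finset.range m, F ^ k) i j - (∑ k ∈ Finset.range n, F ^ k) i j ∈ fil A n := by
  rw [← Finset.sum_range_add_sum_Ico _ h, Matrix.add_apply, add_sub_cancel_left, Matrix.sum_apply]
  refine AddSubgroup.sum_mem _ fun k hk => fil_anti ?_ (matrix_pow_mem_fil hF k i j)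
  exact (Finset.mem_Ico.1 hk).1

/-- The geometric series `∑ F^k`, summed coefficientwise: only the powers with `k ≤ -(a + b)`
contribute to the coefficient of `z^a ∂^b`. -/
def geomSeries (F : Matrix κ κ (PDO A)) (hF : ∀ i j, F i j ∈ fil A 1) : Matrix κ κ (PDO A) :=
  Matrix.of fun i j =>
    ⟨fun a b => ((∑ k ∈ Finset.range (-(a + b) + 1).toNat, F ^ k) i j).coeff a b, by
      refine ⟨0, 0, fun a b h => ?_⟩
      rw [Matrix.sum_apply] at h
      have := AddSubgroup.sum_mem (fil A 0)
        (fun k (_ : k ∈ Finset.range (-(a + b) + 1).toNat) =>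
          fil_anti (Nat.zero_le k) (matrix_pow_mem_fil hF k i j)) a b h
      exact ⟨this.1, this.2.1⟩⟩

theorem geomSeries_sub_mem_fil (F : Matrix κ κ (PDO A)) (hF : ∀ i j, F i j ∈ fil A 1) (n : ℕ)
    (i j : κ) : geomSeries F hF i j - (∑ k ∈ Finset.range n, F ^ k) i j ∈ fil A n := by
  intro a b h
  rw [coeff_sub] at h
  change ((∑ k ∈ Finset.range (-(a + b) + 1).toNat, F ^ k) i j).coeff a b - _ ≠ 0 at h
  rcases le_total n (-(a + b) + 1).toNat with h' | h'
  · exact matrix_geom_mem_fil hF h' i j a b (by rwa [coeff_sub])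
  · have := matrix_geom_mem_fil hF h' i j a b (by
      rw [coeff_sub]
      intro h0
      exact h (by rw [← neg_sub, h0, neg_zero]))
    omega

theorem matrix_eq_of_sub_mem_fil {F G : Matrix κ κ (PDO A)}
    (h : ∀ n i j, (F - G) i j ∈ fil A n) : F = G := by
  ext1 i j
  exact sub_eq_zero.1 (eq_zero_of_mem_fil fun n => h n i j)

theorem one_sub_mul_geomSeries (F : Matrix κ κ (PDO A)) (hF : ∀ i j, F i j ∈ fil A 1) :
    (1 - F) * geomSeries F hF = 1 ∧ geomSeries F hF * (1 - F) = 1 := by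
  have h0 : ∀ i j, (1 - F) i j ∈ fil A 0 := fun i j =>
    AddSubgroup.sub_mem _ (matrix_one_mem_fil i j) (fil_anti zero_le_one (hF i j))
  have h1 : ∀ n i j, (geomSeries F hF - ∑ k ∈ Finset.range n, F ^ k) i j ∈ fil A n :=
    fun n i j => geomSeries_sub_mem_fil F hF n i j
  constructor
  · refine matrix_eq_of_sub_mem_fil fun n i j => ?_
    have e : (1 - F) * geomSeries F hF - 1 =
        (1 - F) * (geomSeries F hF - ∑ k ∈ Finset.range n, F ^ k) - F ^ n := by
      rw [mul_sub, mul_neg_geom_sum]; abel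
    rw [e]
    refine AddSubgroup.sub_mem _ ?_ (matrix_pow_mem_fil hF n i j)
    have := matrix_mul_mem_fil h0 (h1 n) i j
    rwa [zero_add] at this
  · refine matrix_eq_of_sub_mem_fil fun n i j => ?_
    have e : geomSeries F hF * (1 - F) - 1 =
        (geomSeries F hF - ∑ k ∈ Finset.range n, F ^ k) * (1 - F) - F ^ n := by
      rw [sub_mul _ _ (1 - F), geom_sum_mul_neg]; abel
    rw [e]
    exact AddSubgroup.sub_mem _ (matrix_mul_mem_fil (h1 n) h0 i j) (matrix_pow_mem_fil hF n i j)

theorem isUnit_of_sub_one_mem_fil {f : PDO A} (hf : f - 1 ∈ fil A 1) : IsUnit f := by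
  have hF : ∀ i j : Unit, (Matrix.of fun _ _ : Unit => 1 - f) i j ∈ fil A 1 := fun i j => by
    have := AddSubgroup.neg_mem _ hf
    rwa [neg_sub] at this
  obtain ⟨h1, h2⟩ := one_sub_mul_geomSeries _ hF
  have e1 := congrFun (congrFun h1 ()) ()
  have e2 := congrFun (congrFun h2 ()) ()
  simp only [Matrix.mul_apply, Finset.univ_unique, Finset.sum_singleton, Matrix.sub_apply,
    Matrix.one_apply, Matrix.of_apply, if_true, PUnit.default_eq_unit, sub_sub_cancel] at e1 e2
  exact ⟨⟨f, _, e1, e2⟩, rfl⟩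

/-- A matrix over `A((z⁻¹, ∂⁻¹))` which differs from a diagonal matrix of `z`'s and `∂`'s by
entries of degree at most zero. -/
def NearDiagonal (M : Matrix κ κ (PDO A)) : Prop :=
  ∃ δ : κ → PDO A, (∀ i, δ i = zvar ∨ δ i = del) ∧
    ∀ i j, M i j - (if i = j then δ i else 0) ∈ fil A 0

theorem NearDiagonal.submatrix {M : Matrix κ κ (PDO A)} (h : NearDiagonal M) {ι : Type*}
    [Fintype ι] [DecidableEq ι] {f : ι → κ} (hf : Function.Injective f) :
    NearDiagonal (M.submatrix f f) := by
  obtain ⟨δ, h1, h2⟩ := h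
  refine ⟨fun i => δ (f i), fun i => h1 _, fun i j => ?_⟩
  have := h2 (f i) (f j)
  simpa only [Matrix.submatrix_apply, hf.eq_iff] using this

/-- A near diagonal matrix is `Δ (1 - F)` with `Δ` diagonal and `F` of degree at most `-1`, so its
inverse is `(∑ F^k) Δ⁻¹`, a small matrix with invertible diagonal entries. -/
theorem NearDiagonal.exists_inverse {M : Matrix κ κ (PDO A)} (h : NearDiagonal M) :
    ∃ N : Matrix κ κ (PDO A), M * N = 1 ∧ N * M = 1 ∧ (∀ i j, N i j ∈ fil A 1) ∧
      ∀ i, IsUnit (N i i) := by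
  obtain ⟨δ, h1, h2⟩ := h
  have hε : ∀ i, ∃ ε, ε ∈ fil A 1 ∧ δ i * ε = 1 ∧ ε * δ i = 1 := fun i => by
    rcases h1 i with h | h <;> rw [h]
    · exact ⟨zinv, zinv_mem_fil, zvar_mul_zinv, zinv_mul_zvar⟩
    · exact ⟨delinv, delinv_mem_fil, del_mul_delinv, delinv_mul_del⟩
  choose ε h3 h4 h5 using hε
  have d1 : Matrix.diagonal δ * Matrix.diagonal ε = 1 := by
    rw [Matrix.diagonal_mul_diagonal, ← Matrix.diagonal_one]
    exact congrArg _ (funext h4)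
  have d2 : Matrix.diagonal ε * Matrix.diagonal δ = 1 := by
    rw [Matrix.diagonal_mul_diagonal, ← Matrix.diagonal_one]
    exact congrArg _ (funext h5)
  have hF : ∀ i j, (1 - Matrix.diagonal ε * M) i j ∈ fil A 1 := fun i j => by
    have : (1 - Matrix.diagonal ε * M) i j = -(ε i * (M i j - if i = j then δ i else 0)) := by
      rw [mul_sub, Matrix.sub_apply, Matrix.diagonal_mul, Matrix.one_apply, mul_ite, h5, mul_zero]
      abel
    rw [this]
    exact AddSubgroup.neg_mem _ (mul_mem_fil (h3 i) (h2 i j))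
  obtain ⟨g1, g2⟩ := one_sub_mul_geomSeries _ hF
  rw [sub_sub_cancel] at g1 g2
  refine ⟨geomSeries _ hF * Matrix.diagonal ε, ?_, ?_, fun i j => ?_, fun i => ?_⟩
  · calc M * (geomSeries _ hF * Matrix.diagonal ε)
        = (Matrix.diagonal δ * Matrix.diagonal ε) * (M * (geomSeries _ hF * Matrix.diagonal ε)) := by
          rw [d1, one_mul]
      _ = Matrix.diagonal δ * (Matrix.diagonal ε * M * geomSeries _ hF) * Matrix.diagonal ε := by
          simp only [mul_assoc]
      _ = 1 := by rw [g1, mul_one, d1]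
  · rw [mul_assoc, g2]
  · rw [Matrix.mul_diagonal]
    have := geomSeries_sub_mem_fil _ hF 0 i j
    rw [Finset.sum_range_zero, Matrix.zero_apply, sub_zero] at this
    have h6 := mul_mem_fil this (h3 j)
    rwa [zero_add] at h6
  · rw [Matrix.mul_diagonal]
    refine IsUnit.mul ?_ ⟨⟨ε i, δ i, h5 i, h4 i⟩, rfl⟩
    apply isUnit_of_sub_one_mem_fil
    have := geomSeries_sub_mem_fil _ hF 1 i i
    rwa [Finset.sum_range_one, pow_zero, Matrix.one_apply_eq] at this

end Filtration

end PDO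

namespace Gaudin

/-! ### Matrices with central supercommutators and their inverses -/

section Inverse

/-- The sign `(-1)^k`. -/
def sg (k : ℕ) : ℤ := (-1) ^ k

theorem sg_congr {a b : ℕ} (h : (a : ZMod 2) = b) : sg a = sg b := by
  have := (ZMod.natCast_eq_natCast_iff' a b 2).1 h
  rw [sg, sg, neg_one_pow_eq_pow_mod_two, this, ← neg_one_pow_eq_pow_mod_two]

theorem sg_add (a b : ℕ) : sg (a + b) = sg a * sg b := pow_add _ _ _

@[simp] theorem sg_zero : sg 0 = 1 := rfl

@[simp] theorem sg_one : sg 1 = -1 := rfl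

theorem sg_mul_self (a : ℕ) : sg a * sg a = 1 := by
  rw [sg, ← mul_pow]; simp

theorem zmod_two_sq (x : ZMod 2) : x * x = x := by revert x; decide

variable {R : Type*} [Ring R] {κ : Type*} [Fintype κ] [DecidableEq κ]

/-- If `y` supercommutes with the entries of `M` up to `D`, then it supercommutes with those of
`N = M⁻¹` up to `N D N`. The signs are absorbed by the diagonal matrix with entries `± y`. -/
theorem supercomm_inverse (s : κ → ℕ) (e : ℕ) {M N : Matrix κ κ R} (hMN : M * N = 1)
    (hNM : N * M = 1) (y : R) (D : κ → κ → R)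
    (h : ∀ i j, M i j * y - sg ((s i + s j) * e) • (y * M i j) = D i j) (p q : κ) :
    y * N p q - sg (e * (s p + s q)) • (N p q * y) =
      ∑ i, ∑ j, sg (e * (s j + s p)) • (N p i * D i j * N j q) := by
  set Y : Matrix κ κ R := Matrix.diagonal fun i => sg (e * s i) • y with hY
  set D' : Matrix κ κ R := Matrix.of fun i j => sg (e * s j) • D i j with hD'
  have h1 : M * Y - Y * M = D' := by
    ext1 i j
    rw [Matrix.sub_apply, hY, Matrix.mul_diagonal, Matrix.diagonal_mul, hD', Matrix.of_apply, ← h,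
      smul_sub, smul_smul, mul_smul_comm, smul_mul_assoc, ← sg_add]
    congr 2
    refine sg_congr ?_
    have h2 : (2 : ZMod 2) = 0 := rfl
    push_cast
    linear_combination (-(e : ZMod 2) * s j) * h2
  have h2 : Y * N - N * Y = N * D' * N := by
    rw [← h1, mul_sub, sub_mul, ← mul_assoc N M, hNM, one_mul, mul_assoc N, mul_assoc Y, hMN,
      mul_one]
  have h3 := congrFun (congrFun h2 p) q
  rw [Matrix.sub_apply, hY, Matrix.mul_diagonal, Matrix.diagonal_mul, Matrix.mul_apply] at h3
  have h4 := congrArg (sg (e * s p) • ·) h3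
  simp only [smul_sub, smul_mul_assoc, mul_smul_comm, smul_smul, sg_mul_self, one_smul] at h4
  rw [mul_add e, sg_add, h4, Finset.smul_sum, Finset.sum_comm]
  refine Finset.sum_congr rfl fun j _ => ?_
  rw [Matrix.mul_apply, Finset.sum_mul, Finset.smul_sum]
  refine Finset.sum_congr rfl fun i _ => ?_
  rw [hD', Matrix.of_apply, mul_smul_comm, smul_mul_assoc, smul_smul, ← sg_add, ← mul_add, add_comm]

/-- The supercommutation relations of the matrix `M`: the supercommutator of `M_{ij}` and `M_{kl}`
is the constant `ω_{jl} (δ_{ij} δ_{kl} + (-1)^{|j|} δ_{il} δ_{kj})`. -/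
def CentralRel (s : κ → ℕ) (ω : κ → κ → ℤ) (M : Matrix κ κ R) : Prop :=
  ∀ i j k l, M i j * M k l - sg ((s i + s j) * (s k + s l)) • (M k l * M i j) =
    (ω j l * ((if i = j ∧ k = l then 1 else 0) + sg (s j) * (if i = l ∧ k = j then 1 else 0))) •
      (1 : R)

/-- The supercommutator of two entries. -/
def scomm (s : κ → ℕ) (N : Matrix κ κ R) (p q u v : κ) : R :=
  N p q * N u v - sg ((s p + s q) * (s u + s v)) • (N u v * N p q)

/-- The antisymmetrization of `N_{pq} N_{uv}` in the row indices. -/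
def rowAlt (s : κ → ℕ) (N : Matrix κ κ R) (p u q v : κ) : R :=
  N p q * N u v - sg (s p * s q + s u * s q + s p * s u) • (N u q * N p v)

/-- The defect of the super Manin relation
`[N_{pq}, N_{uv}] = (-1)^{|p||q|+|p||u|+|q||u|} [N_{uq}, N_{pv}]`. -/
def maninDefect (s : κ → ℕ) (N : Matrix κ κ R) (p u q v : κ) : R :=
  scomm s N p q u v - sg (s p * s q + s p * s u + s q * s u) • scomm s N u q p v

/-- The defect as an antisymmetrization of supercommutators in the column indices. -/
theorem maninDefect_eq_scomm (s : κ → ℕ) (N : Matrix κ κ R) (p u q v : κ) :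
    maninDefect s N p u q v = scomm s N p q u v +
      sg (s q * s u + s u * s v + s q * s v) • scomm s N p v u q := by
  have e1 : sg (s q * s u + s u * s v + s q * s v) * sg ((s p + s v) * (s u + s q)) =
      sg (s p * s q + s p * s u + s q * s u) := by
    rw [← sg_add]
    refine sg_congr ?_
    have h2 : (2 : ZMod 2) = 0 := rfl
    push_cast
    linear_combination ((s u : ZMod 2) * s v + s q * s v) * h2
  have e2 : sg (s p * s q + s p * s u + s q * s u) * sg ((s u + s q) * (s p + s v)) =
      sg (s q * s u + s u * s v + s q * s v) := by
    rw [← sg_add]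
    refine sg_congr ?_
    have h2 : (2 : ZMod 2) = 0 := rfl
    push_cast
    linear_combination ((s p : ZMod 2) * s q + s p * s u) * h2
  rw [maninDefect]
  simp only [scomm, smul_sub, smul_smul, e1, e2]
  abel

/-- The defect as an antisymmetrization in the row and the column indices. -/
theorem maninDefect_eq_rowAlt (s : κ → ℕ) (N : Matrix κ κ R) (p u q v : κ) :
    maninDefect s N p u q v = rowAlt s N p u q v +
      sg (s q * s u + s u * s v + s q * s v) • rowAlt s N p u v q := by
  have e1 : sg (s p * s q + s p * s u + s q * s u) * sg ((s u + s q) * (s p + s v)) =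
      sg (s q * s u + s u * s v + s q * s v) := by
    rw [← sg_add]
    refine sg_congr ?_
    have h2 : (2 : ZMod 2) = 0 := rfl
    push_cast
    linear_combination ((s p : ZMod 2) * s q + s p * s u) * h2
  have e2 : sg (s q * s u + s u * s v + s q * s v) * sg (s p * s v + s u * s v + s p * s u) =
      sg ((s p + s q) * (s u + s v)) := by
    rw [← sg_add]
    refine sg_congr ?_
    have h2 : (2 : ZMod 2) = 0 := rfl
    push_cast
    linear_combination ((s u : ZMod 2) * s v) * h2
  rw [maninDefect]
  simp only [scomm, rowAlt, smul_sub, smul_smul, e1, e2,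
    show s p * s q + s u * s q + s p * s u = s p * s q + s p * s u + s q * s u by ring]
  abel

variable {s : κ → ℕ} {ω : κ → κ → ℤ} {M N : Matrix κ κ R}

/-- The supercommutators of the entries of `M` with those of `N = M⁻¹`. -/
theorem CentralRel.mixed (h : CentralRel s ω M) (hMN : M * N = 1) (hNM : N * M = 1)
    (p q k l : κ) :
    M k l * N p q - sg ((s k + s l) * (s p + s q)) • (N p q * M k l) =
      (if k = l then ∑ j, ω j l • (N p j * N j q) else 0) +
        (sg (s k * s l + s p * s k + s p * s l) * ω k l) • (N p l * N k q) := by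
  rw [supercomm_inverse s (s k + s l) hMN hNM (M k l) _ (fun i j => h i j k l)]
  have e : ∀ i j, sg ((s k + s l) * (s j + s p)) • (N p i *
      ((ω j l * ((if i = j ∧ k = l then 1 else 0) + sg (s j) * (if i = l ∧ k = j then 1 else 0))) •
        (1 : R)) * N j q) =
      (if i = j then (if k = l then ω j l • (N p j * N j q) else 0) else 0) +
      (if i = l then (if k = j then
        (sg (s k * s l + s p * s k + s p * s l) * ω k l) • (N p l * N k q) else 0) else 0) := by
    intro i j
    rw [mul_add (ω j l), add_smul, mul_add (N p i), add_mul _ _ (N j q), smul_add]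
    congr 1
    · by_cases h1 : i = j
      · by_cases h2 : k = l
        · subst h1 h2
          have : sg ((s k + s k) * (s i + s p)) = 1 := by
            rw [← sg_zero]
            refine sg_congr ?_
            have h2 : (2 : ZMod 2) = 0 := rfl
            push_cast
            linear_combination ((s k : ZMod 2) * (s i + s p)) * h2
          rw [this]
          simp only [and_self, if_true, mul_one, one_smul, mul_smul_comm, smul_mul_assoc]
        · simp [h2]
      · simp [h1]
    · by_cases h1 : i = l
      · by_cases h2 : k = j
        · subst h1 h2
          have : sg ((s k + s i) * (s k + s p)) * (ω k i * sg (s k)) =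
              sg (s k * s i + s p * s k + s p * s i) * ω k i := by
            rw [mul_left_comm, ← sg_add, mul_comm]
            congr 1
            refine sg_congr ?_
            have h2 : (2 : ZMod 2) = 0 := rfl
            have h3 := zmod_two_sq (s k)
            push_cast
            linear_combination (s k : ZMod 2) * h2 + h3
          simp only [true_and, if_true, mul_one, mul_smul_comm, smul_mul_assoc, smul_smul, this]
        · simp [h2]
      · simp [h1]
  simp only [e, Finset.sum_add_distrib]
  congr 1
  · simp
  · simp

/-- The supercommutators of the entries of `N = M⁻¹`. The antisymmetry of `ω` turns the two kinds of
terms into the antisymmetrization in the row indices. -/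
theorem CentralRel.scomm_inverse (h : CentralRel s ω M) (hω : ∀ k l, ω l k = -ω k l)
    (hMN : M * N = 1) (hNM : N * M = 1) (p q u v : κ) :
    scomm s N p q u v = ∑ k, ∑ l, (ω k l * sg ((s p + s q) * (s u + s l))) •
      (N u l * N p k * rowAlt s N k l q v) := by
  rw [scomm, supercomm_inverse s (s p + s q) hMN hNM (N p q) _ (fun k l => h.mixed hMN hNM p q k l)]
  have e1 : ∀ (c : ℤ) (k l : κ) (x y : R),
      c • (N u k * (x + y) * N l v) = c • (N u k * x * N l v) + c • (N u k * y * N l v) :=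
    fun c k l x y => by rw [mul_add, add_mul, smul_add]
  have e2 : ∀ (c : ℤ) (k l : κ) (x y : R), c • (N u l * N p k * (x - y)) =
      c • (N u l * N p k * x) - c • (N u l * N p k * y) :=
    fun c k l x y => by rw [mul_sub, smul_sub]
  simp only [e1, e2, Finset.sum_add_distrib, rowAlt, Finset.sum_sub_distrib]
  rw [sub_eq_add_neg]
  congr 1
  · rw [Finset.sum_comm]
    conv_rhs => rw [Finset.sum_comm]
    refine Finset.sum_congr rfl fun l _ => ?_
    rw [Finset.sum_eq_single l]
    · rw [if_pos rfl, Finset.mul_sum, Finset.sum_mul, Finset.smul_sum]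
      refine Finset.sum_congr rfl fun k _ => ?_
      rw [mul_smul_comm, smul_mul_assoc, smul_smul, add_comm (s l), mul_comm (sg _)]
      simp only [mul_assoc]
    · intro k _ hk
      rw [if_neg hk]; simp
    · simp
  · rw [Finset.sum_comm, ← Finset.sum_neg_distrib]
    refine Finset.sum_congr rfl fun k _ => ?_
    rw [← Finset.sum_neg_distrib]
    refine Finset.sum_congr rfl fun l _ => ?_
    rw [hω k l, mul_smul_comm, smul_mul_assoc, mul_smul_comm, smul_smul, smul_smul, ← neg_smul]
    congr 1
    · rw [mul_neg, mul_neg, neg_inj, mul_right_comm (ω k l), mul_comm (ω k l), ← mul_assoc,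
        ← sg_add, mul_comm _ (ω k l), mul_comm _ (ω k l), mul_assoc (ω k l), ← sg_add]
      congr 1
      refine sg_congr ?_
      have h2 : (2 : ZMod 2) = 0 := rfl
      push_cast
      linear_combination ((s p : ZMod 2) * s k - s q * s l) * h2
    · simp only [mul_assoc]

/-- The Manin defect of the inverse reproduces itself with two more factors from the inverse. -/
theorem CentralRel.maninDefect_inverse (h : CentralRel s ω M) (hω : ∀ k l, ω l k = -ω k l)
    (hMN : M * N = 1) (hNM : N * M = 1) (p u q v : κ) :
    maninDefect s N p u q v = ∑ k, ∑ l, (ω k l * sg ((s p + s q) * (s u + s l))) •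
      (N u l * N p k * maninDefect s N k l q v) := by
  rw [maninDefect_eq_scomm, h.scomm_inverse hω hMN hNM, h.scomm_inverse hω hMN hNM,
    Finset.smul_sum, ← Finset.sum_add_distrib]
  refine Finset.sum_congr rfl fun k _ => ?_
  rw [Finset.smul_sum, ← Finset.sum_add_distrib]
  refine Finset.sum_congr rfl fun l _ => ?_
  rw [maninDefect_eq_rowAlt, mul_add (N u l * N p k), smul_add, mul_smul_comm, smul_smul, smul_smul]
  congr 2
  rw [mul_left_comm, mul_assoc, ← sg_add, ← sg_add]
  congr 1
  refine sg_congr ?_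
  have h2 : (2 : ZMod 2) = 0 := rfl
  push_cast
  linear_combination ((s u : ZMod 2) * s v - s q * s l) * h2

/-- A small inverse of a matrix with central supercommutators is a super Manin matrix: its defect
has arbitrarily low degree. -/
theorem CentralRel.maninDefect_eq_zero {A : Type*} [Ring A] {M N : Matrix κ κ (PDO A)}
    (h : CentralRel s ω M) (hω : ∀ k l, ω l k = -ω k l) (hMN : M * N = 1) (hNM : N * M = 1)
    (hN : ∀ i j, N i j ∈ PDO.fil A 1) (p u q v : κ) : maninDefect s N p u q v = 0 := by
  have key : ∀ k p u q v, maninDefect s N p u q v ∈ PDO.fil A k := by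
    intro k
    induction k with
    | zero =>
      intro p u q v
      have h2 : ∀ a b c d, N a b * N c d ∈ PDO.fil A 0 := fun a b c d =>
        PDO.fil_anti (Nat.zero_le _) (PDO.mul_mem_fil (hN a b) (hN c d))
      exact AddSubgroup.sub_mem _
        (AddSubgroup.sub_mem _ (h2 _ _ _ _) (AddSubgroup.zsmul_mem _ (h2 _ _ _ _) _))
        (AddSubgroup.zsmul_mem _
          (AddSubgroup.sub_mem _ (h2 _ _ _ _) (AddSubgroup.zsmul_mem _ (h2 _ _ _ _) _)) _)
    | succ k ih =>
      intro p u q v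
      rw [h.maninDefect_inverse hω hMN hNM]
      refine AddSubgroup.sum_mem _ fun a _ => AddSubgroup.sum_mem _ fun b _ =>
        AddSubgroup.zsmul_mem _ (PDO.fil_anti (m := 1 + 1 + k) (by omega) ?_) _
      exact PDO.mul_mem_fil (PDO.mul_mem_fil (hN _ _) (hN _ _)) (ih _ _ _ _)
  exact PDO.eq_zero_of_mem_fil fun k => key k p u q v

theorem CentralRel.submatrix (h : CentralRel s ω M) {ι : Type*} [Fintype ι] [DecidableEq ι]
    {f : ι → κ} (hf : Function.Injective f) :
    CentralRel (fun i => s (f i)) (fun i j => ω (f i) (f j)) (M.submatrix f f) := by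
  intro i j k l
  have := h (f i) (f j) (f k) (f l)
  simpa only [hf.eq_iff, Matrix.submatrix_apply] using this

end Inverse

/-! ### Quasideterminants -/

section Quasidet

variable {R : Type*} [Ring R] {κ : Type*} [Fintype κ] [DecidableEq κ]

theorem ring_inverse_eq {S : Type*} [MonoidWithZero S] {a b : S} (h1 : a * b = 1)
    (h2 : b * a = 1) : Ring.inverse a = b :=
  Ring.inverse_unit (⟨a, b, h1, h2⟩ : Sˣ)

/-- The principal quasideterminant `((M⁻¹)_{ii})⁻¹`, for an arbitrary finite index set. It is
meaningful when both inverses exist: `Ring.inverse` is zero on the elements which are not units. -/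
def principalQuasidet (M : Matrix κ κ R) (i : κ) : R := Ring.inverse (Ring.inverse M i i)

theorem principalQuasidet_eq {M N : Matrix κ κ R} (hMN : M * N = 1) (hNM : N * M = 1) (i : κ) :
    principalQuasidet M i = Ring.inverse (N i i) := by
  rw [principalQuasidet, ring_inverse_eq hMN hNM]

theorem principalQuasidet_of_col {M N : Matrix κ κ R} (hMN : M * N = 1) (hNM : N * M = 1) {l : κ}
    (hl : IsUnit (N l l)) (h : ∀ i, i ≠ l → M i l = 0) : principalQuasidet M l = M l l := by
  have h1 := congrFun (congrFun hNM l) l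
  rw [Matrix.mul_apply, Finset.sum_eq_single l (fun i _ hi => by rw [h i hi, mul_zero]) (by simp),
    Matrix.one_apply_eq] at h1
  rw [principalQuasidet_eq hMN hNM]
  obtain ⟨u, hu⟩ := hl
  rw [← hu] at h1 ⊢
  rw [Ring.inverse_unit]
  exact (Units.mul_eq_one_iff_inv_eq.1 h1)

theorem principalQuasidet_of_row {M N : Matrix κ κ R} (hMN : M * N = 1) (hNM : N * M = 1) {l : κ}
    (hl : IsUnit (N l l)) (h : ∀ j, j ≠ l → M l j = 0) : principalQuasidet M l = M l l := by
  have h1 := congrFun (congrFun hMN l) l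
  rw [Matrix.mul_apply, Finset.sum_eq_single l (fun i _ hi => by rw [h i hi, zero_mul]) (by simp),
    Matrix.one_apply_eq] at h1
  rw [principalQuasidet_eq hMN hNM]
  obtain ⟨u, hu⟩ := hl
  rw [← hu] at h1 ⊢
  rw [Ring.inverse_unit]
  exact (Units.mul_eq_one_iff_eq_inv.1 h1).symm

/-- Deleting the index `r` from `M` replaces `N = M⁻¹` by its Schur complement
`N_{ij} - N_{ir} N_{rr}⁻¹ N_{rj}`. -/
theorem inverse_delete {M N : Matrix κ κ R} (hMN : M * N = 1) (hNM : N * M = 1) {r : κ}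
    (hr : IsUnit (N r r)) {ι : Type*} [Fintype ι] [DecidableEq ι] {f : ι → κ}
    (hf : Function.Injective f) (hfr : ∀ x, x ≠ r ↔ x ∈ Set.range f) :
    M.submatrix f f * Matrix.of (fun i j => N (f i) (f j) -
      N (f i) r * Ring.inverse (N r r) * N r (f j)) = 1 ∧
    Matrix.of (fun i j => N (f i) (f j) -
      N (f i) r * Ring.inverse (N r r) * N r (f j)) * M.submatrix f f = 1 := by
  have hsum : ∀ g : κ → R, ∑ x, g (f x) = ∑ x, g x - g r := fun g => by
    have e := Finset.sum_map Finset.univ ⟨f, hf⟩ g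
    simp only [Function.Embedding.coeFn_mk] at e
    rw [eq_sub_iff_add_eq, ← e,
      ← Finset.sum_erase_add _ _ (Finset.mem_univ r)]
    congr 2
    ext x
    rw [Finset.mem_map, Finset.mem_erase]
    simp only [Finset.mem_univ, true_and, and_true, Function.Embedding.coeFn_mk]
    exact (hfr x).symm
  have hne : ∀ i, f i ≠ r := fun i => (hfr _).2 ⟨i, rfl⟩
  have h1 : ∀ i j, ∑ x, M i x * N x j = (1 : Matrix κ κ R) i j := fun i j => by
    rw [← hMN, Matrix.mul_apply]
  have h2 : ∀ i j, ∑ x, N i x * M x j = (1 : Matrix κ κ R) i j := fun i j => by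
    rw [← hNM, Matrix.mul_apply]
  have h3 : (1 : Matrix κ κ R).submatrix f f = 1 := Matrix.submatrix_one f hf
  constructor
  · ext1 i j
    simp only [Matrix.mul_apply, Matrix.submatrix_apply, Matrix.of_apply, mul_sub,
      Finset.sum_sub_distrib, ← mul_assoc, ← Finset.sum_mul]
    rw [hsum fun x => M (f i) x * N x (f j), hsum fun x => M (f i) x * N x r, h1, h1,
      Matrix.one_apply_ne (hne i), ← h3, Matrix.submatrix_apply, zero_sub, neg_mul, neg_mul,
      mul_assoc (M (f i) r), Ring.mul_inverse_cancel _ hr, mul_one]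
    abel
  · ext1 i j
    simp only [Matrix.mul_apply, Matrix.submatrix_apply, Matrix.of_apply, sub_mul,
      Finset.sum_sub_distrib, mul_assoc, ← Finset.mul_sum]
    rw [hsum fun x => N (f i) x * M x (f j), hsum fun x => N r x * M x (f j), h2, h2,
      Matrix.one_apply_ne (hne j).symm, ← h3, Matrix.submatrix_apply, zero_sub, mul_neg, mul_neg,
      ← mul_assoc (Ring.inverse _), Ring.inverse_mul_cancel _ hr, one_mul]
    abel

/-- The corner of the inverse of a block matrix inverts the Schur complement. -/
theorem schur_complement₁₁ {α β : Type*} [Fintype α] [DecidableEq α] [Fintype β] [DecidableEq β]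
    {Z : Matrix α α R} {X : Matrix α β R} {Y : Matrix β α R} {T G : Matrix β β R}
    {N : Matrix (α ⊕ β) (α ⊕ β) R} (hTG : T * G = 1) (hGT : G * T = 1)
    (hMN : Matrix.fromBlocks Z X Y T * N = 1) (hNM : N * Matrix.fromBlocks Z X Y T = 1) :
    (Z - X * G * Y) * N.toBlocks₁₁ = 1 ∧ N.toBlocks₁₁ * (Z - X * G * Y) = 1 := by
  rw [← Matrix.fromBlocks_toBlocks N, Matrix.fromBlocks_multiply, ← Matrix.fromBlocks_one,
    Matrix.fromBlocks_inj] at hMN hNM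
  obtain ⟨h1, -, h2, -⟩ := hMN
  obtain ⟨h3, h4, -, -⟩ := hNM
  constructor
  · have e : G * (Y * N.toBlocks₁₁) = -N.toBlocks₂₁ := by
      rw [eq_neg_of_add_eq_zero_left h2, Matrix.mul_neg, ← Matrix.mul_assoc, hGT, Matrix.one_mul]
    rw [Matrix.sub_mul, Matrix.mul_assoc, Matrix.mul_assoc, e, Matrix.mul_neg, sub_neg_eq_add, h1]
  · have e : N.toBlocks₁₁ * X * G = -N.toBlocks₁₂ := by
      rw [eq_neg_of_add_eq_zero_left h4, Matrix.neg_mul, Matrix.mul_assoc, hTG, Matrix.mul_one]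
    rw [Matrix.mul_sub, ← Matrix.mul_assoc, ← Matrix.mul_assoc, e, Matrix.neg_mul, sub_neg_eq_add,
      h3]

/-- The opposite corner of the inverse of a block matrix inverts the other Schur complement. -/
theorem schur_complement₂₂ {α β : Type*} [Fintype α] [DecidableEq α] [Fintype β] [DecidableEq β]
    {Z G : Matrix α α R} {X : Matrix α β R} {Y : Matrix β α R} {T : Matrix β β R}
    {N : Matrix (α ⊕ β) (α ⊕ β) R} (hZG : Z * G = 1) (hGZ : G * Z = 1)
    (hMN : Matrix.fromBlocks Z X Y T * N = 1) (hNM : N * Matrix.fromBlocks Z X Y T = 1) :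
    (T - Y * G * X) * N.toBlocks₂₂ = 1 ∧ N.toBlocks₂₂ * (T - Y * G * X) = 1 := by
  rw [← Matrix.fromBlocks_toBlocks N, Matrix.fromBlocks_multiply, ← Matrix.fromBlocks_one,
    Matrix.fromBlocks_inj] at hMN hNM
  obtain ⟨-, h2, -, h1⟩ := hMN
  obtain ⟨-, -, h4, h3⟩ := hNM
  constructor
  · have e : G * (X * N.toBlocks₂₂) = -N.toBlocks₁₂ := by
      rw [eq_neg_of_add_eq_zero_right h2, Matrix.mul_neg, ← Matrix.mul_assoc, hGZ, Matrix.one_mul]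
    rw [Matrix.sub_mul, Matrix.mul_assoc, Matrix.mul_assoc, e, Matrix.mul_neg, sub_neg_eq_add,
      add_comm, h1]
  · have e : N.toBlocks₂₂ * Y * G = -N.toBlocks₂₁ := by
      rw [eq_neg_of_add_eq_zero_right h4, Matrix.neg_mul, Matrix.mul_assoc, hZG, Matrix.mul_one]
    rw [Matrix.mul_sub, ← Matrix.mul_assoc, ← Matrix.mul_assoc, e, Matrix.neg_mul, sub_neg_eq_add,
      add_comm, h3]

end Quasidet

/-! ### Exchanging two indices -/

section Exchange

variable {R : Type*} [Ring R]

/-- `x` if `e = 0`, and `x⁻¹` otherwise. -/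
def signedPow (e : ℕ) (x : R) : R := if e = 0 then x else Ring.inverse x

/-- For an even index, `a` and `e` are diagonal entries and `b`, `c` are off-diagonal entries of a
`2 × 2` Manin block; both sides invert the same noncommutative `2 × 2` determinant. -/
theorem inverse_exchange_even {a b c e : R} (ha : IsUnit a) (he : IsUnit e)
    (hSa : IsUnit (a - b * Ring.inverse e * c)) (hSe : IsUnit (e - c * Ring.inverse a * b))
    (h1 : a * c = c * a) (h2 : e * b = b * e) (h3 : a * e - e * a = c * b - b * c) :
    Ring.inverse (a - b * Ring.inverse e * c) * Ring.inverse e =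
      Ring.inverse (e - c * Ring.inverse a * b) * Ring.inverse a := by
  have h : e * (a - b * Ring.inverse e * c) = a * (e - c * Ring.inverse a * b) := by
    have e1 : e * (b * Ring.inverse e * c) = b * c := by
      rw [← mul_assoc, ← mul_assoc, h2, mul_assoc b, Ring.mul_inverse_cancel _ he, mul_one]
    have e2 : a * (c * Ring.inverse a * b) = c * b := by
      rw [← mul_assoc, ← mul_assoc, h1, mul_assoc c, Ring.mul_inverse_cancel _ ha, mul_one]
    rw [mul_sub, mul_sub, e1, e2, sub_eq_sub_iff_sub_eq_sub]
    rw [sub_eq_sub_iff_add_eq_add] at h3 ⊢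
    rw [add_comm, ← h3, add_comm]
  obtain ⟨u, rfl⟩ := ha
  obtain ⟨v, rfl⟩ := he
  obtain ⟨x, hx⟩ := hSa
  obtain ⟨y, hy⟩ := hSe
  rw [← hx, ← hy] at h ⊢
  simp only [Ring.inverse_unit, ← Units.val_mul, ← mul_inv_rev, Units.val_inj] at h ⊢
  rw [h]

/-- The analogue of `inverse_exchange_even` for an odd index, which enters with exponent `-1`. -/
theorem inverse_exchange_odd {a b c e : R} (ha : IsUnit a) (he : IsUnit e)
    (hSa : IsUnit (a - b * Ring.inverse e * c)) (h0 : c * c = 0)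
    (h1 : a * c = c * a) (h2 : c * e = e * c) (h3 : a * e - e * a = c * b + b * c) :
    Ring.inverse (a - b * Ring.inverse e * c) * e =
      (e - c * Ring.inverse a * b) * Ring.inverse a := by
  have h : e * a = (a - b * Ring.inverse e * c) * (e - c * Ring.inverse a * b) := by
    have e1 : a * (c * Ring.inverse a * b) = c * b := by
      rw [← mul_assoc, ← mul_assoc, h1, mul_assoc c, Ring.mul_inverse_cancel _ ha, mul_one]
    have e2 : b * Ring.inverse e * c * e = b * c := by
      rw [mul_assoc, h2, ← mul_assoc, mul_assoc b, Ring.inverse_mul_cancel _ he, mul_one]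
    have e3 : b * Ring.inverse e * c * (c * Ring.inverse a * b) = 0 := by
      rw [mul_assoc, ← mul_assoc c, ← mul_assoc c, h0, zero_mul, zero_mul, mul_zero]
    rw [sub_mul, mul_sub, mul_sub, e1, e2, e3, sub_zero, sub_sub, ← h3]
    abel
  obtain ⟨u, rfl⟩ := ha
  obtain ⟨x, hx⟩ := hSa
  rw [← hx] at h ⊢
  rw [Ring.inverse_unit, Ring.inverse_unit, Units.inv_mul_eq_iff_eq_mul, ← mul_assoc]
  rw [Ring.inverse_unit] at h
  rw [← h, Units.mul_inv_cancel_right]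

/-- Consequences of the super Manin relation for a `2 × 2` block with an even index `a` and an
index `r`. -/
theorem manin_block {κ : Type*} (htwo : ∀ x : R, x + x = 0 → x = 0) {s : κ → ℕ}
    {N : Matrix κ κ R} (h : ∀ p u q v, maninDefect s N p u q v = 0) {a r : κ} (ha : s a = 0) :
    N a a * N r a = N r a * N a a ∧
    (s r = 0 → N r r * N a r = N a r * N r r) ∧
    (s r = 0 → N a a * N r r - N r r * N a a = N r a * N a r - N a r * N r a) ∧
    (s r = 1 → N r a * N r a = 0) ∧
    (s r = 1 → N r a * N r r = N r r * N r a) ∧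
    (s r = 1 → N a a * N r r - N r r * N a a = N r a * N a r + N a r * N r a) := by
  refine ⟨?_, fun hr => ?_, fun hr => ?_, fun hr => ?_, fun hr => ?_, fun hr => ?_⟩
  · have := h a r a a
    simp only [maninDefect, scomm, ha, mul_zero, zero_mul, add_zero, sg_zero, one_smul] at this
    refine sub_eq_zero.1 (htwo _ ?_)
    rw [← this]; abel
  · have := h a r r r
    simp only [maninDefect, scomm, ha, hr, mul_zero, add_zero, sg_zero, one_smul] at this
    refine sub_eq_zero.1 (htwo _ ?_)
    rw [← neg_eq_zero, ← this]; abel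
  · have := h a r a r
    simp only [maninDefect, scomm, ha, hr, mul_zero, add_zero, sg_zero, one_smul] at this
    exact sub_eq_zero.1 this
  · have := h r r a a
    simp only [maninDefect, scomm, ha, hr, mul_zero, mul_one, add_zero, zero_add, sg_one,
      neg_smul, one_smul, sub_neg_eq_add] at this
    exact htwo _ (htwo _ this)
  · have := h r r a r
    have e : sg 2 = 1 := rfl
    simp only [maninDefect, scomm, ha, hr, mul_zero, mul_one, add_zero, zero_add,
      one_add_one_eq_two, one_mul, e, sg_one, neg_smul, one_smul, sub_neg_eq_add] at this
    exact sub_eq_zero.1 (htwo _ this)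
  · have := h a r a r
    simp only [maninDefect, scomm, ha, hr, mul_zero, mul_one, zero_mul, add_zero, zero_add,
      sg_zero, sg_one, neg_smul, one_smul, sub_neg_eq_add] at this
    exact sub_eq_zero.1 this

/-- Used to pass from `x + x = 0` to `x = 0` for the coincident indices of the Manin relations. -/
theorem pdo_two_torsion {A : Type*} [Ring A] [Algebra ℂ A] (x : PDO A) (h : x + x = 0) :
    x = 0 := by
  ext i j
  have h1 : x.coeff i j + x.coeff i j = 0 := congrArg (fun f => f.coeff i j) h
  rw [← two_smul ℂ] at h1
  have h2 := congrArg ((2 : ℂ)⁻¹ • ·) h1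
  simpa using h2

/-- The order in which an even index `a` and an index `r` are eliminated does not matter. -/
theorem quasidet_exchange {A : Type*} [Ring A] [Algebra ℂ A] {κ : Type*} [Fintype κ]
    [DecidableEq κ] {M : Matrix κ κ (PDO A)} (hM : PDO.NearDiagonal M) {s : κ → ℕ} {ω : κ → κ → ℤ}
    (hω : ∀ k l, ω l k = -ω k l) (h : CentralRel s ω M) {a r : κ} (ha : s a = 0)
    (hr : s r = 0 ∨ s r = 1) {α ρ : Type*} [Fintype α] [DecidableEq α] [Fintype ρ] [DecidableEq ρ]
    {f : α → κ} (hf : Function.Injective f) (hfr : ∀ x, x ≠ r ↔ x ∈ Set.range f) {a' : α}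
    (ha' : f a' = a)
    {g : ρ → κ} (hg : Function.Injective g) (hga : ∀ x, x ≠ a ↔ x ∈ Set.range g) {r' : ρ}
    (hr' : g r' = r) :
    principalQuasidet (M.submatrix f f) a' * signedPow (s r) (principalQuasidet M r) =
      signedPow (s r) (principalQuasidet (M.submatrix g g) r') * principalQuasidet M a := by
  obtain ⟨N, hMN, hNM, hN, hu⟩ := hM.exists_inverse
  obtain ⟨m1, m2, m3, m4, m5, m6⟩ := manin_block pdo_two_torsion
    (h.maninDefect_eq_zero hω hMN hNM hN) (r := r) ha
  obtain ⟨d1, d2⟩ := inverse_delete hMN hNM (hu r) hf hfr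
  obtain ⟨d3, d4⟩ := inverse_delete hMN hNM (hu a) hg hga
  obtain ⟨N1, k1, k2, -, u1⟩ := (hM.submatrix hf).exists_inverse
  obtain ⟨N2, k3, k4, -, u2⟩ := (hM.submatrix hg).exists_inverse
  have v1 := u1 a'
  rw [left_inv_eq_right_inv k2 d1, Matrix.of_apply, ha'] at v1
  have v2 := u2 r'
  rw [left_inv_eq_right_inv k4 d3, Matrix.of_apply, hr'] at v2
  rw [principalQuasidet_eq d1 d2, principalQuasidet_eq d3 d4, principalQuasidet_eq hMN hNM,
    principalQuasidet_eq hMN hNM, Matrix.of_apply, Matrix.of_apply, ha', hr']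
  rcases hr with hr | hr
  · simp only [signedPow, hr, if_true]
    exact inverse_exchange_even (hu a) (hu r) v1 v2 m1 (m2 hr) (m3 hr)
  · simp only [signedPow, hr, if_neg one_ne_zero]
    have e : ∀ x : PDO A, IsUnit x → Ring.inverse (Ring.inverse x) = x := by
      rintro _ ⟨x, rfl⟩
      rw [Ring.inverse_unit, Ring.inverse_unit, inv_inv]
    rw [e _ (hu r), e _ v2]
    exact inverse_exchange_odd (hu a) (hu r) v1 (m4 hr) m1 (m5 hr) (m6 hr)

end Exchange

/-! ### Eliminating the indices along a lattice path -/

section Grid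

theorem prod_ofFn_eq_range {S : Type*} [Monoid S] (n : ℕ) (f : ℕ → S) :
    (List.ofFn fun i : Fin n => f i).prod = ((List.range n).map f).prod := by
  rw [List.ofFn_eq_map, ← List.map_coe_finRange_eq_range, List.map_map]
  rfl

/-- A commuting square at every step of a grid makes the product along a boundary path
independent of the path. -/
theorem grid_prod {S : Type*} [Monoid S] {d N : ℕ} {a b : ℕ → ℕ → S}
    (h : ∀ k < d, ∀ j < N, a k j * b (k + 1) j = b k j * a k (j + 1)) :
    (List.ofFn fun k : Fin d => a k 0).prod * (List.ofFn fun j : Fin N => b d j).prod =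
      (List.ofFn fun j : Fin N => b 0 j).prod * (List.ofFn fun k : Fin d => a k N).prod := by
  rw [prod_ofFn_eq_range d fun k => a k 0, prod_ofFn_eq_range N fun j => b d j,
    prod_ofFn_eq_range N fun j => b 0 j, prod_ofFn_eq_range d fun k => a k N]
  have row : ∀ j < N, ∀ k ≤ d, ((List.range k).map fun k => a k j).prod * b k j =
      b 0 j * ((List.range k).map fun k => a k (j + 1)).prod := by
    intro j hj k
    induction k with
    | zero => intro _; simp
    | succ k ih =>
      intro hk
      rw [List.prod_range_succ, List.prod_range_succ, mul_assoc, h k (by omega) j hj, ← mul_assoc,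
        ih (by omega), mul_assoc]
  have col : ∀ j ≤ N, ((List.range d).map fun k => a k 0).prod *
      ((List.range j).map fun j => b d j).prod =
      ((List.range j).map fun j => b 0 j).prod * ((List.range d).map fun k => a k j).prod := by
    intro j
    induction j with
    | zero => intro _; simp
    | succ j ih =>
      intro hj
      rw [List.prod_range_succ, List.prod_range_succ, ← mul_assoc, ih (by omega), mul_assoc,
        row j (by omega) d le_rfl, mul_assoc]
  exact col N le_rfl

/-- The first `k` indices of the first kind and the first `j` of the second kind. The reduction
modulo `d` and `N` makes this total in `k` and `j`; it has no effect for `k ≤ d` and `j ≤ N`. -/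
def gridMap (d N : ℕ) [NeZero d] [NeZero N] (k j : ℕ) : Fin k ⊕ Fin j → Fin d ⊕ Fin N :=
  Sum.map (fun i => Fin.ofNat d i) (fun i => Fin.ofNat N i)

variable {d N : ℕ} [NeZero d] [NeZero N]

theorem ofNat_eq_castLE {k : ℕ} (hk : k ≤ d) (i : Fin k) : Fin.ofNat d i = Fin.castLE hk i := by
  apply Fin.ext
  rw [Fin.val_ofNat, Nat.mod_eq_of_lt (lt_of_lt_of_le i.isLt hk), Fin.val_castLE]

theorem gridMap_eq {k j : ℕ} (hk : k ≤ d) (hj : j ≤ N) :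
    gridMap d N k j = Sum.map (Fin.castLE hk) (Fin.castLE hj) := by
  rw [gridMap, funext (ofNat_eq_castLE hk), funext (ofNat_eq_castLE hj)]

theorem gridMap_injective {k j : ℕ} (hk : k ≤ d) (hj : j ≤ N) :
    Function.Injective (gridMap d N k j) := by
  rw [gridMap_eq hk hj]
  exact Sum.map_injective.2 ⟨Fin.castLE_injective hk, Fin.castLE_injective hj⟩

/-- The quasideterminant at the index `k` of the first kind, after the previous indices of the
first kind and the first `j` of the second kind. -/
def quasiminorL {R : Type*} [Ring R] (M : Matrix (Fin d ⊕ Fin N) (Fin d ⊕ Fin N) R) (k j : ℕ) : R :=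
  principalQuasidet (M.submatrix (gridMap d N (k + 1) j) (gridMap d N (k + 1) j))
    (Sum.inl (Fin.last k))

/-- The quasideterminant at the index `j` of the second kind, after the previous indices of the
second kind and the first `k` of the first kind. -/
def quasiminorR {R : Type*} [Ring R] (M : Matrix (Fin d ⊕ Fin N) (Fin d ⊕ Fin N) R) (k j : ℕ) : R :=
  principalQuasidet (M.submatrix (gridMap d N k (j + 1)) (gridMap d N k (j + 1)))
    (Sum.inr (Fin.last j))

/-- The two ways around a unit square of the lattice contribute the same product. -/
theorem quasiminor_step {A : Type*} [Ring A] [Algebra ℂ A]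
    {M : Matrix (Fin d ⊕ Fin N) (Fin d ⊕ Fin N) (PDO A)} (hM : PDO.NearDiagonal M)
    {s : Fin d ⊕ Fin N → ℕ} {ω : Fin d ⊕ Fin N → Fin d ⊕ Fin N → ℤ}
    (hω : ∀ k l, ω l k = -ω k l) (h : CentralRel s ω M) (ha : ∀ a, s (Sum.inl a) = 0)
    (hr : ∀ r, s (Sum.inr r) = 0 ∨ s (Sum.inr r) = 1) {k j : ℕ} (hk : k < d) (hj : j < N) :
    quasiminorL M k j * signedPow (s (Sum.inr (Fin.ofNat N j))) (quasiminorR M (k + 1) j) =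
      signedPow (s (Sum.inr (Fin.ofNat N j))) (quasiminorR M k j) * quasiminorL M k (j + 1) := by
  have hinj := gridMap_injective (d := d) (N := N) (k := k + 1) (j := j + 1) hk hj
  have hlast : ∀ {n : ℕ} (x : Fin (n + 1)), x ≠ Fin.last n ↔ x ∈ Set.range Fin.castSucc :=
    fun x => by
      constructor
      · intro hx
        exact ⟨x.castPred hx, Fin.castSucc_castPred x hx⟩
      · rintro ⟨y, rfl⟩
        exact (Fin.castSucc_lt_last y).ne
  have key := quasidet_exchange (hM.submatrix hinj) (fun _ _ => hω _ _) (h.submatrix hinj)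
    (a := Sum.inl (Fin.last k)) (r := Sum.inr (Fin.last j)) (ha _) (hr _)
    (f := Sum.map id Fin.castSucc) (Sum.map_injective.2 ⟨fun _ _ h => h, Fin.castSucc_injective j⟩)
    (by
      rintro (x | x)
      · simp
      · rw [Ne, Sum.inr.injEq, ← Ne, hlast]
        constructor
        · rintro ⟨y, rfl⟩
          exact ⟨Sum.inr y, rfl⟩
        · rintro ⟨y | y, hy⟩
          · cases hy
          · exact ⟨y, Sum.inr.inj hy⟩)
    (a' := Sum.inl (Fin.last k)) rfl
    (g := Sum.map Fin.castSucc id) (Sum.map_injective.2 ⟨Fin.castSucc_injective k, fun _ _ h => h⟩)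
    (by
      rintro (x | x)
      · rw [Ne, Sum.inl.injEq, ← Ne, hlast]
        constructor
        · rintro ⟨y, rfl⟩
          exact ⟨Sum.inl y, rfl⟩
        · rintro ⟨y | y, hy⟩
          · exact ⟨y, Sum.inl.inj hy⟩
          · cases hy
      · simp)
    (r' := Sum.inr (Fin.last j)) rfl
  have e1 : gridMap d N (k + 1) (j + 1) ∘ Sum.map id Fin.castSucc = gridMap d N (k + 1) j := by
    funext x; rcases x with x | x <;> rfl
  have e2 : gridMap d N (k + 1) (j + 1) ∘ Sum.map Fin.castSucc id = gridMap d N k (j + 1) := by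
    funext x; rcases x with x | x <;> rfl
  rw [Matrix.submatrix_submatrix, Matrix.submatrix_submatrix, e1, e2] at key
  exact key

/-- The two extreme elimination orders give the same product of quasideterminants. -/
theorem quasiminor_prod {A : Type*} [Ring A] [Algebra ℂ A]
    {M : Matrix (Fin d ⊕ Fin N) (Fin d ⊕ Fin N) (PDO A)} (hM : PDO.NearDiagonal M)
    {s : Fin d ⊕ Fin N → ℕ} {ω : Fin d ⊕ Fin N → Fin d ⊕ Fin N → ℤ}
    (hω : ∀ k l, ω l k = -ω k l) (h : CentralRel s ω M) (ha : ∀ a, s (Sum.inl a) = 0)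
    (hr : ∀ r, s (Sum.inr r) = 0 ∨ s (Sum.inr r) = 1) :
    (List.ofFn fun k : Fin d => quasiminorL M k 0).prod *
      (List.ofFn fun j : Fin N => signedPow (s (Sum.inr j)) (quasiminorR M d j)).prod =
    (List.ofFn fun j : Fin N => signedPow (s (Sum.inr j)) (quasiminorR M 0 j)).prod *
      (List.ofFn fun k : Fin d => quasiminorL M k N).prod := by
  have := grid_prod (d := d) (N := N) (a := quasiminorL M)
    (b := fun k j => signedPow (s (Sum.inr (Fin.ofNat N j))) (quasiminorR M k j))
    fun k hk j hj => quasiminor_step hM hω h ha hr hk hj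
  simpa only [Fin.ofNat_eq_cast, Fin.cast_val_eq_self] using this

end Grid

/-! ### Column determinants of Manin matrices -/

section ColumnDeterminant

variable {R : Type*} [Ring R]

/-- The Manin relations `[K_{ij}, K_{kl}] = [K_{kj}, K_{il}]`. For `j = l` they say that the entries
of a column commute, up to `2`-torsion. -/
def IsManin {ι κ : Type*} (K : Matrix ι κ R) : Prop :=
  ∀ i j k l, K i j * K k l - K k l * K i j = K k j * K i l - K i l * K k j

/-- An ordered product, with the factors at two adjacent positions singled out. -/
theorem prod_ofFn_split {n : ℕ} (i : Fin n) (f : Fin (n + 1) → R) :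
    ∃ x y : R, ∀ g : Fin (n + 1) → R, (∀ j, j ≠ i.castSucc → j ≠ i.succ → g j = f j) →
      (List.ofFn g).prod = x * (g i.castSucc * g i.succ) * y := by
  induction n with
  | zero => exact i.elim0
  | succ n ih =>
    refine Fin.cases ?_ (fun i => ?_) i
    · refine ⟨1, (List.ofFn fun j : Fin n => f j.succ.succ).prod, fun g hg => ?_⟩
      rw [List.ofFn_succ, List.ofFn_succ, List.prod_cons, List.prod_cons, one_mul, mul_assoc]
      have : ∀ j : Fin n, g j.succ.succ = f j.succ.succ := fun j =>
        hg _ (Fin.succ_ne_zero _) (fun h => Fin.succ_ne_zero j (Fin.succ_injective _ h))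
      simp only [this]
      rfl
    · obtain ⟨x, y, h⟩ := ih i fun j => f j.succ
      refine ⟨f 0 * x, y, fun g hg => ?_⟩
      rw [List.ofFn_succ, List.prod_cons, h (fun j => g j.succ)]
      · rw [hg 0 (fun h => Fin.succ_ne_zero i.castSucc h.symm) (fun h => Fin.succ_ne_zero _ h.symm)]
        simp only [mul_assoc]
        rfl
      · intro j h1 h2
        exact hg _ (fun h' => h1 (Fin.succ_injective _ h'))
          (fun h' => h2 (Fin.succ_injective _ h'))

variable {n : ℕ} {κ : Type*}

theorem IsManin.cdet_swap_adjacent {K : Matrix (Fin (n + 1)) κ R} (hK : IsManin K)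
    (c : Fin (n + 1) → κ) (i : Fin n) :
    cdet (K.submatrix id (c ∘ Equiv.swap i.castSucc i.succ)) = -cdet (K.submatrix id c) := by
  rw [eq_neg_iff_add_eq_zero, cdet, cdet, ← Finset.sum_add_distrib]
  have hne : i.castSucc ≠ i.succ := Fin.castSucc_lt_succ.ne
  -- The terms of `σ` and `σ τ` cancel, where `τ` exchanges the two adjacent positions.
  refine Finset.sum_involution (fun σ _ => σ * Equiv.swap i.castSucc i.succ) ?_ ?_
    (fun _ _ => Finset.mem_univ _) (fun σ _ => by
      rw [mul_assoc, Equiv.swap_mul_self, mul_one])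
  · intro σ _
    set τ := Equiv.swap i.castSucc i.succ with hτ
    have t1 : τ i.castSucc = i.succ := Equiv.swap_apply_left _ _
    have t2 : τ i.succ = i.castSucc := Equiv.swap_apply_right _ _
    have t3 : ∀ j, j ≠ i.castSucc → j ≠ i.succ → τ j = j := fun j =>
      Equiv.swap_apply_of_ne_of_ne
    obtain ⟨x, y, h⟩ := prod_ofFn_split i fun j => K (σ j) (c j)
    have h1 := h (fun j => K (σ j) (c j)) fun _ _ _ => rfl
    have h2 := h (fun j => K (σ j) (c (τ j))) fun j a b => by rw [t3 j a b]
    have h3 := h (fun j => K (σ (τ j)) (c j)) fun j a b => by rw [t3 j a b]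
    have h4 := h (fun j => K (σ (τ j)) (c (τ j))) fun j a b => by rw [t3 j a b]
    simp only [t1, t2] at h1 h2 h3 h4
    simp only [Matrix.submatrix_apply, id, Function.comp, Equiv.Perm.mul_apply, h1, h2, h3, h4,
      Equiv.Perm.sign_mul]
    rw [hτ, Equiv.Perm.sign_swap hne, mul_neg_one, Units.val_neg, neg_smul, neg_smul, ← smul_add,
      ← neg_add, ← smul_add, ← sub_eq_add_neg, ← smul_sub]
    have e := hK (σ i.castSucc) (c i.castSucc) (σ i.succ) (c i.succ)
    have e2 : x * (K (σ i.castSucc) (c i.succ) * K (σ i.succ) (c i.castSucc)) * y +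
        x * (K (σ i.castSucc) (c i.castSucc) * K (σ i.succ) (c i.succ)) * y -
        (x * (K (σ i.succ) (c i.succ) * K (σ i.castSucc) (c i.castSucc)) * y +
        x * (K (σ i.succ) (c i.castSucc) * K (σ i.castSucc) (c i.succ)) * y) = 0 := by
      rw [← add_mul, ← mul_add, ← add_mul, ← mul_add, ← sub_mul, ← mul_sub,
        show ∀ a b p q : R, a + b - (p + q) = (b - p) - (q - a) from fun a b p q => by abel, e,
        sub_self, mul_zero, zero_mul]
    rw [e2, smul_zero]
  · intro σ _ _ h
    have := congrArg (fun π : Equiv.Perm (Fin (n + 1)) => π i.succ) (mul_eq_left.1 h)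
    simp only [Equiv.swap_apply_right, Equiv.Perm.one_apply] at this
    exact hne this

/-- The column determinant of a Manin matrix is alternating in the columns. -/
theorem IsManin.cdet_perm {K : Matrix (Fin (n + 1)) κ R} (hK : IsManin K)
    (τ : Equiv.Perm (Fin (n + 1))) (c : Fin (n + 1) → κ) :
    cdet (K.submatrix id (c ∘ τ)) =
      ((Equiv.Perm.sign τ : ℤˣ) : ℤ) • cdet (K.submatrix id c) := by
  have hτ : τ ∈ Submonoid.closure
      (Set.range fun i : Fin n => Equiv.swap i.castSucc i.succ) := by
    rw [Equiv.Perm.mclosure_swap_castSucc_succ]; trivial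
  induction hτ using Submonoid.closure_induction generalizing c with
  | mem x hx =>
    obtain ⟨i, rfl⟩ := hx
    rw [hK.cdet_swap_adjacent, Equiv.Perm.sign_swap Fin.castSucc_lt_succ.ne]
    simp
  | one => simp
  | mul x y _ _ hx hy =>
    rw [Equiv.Perm.coe_mul, ← Function.comp_assoc, hy, hx, smul_smul, Equiv.Perm.sign_mul,
      Units.val_mul, mul_comm]

theorem IsManin.cdet_eq_zero {K : Matrix (Fin (n + 1)) κ R} (hK : IsManin K)
    (htwo : ∀ x : R, x + x = 0 → x = 0) {c : Fin (n + 1) → κ} {i j : Fin (n + 1)} (hij : i ≠ j)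
    (hc : c i = c j) : cdet (K.submatrix id c) = 0 := by
  have h := hK.cdet_perm (Equiv.swap i j) c
  have e : c ∘ Equiv.swap i j = c := by
    funext x
    rw [Function.comp_apply, Equiv.swap_apply_def]
    split_ifs with h1 h2
    · rw [h1, hc]
    · rw [h2, hc]
    · rfl
  rw [e, Equiv.Perm.sign_swap hij, Units.val_neg, Units.val_one, neg_one_smul] at h
  exact htwo _ (eq_neg_iff_add_eq_zero.1 h)

/-- The (signed) cofactors of the last column, when the previous columns are those in `c`. -/
def cofactor (K : Matrix (Fin (n + 1)) κ R) (c : Fin n → κ) (i : Fin (n + 1)) : R :=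
  ∑ σ : Equiv.Perm (Fin (n + 1)) with σ (Fin.last n) = i,
    ((Equiv.Perm.sign σ : ℤˣ) : ℤ) • (List.ofFn fun j : Fin n => K (σ j.castSucc) (c j)).prod

/-- The expansion of the column determinant along the last column. -/
theorem cdet_snoc (K : Matrix (Fin (n + 1)) κ R) (c : Fin n → κ) (x : κ) :
    cdet (K.submatrix id (Fin.snoc c x : Fin (n + 1) → κ)) = ∑ i, cofactor K c i * K i x := by
  rw [cdet, ← Finset.sum_fiberwise _ fun σ : Equiv.Perm (Fin (n + 1)) => σ (Fin.last n)]
  refine Finset.sum_congr rfl fun i _ => ?_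
  rw [cofactor, Finset.sum_mul]
  refine Finset.sum_congr rfl fun σ hσ => ?_
  rw [List.ofFn_succ', List.prod_concat, smul_mul_assoc]
  simp only [Matrix.submatrix_apply, id, Fin.snoc_castSucc, Fin.snoc_last]
  rw [(Finset.mem_filter.1 hσ).2]

theorem cofactor_last (K : Matrix (Fin (n + 1)) κ R) (c : Fin n → κ) :
    cofactor K c (Fin.last n) = cdet (K.submatrix Fin.castSucc c) := by
  symm
  refine Finset.sum_bij (fun σ _ => (finSuccEquivLast (n := n)).symm.permCongr
    (Equiv.optionCongr σ)) ?_ ?_ ?_ ?_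
  · intro σ _
    simp [Finset.mem_filter, Equiv.permCongr_apply]
  · intro σ _ σ' _ h
    exact Equiv.optionCongr_injective ((finSuccEquivLast (n := n)).symm.permCongr.injective h)
  · intro σ hσ
    have hσ := (Finset.mem_filter.1 hσ).2
    refine ⟨Equiv.removeNone ((finSuccEquivLast (n := n)).permCongr σ), Finset.mem_univ _, ?_⟩
    rw [map_equiv_removeNone]
    have : (finSuccEquivLast (n := n)).permCongr σ none = none := by
      simp [Equiv.permCongr_apply, hσ]
    rw [this, Equiv.swap_self, ← Equiv.Perm.one_def, one_mul]
    ext x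
    simp [Equiv.permCongr_apply]
  · intro σ _
    rw [Equiv.Perm.sign_permCongr, Equiv.optionCongr_sign]
    simp [Equiv.permCongr_apply]

/-- Cramer's rule for the last diagonal entry of the inverse: the row of cofactors of the last
column annihilates the other columns. -/
theorem IsManin.cdet_mul_inverse {K N : Matrix (Fin (n + 1)) (Fin (n + 1)) R} (hK : IsManin K)
    (htwo : ∀ x : R, x + x = 0 → x = 0) (hKN : K * N = 1) :
    cdet K * N (Fin.last n) (Fin.last n) = cdet (K.submatrix Fin.castSucc Fin.castSucc) := by
  have h1 : ∀ x, ∑ i, cofactor K Fin.castSucc i * K i x = if x = Fin.last n then cdet K else 0 := by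
    intro x
    rw [← cdet_snoc]
    refine Fin.lastCases ?_ (fun j => ?_) x
    · rw [if_pos rfl]
      have : (Fin.snoc Fin.castSucc (Fin.last n) : Fin (n + 1) → Fin (n + 1)) = id := by
        funext y
        refine Fin.lastCases ?_ (fun j => ?_) y
        · simp
        · simp
      rw [this, Matrix.submatrix_id_id]
    · rw [if_neg (Fin.castSucc_lt_last j).ne]
      refine hK.cdet_eq_zero htwo (i := j.castSucc) (j := Fin.last n)
        (Fin.castSucc_lt_last j).ne ?_
      rw [Fin.snoc_castSucc, Fin.snoc_last]
  rw [← cofactor_last]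
  calc cdet K * N (Fin.last n) (Fin.last n)
      = ∑ x, (∑ i, cofactor K Fin.castSucc i * K i x) * N x (Fin.last n) := by
        simp [h1]
    _ = ∑ i, cofactor K Fin.castSucc i * (K * N) i (Fin.last n) := by
        simp only [Finset.sum_mul, Matrix.mul_apply, Finset.mul_sum]
        rw [Finset.sum_comm]
        simp only [mul_assoc]
    _ = _ := by
        rw [hKN]
        simp [Matrix.one_apply]

/-- The column determinant of a sufficiently invertible Manin matrix is the product of its
principal quasiminors. -/
theorem IsManin.cdet_eq_prod_quasiminor {K : Matrix (Fin n) (Fin n) R} (hK : IsManin K)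
    (htwo : ∀ x : R, x + x = 0 → x = 0) (hinv : SufficientlyInvertible K) :
    cdet K = (List.ofFn fun i => quasiminor K i).prod := by
  have key : ∀ k, ∀ hk : k ≤ n, cdet (K.submatrix (Fin.castLE hk) (Fin.castLE hk)) =
      (List.ofFn fun i : Fin k => quasiminor K (Fin.castLE hk i)).prod := by
    intro k
    induction k with
    | zero => intro hk; simp [cdet]
    | succ k ih =>
      intro hk
      obtain ⟨h1, h2⟩ := hinv ⟨k, hk⟩
      have hL : IsManin (leading K ⟨k, hk⟩) := fun _ _ _ _ => hK _ _ _ _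
      have h3 := hL.cdet_mul_inverse htwo (Ring.mul_inverse_cancel _ h1)
      have e : (leading K ⟨k, hk⟩).submatrix Fin.castSucc Fin.castSucc =
          K.submatrix (Fin.castLE (Nat.le_of_succ_le hk)) (Fin.castLE (Nat.le_of_succ_le hk)) := rfl
      rw [e, ih] at h3
      rw [List.ofFn_succ', List.prod_concat]
      have e2 : quasiminor K (Fin.castLE hk (Fin.last k)) =
          Ring.inverse (Ring.inverse (leading K ⟨k, hk⟩) (Fin.last k) (Fin.last k)) := rfl
      have e3 : (List.ofFn fun i : Fin k => quasiminor K (Fin.castLE hk i.castSucc)).prod =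
          cdet (leading K ⟨k, hk⟩) *
            Ring.inverse (leading K ⟨k, hk⟩) (Fin.last k) (Fin.last k) := h3.symm
      rw [e2, e3, mul_assoc, Ring.mul_inverse_cancel _ h2, mul_one]
      rfl
  exact key n le_rfl

end ColumnDeterminant

/-! ### Behaviour under ring homomorphisms -/

section Map

variable {R S : Type*} [Ring R] [Ring S] {n : ℕ}

theorem map_cdet (f : R →+* S) (K : Matrix (Fin n) (Fin n) R) : f (cdet K) = cdet (K.map f) := by
  simp only [cdet, map_sum, map_zsmul, map_list_prod, List.map_ofFn]
  rfl

theorem map_ring_inverse (f : R →+* S) {x : R} (hx : IsUnit x) :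
    f (Ring.inverse x) = Ring.inverse (f x) := by
  refine (ring_inverse_eq ?_ ?_).symm
  · rw [← map_mul, Ring.mul_inverse_cancel _ hx, map_one]
  · rw [← map_mul, Ring.inverse_mul_cancel _ hx, map_one]

theorem ring_inverse_isUnit {x : R} (hx : IsUnit x) : IsUnit (Ring.inverse x) := by
  obtain ⟨u, rfl⟩ := hx
  rw [Ring.inverse_unit]; exact u⁻¹.isUnit

theorem map_quasiminor (f : R →+* S) {K : Matrix (Fin n) (Fin n) R}
    (hK : SufficientlyInvertible K) (i : Fin n) :
    f (quasiminor K i) = quasiminor (K.map f) i := by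
  obtain ⟨h1, h2⟩ := hK i
  rw [quasiminor, quasiminor, quasidet, quasidet, map_ring_inverse f h2]
  have : (Ring.inverse (leading K i)).map f = Ring.inverse (leading (K.map f) i) :=
    map_ring_inverse f.mapMatrix h1
  rw [← this, Matrix.map_apply]

theorem map_ber (f : R →+* S) (s : Fin n → ℕ) {K : Matrix (Fin n) (Fin n) R}
    (hK : SufficientlyInvertible K) :
    f (ber s K) = (List.ofFn fun i => signedPow (s i) (quasiminor (K.map f) i)).prod := by
  rw [ber, map_list_prod, List.map_ofFn]
  congr 2
  funext i
  rw [Function.comp_apply, signedPow, ← map_quasiminor f hK]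
  split_ifs
  · rfl
  · exact map_ring_inverse f (ring_inverse_isUnit (hK i).2)

/-- Every submatrix of a near diagonal matrix is near diagonal, hence invertible. -/
theorem _root_.PDO.NearDiagonal.sufficientlyInvertible {A : Type*} [Ring A]
    {K : Matrix (Fin n) (Fin n) (PDO A)} (hK : PDO.NearDiagonal K) : SufficientlyInvertible K := by
  intro i
  obtain ⟨N, h1, h2, -, h3⟩ := (hK.submatrix (Fin.castLE_injective i.isLt)).exists_inverse
  refine ⟨⟨⟨_, N, h1, h2⟩, rfl⟩, ?_⟩
  rw [leading, ring_inverse_eq h1 h2]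
  exact h3 _

end Map
end Gaudin

namespace PDO

/-! ### Series in one variable -/

section Series

variable {A : Type*} [Ring A]

/-- The series `∑ c_n ∂^{-n-1}`. -/
def delSeries (c : ℕ → A) : PDO A :=
  ⟨fun a b => if a = 0 ∧ b < 0 then c (-b - 1).toNat else 0, 0, 0, fun a b h => by
    by_cases h' : a = 0 ∧ b < 0
    · omega
    · simp [h'] at h⟩

/-- The series `∑ c_n z^{-n-1}`. -/
def zSeries (c : ℕ → A) : PDO A :=
  ⟨fun a b => if b = 0 ∧ a < 0 then c (-a - 1).toNat else 0, 0, 0, fun a b h => by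
    by_cases h' : b = 0 ∧ a < 0
    · omega
    · simp [h'] at h⟩

theorem coeff_delSeries (c : ℕ → A) (a b : ℤ) :
    (delSeries c).coeff a b = if a = 0 ∧ b < 0 then c (-b - 1).toNat else 0 := rfl

theorem coeff_zSeries (c : ℕ → A) (a b : ℤ) :
    (zSeries c).coeff a b = if b = 0 ∧ a < 0 then c (-a - 1).toNat else 0 := rfl

theorem delSeries_mem_fil (c : ℕ → A) : delSeries c ∈ fil A 0 := by
  intro a b h
  rw [coeff_delSeries] at h
  by_cases h' : a = 0 ∧ b < 0
  · push_cast; omega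
  · simp [h'] at h

theorem zSeries_mem_fil (c : ℕ → A) : zSeries c ∈ fil A 0 := by
  intro a b h
  rw [coeff_zSeries] at h
  by_cases h' : b = 0 ∧ a < 0
  · push_cast; omega
  · simp [h'] at h

theorem mono_mul_delSeries (x : A) (c : ℕ → A) :
    mono 0 0 x * delSeries c = delSeries fun n => x * c n := by
  ext a b; rw [coeff_const_mul, coeff_delSeries, coeff_delSeries, mul_ite, mul_zero]

theorem delSeries_mul_mono (x : A) (c : ℕ → A) :
    delSeries c * mono 0 0 x = delSeries fun n => c n * x := by
  ext a b; rw [coeff_mul_const, coeff_delSeries, coeff_delSeries, ite_mul, zero_mul]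

theorem mono_mul_zSeries (x : A) (c : ℕ → A) :
    mono 0 0 x * zSeries c = zSeries fun n => x * c n := by
  ext a b; rw [coeff_const_mul, coeff_zSeries, coeff_zSeries, mul_ite, mul_zero]

theorem zSeries_mul_mono (x : A) (c : ℕ → A) :
    zSeries c * mono 0 0 x = zSeries fun n => c n * x := by
  ext a b; rw [coeff_mul_const, coeff_zSeries, coeff_zSeries, ite_mul, zero_mul]

theorem delSeries_sum {ι : Type*} (t : Finset ι) (c : ι → ℕ → A) :
    ∑ i ∈ t, delSeries (c i) = delSeries fun n => ∑ i ∈ t, c i n := by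
  ext a b
  rw [coeff_sum]
  simp only [coeff_delSeries]
  split_ifs <;> simp

theorem zSeries_sum {ι : Type*} (t : Finset ι) (c : ι → ℕ → A) :
    ∑ i ∈ t, zSeries (c i) = zSeries fun n => ∑ i ∈ t, c i n := by
  ext a b
  rw [coeff_sum]
  simp only [coeff_zSeries]
  split_ifs <;> simp

theorem delSeries_mul_del (c : ℕ → A) :
    delSeries c * del = mono 0 0 (c 0) + delSeries fun n => c (n + 1) := by
  ext a b
  rw [coeff_mul_del, coeff_add, coeff_mono, coeff_delSeries, coeff_delSeries]
  by_cases ha : a = 0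
  · rcases lt_trichotomy b 0 with hb | rfl | hb
    · have : (-(b - 1) - 1).toNat = (-b - 1).toNat + 1 := by omega
      rw [if_pos ⟨ha, by omega⟩, if_neg (by omega), if_pos ⟨ha, hb⟩, this, zero_add]
    · rw [if_pos ⟨ha, by omega⟩, if_pos ⟨ha, rfl⟩, if_neg (by omega), add_zero]
      rfl
    · rw [if_neg (by omega), if_neg (by omega), if_neg (by omega), add_zero]
  · simp [ha]

theorem del_mul_delSeries (c : ℕ → A) :
    del * delSeries c = mono 0 0 (c 0) + delSeries fun n => c (n + 1) := by
  rw [← delSeries_mul_del]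
  ext a b
  rw [coeff_del_mul, coeff_mul_del, coeff_delSeries c (a + 1), add_eq_left]
  split_ifs with h
  · rw [h.1, zero_smul]
  · rw [smul_zero]

theorem zvar_mul_zSeries (c : ℕ → A) :
    zvar * zSeries c = mono 0 0 (c 0) + zSeries fun n => c (n + 1) := by
  ext a b
  rw [coeff_zvar_mul, coeff_add, coeff_mono, coeff_zSeries, coeff_zSeries]
  by_cases hb : b = 0
  · rcases lt_trichotomy a 0 with ha | rfl | ha
    · have : (-(a - 1) - 1).toNat = (-a - 1).toNat + 1 := by omega
      rw [if_pos ⟨hb, by omega⟩, if_neg (by omega), if_pos ⟨hb, ha⟩, this, zero_add]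
    · rw [if_pos ⟨hb, by omega⟩, if_pos ⟨rfl, hb⟩, if_neg (by omega), add_zero]
      rfl
    · rw [if_neg (by omega), if_neg (by omega), if_neg (by omega), add_zero]
  · simp [hb]

theorem zSeries_mul_zvar (c : ℕ → A) :
    zSeries c * zvar = mono 0 0 (c 0) + zSeries fun n => c (n + 1) := by
  rw [← zvar_mul_zSeries]
  ext a b
  rw [coeff_zvar_mul, coeff_mul_zvar, coeff_zSeries c a (b + 1), add_eq_left]
  split_ifs with h
  · rw [h.1, zero_smul]
  · rw [smul_zero]

theorem map_delSeries {B : Type*} [Ring B] (φ : A →+* B) (c : ℕ → A) :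
    map φ (delSeries c) = delSeries fun n => φ (c n) := by
  ext a b
  rw [coeff_map, coeff_delSeries, coeff_delSeries]
  split_ifs <;> simp

theorem map_zSeries {B : Type*} [Ring B] (φ : A →+* B) (c : ℕ → A) :
    map φ (zSeries c) = zSeries fun n => φ (c n) := by
  ext a b
  rw [coeff_map, coeff_zSeries, coeff_zSeries]
  split_ifs <;> simp

/-- No reordering is needed in `ω(f)` when no term of `f` involves both `z` and `∂`. -/
theorem coeff_fourier_of_separate {f : PDO A} (h : ∀ i j, f.coeff i j ≠ 0 → i = 0 ∨ j = 0)
    (a b : ℤ) : (fourier f).coeff a b = ((Int.negOnePow a : ℤˣ) : ℤ) • f.coeff b a := by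
  change ∑ᶠ k : ℕ, wc (b + k) (a + k) k • ((Int.negOnePow (a + k) : ℤˣ) : ℤ) •
    f.coeff (b + k) (a + k) = _
  rw [finsum_eq_single _ 0]
  · simp [wc]
  · intro k hk
    by_cases h0 : f.coeff (b + k) (a + k) = 0
    · rw [h0, smul_zero, smul_zero]
    · have : wc (b + k) (a + k) k = 0 := by
        rcases h _ _ h0 with h1 | h1 <;>
          rw [wc, h1, Ring.choose_zero_pos ℤ (Nat.pos_of_ne_zero hk)] <;> simp
      rw [this, zero_smul]

variable [Algebra ℂ A]

theorem map_const {B : Type*} [Ring B] [Algebra ℂ B] (φ : A →ₐ[ℂ] B) (c : ℂ) :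
    map (φ : A →+* B) (const c) = const c := by
  ext a b
  rw [coeff_map, const, const, coeff_mono, coeff_mono]
  split_ifs <;> simp

/-- The resolvent `(∂ - J)⁻¹ = ∑ J^n ∂^{-n-1}`. -/
def delResolvent (A : Type*) [Ring A] [Algebra ℂ A] {N : ℕ} (J : Matrix (Fin N) (Fin N) ℂ) :
    Matrix (Fin N) (Fin N) (PDO A) :=
  Matrix.of fun r t => delSeries fun n => algebraMap ℂ A ((J ^ n) r t)

/-- The resolvent `(z - J)⁻¹ = ∑ J^n z^{-n-1}`. -/
def zResolvent (A : Type*) [Ring A] [Algebra ℂ A] {N : ℕ} (J : Matrix (Fin N) (Fin N) ℂ) :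
    Matrix (Fin N) (Fin N) (PDO A) :=
  Matrix.of fun r t => zSeries fun n => algebraMap ℂ A ((J ^ n) r t)

/-- The matrix `x - J` for a variable `x`. -/
def charMatrix {N : ℕ} (x : PDO A) (J : Matrix (Fin N) (Fin N) ℂ) :
    Matrix (Fin N) (Fin N) (PDO A) :=
  Matrix.of fun r t => (if r = t then x else 0) - const (J r t)

variable {N : ℕ} (J : Matrix (Fin N) (Fin N) ℂ)

theorem mono_algebraMap_one (r t : Fin N) :
    (mono 0 0 (algebraMap ℂ A ((J ^ 0) r t)) : PDO A) = (1 : Matrix (Fin N) (Fin N) (PDO A)) r t := by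
  rw [pow_zero, Matrix.one_apply, Matrix.one_apply]
  split_ifs
  · rw [map_one]; rfl
  · rw [map_zero, mono_zero]

theorem charMatrix_mul_delResolvent : charMatrix del J * delResolvent A J = 1 := by
  ext1 r t
  simp only [Matrix.mul_apply, charMatrix, delResolvent, Matrix.of_apply, sub_mul,
    Finset.sum_sub_distrib, ite_mul, zero_mul, const, mono_mul_delSeries, Finset.sum_ite_eq,
    Finset.mem_univ, if_true, delSeries_sum, del_mul_delSeries, mono_algebraMap_one]
  rw [add_sub_assoc, add_eq_left, sub_eq_zero]
  congr 1
  funext n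
  rw [pow_succ', Matrix.mul_apply, map_sum]
  simp only [map_mul]

theorem delResolvent_mul_charMatrix : delResolvent A J * charMatrix del J = 1 := by
  ext1 r t
  simp only [Matrix.mul_apply, charMatrix, delResolvent, Matrix.of_apply, mul_sub,
    Finset.sum_sub_distrib, mul_ite, mul_zero, const, delSeries_mul_mono, Finset.sum_ite_eq',
    Finset.mem_univ, if_true, delSeries_sum, delSeries_mul_del, mono_algebraMap_one]
  rw [add_sub_assoc, add_eq_left, sub_eq_zero]
  congr 1
  funext n
  rw [pow_succ, Matrix.mul_apply, map_sum]
  simp only [map_mul]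

theorem charMatrix_mul_zResolvent : charMatrix zvar J * zResolvent A J = 1 := by
  ext1 r t
  simp only [Matrix.mul_apply, charMatrix, zResolvent, Matrix.of_apply, sub_mul,
    Finset.sum_sub_distrib, ite_mul, zero_mul, const, mono_mul_zSeries, Finset.sum_ite_eq,
    Finset.mem_univ, if_true, zSeries_sum, zvar_mul_zSeries, mono_algebraMap_one]
  rw [add_sub_assoc, add_eq_left, sub_eq_zero]
  congr 1
  funext n
  rw [pow_succ', Matrix.mul_apply, map_sum]
  simp only [map_mul]

theorem zResolvent_mul_charMatrix : zResolvent A J * charMatrix zvar J = 1 := by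
  ext1 r t
  simp only [Matrix.mul_apply, charMatrix, zResolvent, Matrix.of_apply, mul_sub,
    Finset.sum_sub_distrib, mul_ite, mul_zero, const, zSeries_mul_mono, Finset.sum_ite_eq',
    Finset.mem_univ, if_true, zSeries_sum, zSeries_mul_zvar, mono_algebraMap_one]
  rw [add_sub_assoc, add_eq_left, sub_eq_zero]
  congr 1
  funext n
  rw [pow_succ, Matrix.mul_apply, map_sum]
  simp only [map_mul]

theorem mono_commute_delResolvent (x : A) (r t : Fin N) :
    Commute (mono 0 0 x) (delResolvent A J r t) :=
  mono_commute fun a b => by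
    rw [delResolvent, Matrix.of_apply, coeff_delSeries]
    split_ifs
    · exact (Algebra.commutes _ x).symm
    · exact Commute.zero_right x

/-- Since `[z, ∂ - J] = -1`, the resolvent `G = (∂ - J)⁻¹` satisfies `[z, G] = G²`. -/
theorem zvar_delResolvent (r t : Fin N) :
    zvar * delResolvent A J r t - delResolvent A J r t * zvar =
      (delResolvent A J * delResolvent A J) r t := by
  set G := delResolvent A J with hG
  set T := charMatrix (A := A) del J with hT
  set D : Matrix (Fin N) (Fin N) (PDO A) := Matrix.diagonal fun _ => zvar with hD
  have h1 : D * T - T * D = -1 := by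
    ext1 i j
    rw [Matrix.sub_apply, hD, Matrix.diagonal_mul, Matrix.mul_diagonal, hT, charMatrix,
      Matrix.of_apply, mul_sub, sub_mul, (const_commute (J i j) zvar).eq, Matrix.neg_apply,
      Matrix.one_apply]
    split_ifs
    · rw [del_mul_zvar]; abel
    · simp
  have h2 : D * G - G * D = G * G := by
    calc D * G - G * D = (G * T) * D * G - G * D * (T * G) := by
          rw [delResolvent_mul_charMatrix, charMatrix_mul_delResolvent, one_mul, mul_one]
      _ = -(G * (D * T - T * D) * G) := by noncomm_ring
      _ = G * G := by rw [h1]; noncomm_ring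
  have := congrFun (congrFun h2 r) t
  rwa [Matrix.sub_apply, hD, Matrix.diagonal_mul, Matrix.mul_diagonal] at this

theorem delResolvent_commute (r t r' t' : Fin N) :
    Commute (delResolvent A J r t) (delResolvent A J r' t') := by
  set G := delResolvent A J with hG
  set T := charMatrix (A := A) del J with hT
  set D : Matrix (Fin N) (Fin N) (PDO A) := Matrix.diagonal fun _ => G r t with hD
  have h1 : D * T = T * D := by
    ext1 i j
    rw [hD, Matrix.diagonal_mul, Matrix.mul_diagonal, hT, charMatrix, Matrix.of_apply, mul_sub,
      sub_mul, (const_commute (J i j) (G r t)).eq, mul_ite, ite_mul, mul_zero, zero_mul, hG,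
      delResolvent, Matrix.of_apply, delSeries_mul_del, del_mul_delSeries]
  have h2 : D * G = G * D := by
    calc D * G = G * T * D * G := by rw [delResolvent_mul_charMatrix, one_mul]
      _ = G * D * (T * G) := by rw [mul_assoc G T D, ← h1]; simp only [mul_assoc]
      _ = G * D := by rw [charMatrix_mul_delResolvent, mul_one]
  have := congrFun (congrFun h2 r') t'
  rwa [hD, Matrix.diagonal_mul, Matrix.mul_diagonal] at this

end Series

end PDO

namespace Gaudin

/-! ### Jordan matrices and evaluation maps -/

section Jordan

variable {c N : ℕ} (γ : Fin c → ℕ)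

theorem blockStart_total : blockStart γ c = ∑ i, γ i :=
  Finset.sum_congr rfl fun i _ => if_pos i.isLt

theorem exists_block {r : ℕ} (hr : r < ∑ i, γ i) :
    ∃ i : Fin c, blockStart γ i ≤ r ∧ r < blockStart γ (i + 1) := by
  have key : ∀ n ≤ c, r < blockStart γ n →
      ∃ i : Fin c, blockStart γ i ≤ r ∧ r < blockStart γ (i + 1) := by
    intro n
    induction n with
    | zero => intro _ h; simp [blockStart] at h
    | succ n ih =>
      intro hn h
      rcases Nat.lt_or_ge r (blockStart γ n) with h' | h'
      · exact ih (by omega) h'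
      · exact ⟨⟨n, hn⟩, h', h⟩
  exact key c le_rfl (by rwa [blockStart_total])

theorem block_unique {r : ℕ} {i i' : Fin c} (h1 : blockStart γ i ≤ r)
    (h2 : r < blockStart γ (i + 1)) (h3 : blockStart γ i' ≤ r)
    (h4 : r < blockStart γ (i' + 1)) : i = i' := by
  by_contra hne
  have hne : (i : ℕ) ≠ i' := fun h' => hne (Fin.ext h')
  rcases lt_or_gt_of_ne hne with h' | h'
  · have := blockStart_mono γ (show (i : ℕ) + 1 ≤ i' by omega)
    omega
  · have := blockStart_mono γ (show (i' : ℕ) + 1 ≤ i by omega)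
    omega

variable {γ}

/-- The block containing the index `r`. -/
def blockOf (hN : ∑ i, γ i = N) (r : Fin N) : Fin c :=
  (exists_block γ (r := r) (by rw [hN]; exact r.isLt)).choose

theorem blockOf_spec (hN : ∑ i, γ i = N) (r : Fin N) :
    blockStart γ (blockOf hN r) ≤ r ∧ (r : ℕ) < blockStart γ (blockOf hN r + 1) :=
  (exists_block γ (r := r) (by rw [hN]; exact r.isLt)).choose_spec

theorem blockOf_eq_iff (hN : ∑ i, γ i = N) (r : Fin N) (i : Fin c) :
    blockOf hN r = i ↔ blockStart γ i ≤ r ∧ (r : ℕ) < blockStart γ (i + 1) := by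
  constructor
  · rintro rfl; exact blockOf_spec hN r
  · rintro ⟨h1, h2⟩
    obtain ⟨h3, h4⟩ := blockOf_spec hN r
    exact block_unique γ h3 h4 h1 h2

theorem card_blockOf (hN : ∑ i, γ i = N) (i : Fin c) :
    (Finset.univ.filter fun r => blockOf hN r = i).card = γ i := by
  have h1 : blockStart γ (i + 1) ≤ N := by
    rw [← hN, ← blockStart_total]
    exact blockStart_mono γ i.isLt
  have h2 : (Finset.univ.filter fun r : Fin N => blockOf hN r = i).map Fin.valEmbedding =
      Finset.Ico (blockStart γ i) (blockStart γ (i + 1)) := by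
    ext x
    simp only [Finset.mem_map, Finset.mem_filter, Finset.mem_univ, true_and, blockOf_eq_iff,
      Finset.mem_Ico, Fin.valEmbedding_apply]
    constructor
    · rintro ⟨r, h, rfl⟩; exact h
    · rintro h; exact ⟨⟨x, by omega⟩, h, rfl⟩
  rw [← Finset.card_map Fin.valEmbedding, h2, Nat.card_Ico, blockStart_succ]
  omega

theorem sum_shiftMat_zero (hN : ∑ i, γ i = N) :
    ∑ i, (shiftMat γ i 0 : Matrix (Fin N) (Fin N) ℂ) = 1 := by
  ext r r'
  rw [Matrix.sum_apply, Finset.sum_eq_single (blockOf hN r)]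
  · obtain ⟨h1, h2⟩ := blockOf_spec hN r
    rw [shiftMat, Matrix.of_apply, Matrix.one_apply]
    refine if_congr ⟨fun h => Fin.ext h.2.1, ?_⟩ rfl rfl
    rintro rfl
    exact ⟨h1, rfl, h2⟩
  · intro i _ hi
    rw [shiftMat, Matrix.of_apply, if_neg]
    rintro ⟨h1, h2, h3⟩
    exact hi ((blockOf_eq_iff hN r i).2 ⟨h1, by omega⟩).symm
  · simp

theorem jordan_eq (z : Fin c → ℂ) : (jordan γ z : Matrix (Fin N) (Fin N) ℂ) =
    ∑ i, (z i • shiftMat γ i 0 + shiftMat γ i 1) := by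
  ext r r'
  rw [Matrix.sum_apply, jordan, Matrix.of_apply]
  refine Finset.sum_congr rfl fun i _ => ?_
  rw [Matrix.add_apply, Matrix.smul_apply, shiftMat, shiftMat, Matrix.of_apply, Matrix.of_apply,
    smul_eq_mul, mul_ite, mul_one, mul_zero]

theorem jordan_upper (z : Fin c → ℂ) {r r' : Fin N} (h : r' < r) :
    (jordan γ z : Matrix (Fin N) (Fin N) ℂ) r r' = 0 := by
  rw [jordan, Matrix.of_apply]
  refine Finset.sum_eq_zero fun i _ => ?_
  have h : (r' : ℕ) < r := h
  rw [if_neg (fun h' => by have := h'.2.1; omega), if_neg (fun h' => by have := h'.2.1; omega),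
    add_zero]

theorem jordan_diag (hN : ∑ i, γ i = N) (z : Fin c → ℂ) (r : Fin N) :
    (jordan γ z : Matrix (Fin N) (Fin N) ℂ) r r = z (blockOf hN r) := by
  rw [jordan, Matrix.of_apply, Finset.sum_eq_single (blockOf hN r)]
  · obtain ⟨h1, h2⟩ := blockOf_spec hN r
    rw [if_pos ⟨h1, rfl, h2⟩, if_neg (fun h' => by have := h'.2.1; omega), add_zero]
  · intro i _ hi
    rw [if_neg, if_neg (fun h' => by have := h'.2.1; omega), add_zero]
    rintro ⟨h1, h2, h3⟩
    exact hi ((blockOf_eq_iff hN r i).2 ⟨h1, h3⟩).symm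
  · simp

theorem shiftMat_zero_mul_pow (i : Fin c) (k : ℕ) :
    (shiftMat γ i 0 * shiftMat γ i 1 ^ k : Matrix (Fin N) (Fin N) ℂ) = shiftMat γ i k := by
  induction k with
  | zero => rw [pow_zero, mul_one]
  | succ k ih => rw [pow_succ, ← mul_assoc, ih, shiftMat_mul, if_pos rfl]

/-- The powers of a Jordan matrix have the binomial coefficients of the expansion of `t^n` in powers
of `t - z_i`, which defines the evaluation maps. -/
theorem jordan_pow (hN : ∑ i, γ i = N) (z : Fin c → ℂ) (n : ℕ) :
    (jordan γ z : Matrix (Fin N) (Fin N) ℂ) ^ n =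
    ∑ i, ∑ k ∈ Finset.range (n + 1), ((n.choose k : ℂ) * z i ^ (n - k)) • shiftMat γ i k := by
  -- The matrices `shiftMat γ i 0` are orthogonal idempotents with sum `1`, so the blocks separate.
  have h1 : ∀ n, (jordan γ z : Matrix (Fin N) (Fin N) ℂ) ^ n =
      ∑ i, shiftMat γ i 0 * (shiftMat γ i 1 + z i • 1) ^ n := by
    intro n
    induction n with
    | zero => simp only [pow_zero, mul_one, sum_shiftMat_zero hN]
    | succ n ih =>
      rw [pow_succ', ih, Finset.mul_sum]
      refine Finset.sum_congr rfl fun i _ => ?_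
      rw [pow_succ', ← mul_assoc, ← mul_assoc]
      congr 1
      rw [jordan_eq, Finset.sum_mul, Finset.sum_eq_single i]
      · rw [add_mul, mul_add, smul_mul_assoc, shiftMat_mul, shiftMat_mul, shiftMat_mul, if_pos rfl,
          if_pos rfl, mul_smul_comm, mul_one, add_zero, add_comm, add_zero]
      · intro j _ hj
        rw [add_mul, smul_mul_assoc, shiftMat_mul, shiftMat_mul, if_neg hj, if_neg hj, smul_zero,
          add_zero]
      · simp
  rw [h1]
  refine Finset.sum_congr rfl fun i _ => ?_
  rw [Commute.add_pow ((Commute.one_right _).smul_right _), Finset.mul_sum]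
  refine Finset.sum_congr rfl fun k _ => ?_
  rw [smul_pow, one_pow, mul_smul_comm, mul_one, smul_mul_assoc, mul_smul_comm, ← mul_assoc,
    shiftMat_zero_mul_pow, (Nat.commute_cast _ _).eq, ← nsmul_eq_mul, mul_smul,
    ← Nat.cast_smul_eq_nsmul ℂ, smul_comm]

end Jordan

/-! ### The block matrix of oscillators -/

section Oscillators

variable {A : Type*} [Ring A] [Algebra ℂ A] {d N : ℕ}

/-- The matrix `X`, with entries the annihilation operators. -/
def oscX (Q : Fin N × Fin d → A) : Matrix (Fin d) (Fin N) (PDO A) :=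
  Matrix.of fun a r => PDO.mono 0 0 (Q (r, a))

/-- The matrix `Y`, with entries the creation operators, up to signs. -/
def oscY (s : Fin N → ℕ) (P : Fin N × Fin d → A) : Matrix (Fin N) (Fin d) (PDO A) :=
  Matrix.of fun r a => sg (s r) • PDO.mono 0 0 (P (r, a))

/-- The matrix with blocks `z - J'ᵀ`, `X`, `Y` and `∂ - J`. Its two Schur complements are the images
of the two Lax matrices. -/
def oscMatrix (s : Fin N → ℕ) (P Q : Fin N × Fin d → A) (J' : Matrix (Fin d) (Fin d) ℂ)
    (J : Matrix (Fin N) (Fin N) ℂ) : Matrix (Fin d ⊕ Fin N) (Fin d ⊕ Fin N) (PDO A) :=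
  Matrix.fromBlocks (PDO.charMatrix PDO.zvar J'.transpose) (oscX Q) (oscY s P)
    (PDO.charMatrix PDO.del J)

/-- The antisymmetric form of the supercommutation relations of `oscMatrix`. -/
def oscForm {α β : Type*} : α ⊕ β → α ⊕ β → ℤ
  | Sum.inl _, Sum.inr _ => -1
  | Sum.inr _, Sum.inl _ => 1
  | _, _ => 0

theorem oscForm_antisymm {α β : Type*} (k l : α ⊕ β) : oscForm l k = -oscForm k l := by
  rcases k with k | k <;> rcases l with l | l <;> rfl

theorem mono_sg_smul (k : ℕ) (x : A) :
    PDO.mono 0 0 ((-1 : ℂ) ^ k • x) = sg k • PDO.mono 0 0 x := by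
  have : (-1 : ℂ) ^ k • x = sg k • x := by
    rw [← Int.cast_smul_eq_zsmul ℂ, sg]; push_cast; rfl
  rw [this, ← PDO.constHom_apply, map_zsmul, PDO.constHom_apply]

theorem mono_mul {A : Type*} [Ring A] (x y : A) :
    PDO.mono 0 0 x * PDO.mono 0 0 y = PDO.mono 0 0 (x * y) := by
  rw [PDO.mono_mul_mono, add_zero]

theorem mono_ite {A : Type*} [Ring A] (P : Prop) [Decidable P] :
    (PDO.mono 0 0 (if P then (1 : A) else 0)) = if P then 1 else 0 := by
  split_ifs
  · rfl
  · exact PDO.mono_zero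

variable {s : Fin N → ℕ} {P Q : Fin N × Fin d → A}

theorem oscX_oscX (h : CCR (fun v => s v.1) P Q) (a a' : Fin d) (r r' : Fin N) :
    oscX Q a r * oscX Q a' r' =
      sg (s r * s r') • (oscX Q a' r' * oscX Q a r) := by
  simp only [oscX, Matrix.of_apply, mono_mul]
  rw [h.qq, mono_sg_smul]

theorem oscY_oscY (h : CCR (fun v => s v.1) P Q) (a a' : Fin d) (r r' : Fin N) :
    oscY s P r a * oscY s P r' a' =
      sg (s r * s r') • (oscY s P r' a' * oscY s P r a) := by
  simp only [oscY, Matrix.of_apply, smul_mul_assoc, mul_smul_comm, mono_mul]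
  rw [h.pp, mono_sg_smul, smul_smul, smul_smul, smul_smul, smul_smul]
  congr 1
  ring

theorem oscY_oscX (h : CCR (fun v => s v.1) P Q) (a a' : Fin d) (r r' : Fin N) :
    oscY s P r a * oscX Q a' r' =
      sg (s r * s r') • (oscX Q a' r' * oscY s P r a) -
        if a' = a ∧ r = r' then 1 else 0 := by
  simp only [oscX, oscY, Matrix.of_apply, smul_mul_assoc, mul_smul_comm, mono_mul]
  rw [h.qp, PDO.mono_add, mono_sg_smul, mono_ite, smul_add, smul_add, smul_smul,
    smul_smul, smul_smul, mul_right_comm]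
  have e : sg (s r * s r') *
      sg (s r' * s r) = 1 := by
    rw [mul_comm (s r')]
    exact sg_mul_self _
  rw [e, one_mul, add_sub_assoc, left_eq_add, sub_eq_zero]
  by_cases h' : a' = a ∧ r = r'
  · obtain ⟨rfl, rfl⟩ := h'
    simp only [and_self, if_true]
    rw [← sg_add]
    have : sg (s r * s r + s r) = sg 0 := by
      refine sg_congr ?_
      have h2 : (2 : ZMod 2) = 0 := rfl
      have h3 := zmod_two_sq (s r)
      push_cast
      linear_combination (s r : ZMod 2) * h2 + h3
    rw [this, sg_zero, one_smul]
  · rw [if_neg h', if_neg, smul_zero]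
    rw [Prod.mk.injEq]
    exact fun h0 => h' ⟨h0.2, h0.1.symm⟩

theorem oscX_commute_zvar (a : Fin d) (r : Fin N) :
    Commute (oscX Q a r) PDO.zvar := PDO.mono_commute_zvar _

theorem oscX_commute_del (a : Fin d) (r : Fin N) :
    Commute (oscX Q a r) PDO.del := PDO.mono_commute_del _

theorem oscY_commute_zvar (a : Fin d) (r : Fin N) :
    Commute (oscY s P r a) PDO.zvar := by
  rw [oscY, Matrix.of_apply]
  exact (PDO.mono_commute_zvar _).smul_left _

theorem oscY_commute_del (a : Fin d) (r : Fin N) :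
    Commute (oscY s P r a) PDO.del := by
  rw [oscY, Matrix.of_apply]
  exact (PDO.mono_commute_del _).smul_left _

theorem charMatrix_commute {x f : PDO A}
    (J : Matrix (Fin N) (Fin N) ℂ) (h : Commute f x) (r t : Fin N) :
    Commute f (PDO.charMatrix x J r t) := by
  rw [PDO.charMatrix, Matrix.of_apply]
  refine Commute.sub_right ?_ (PDO.const_commute _ _).symm
  split_ifs
  · exact h
  · exact Commute.zero_right f

theorem charMatrix_self_commute {x : PDO A}
    (J : Matrix (Fin N) (Fin N) ℂ) (r t r' t' : Fin N) :
    Commute (PDO.charMatrix x J r t) (PDO.charMatrix x J r' t') :=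
  charMatrix_commute J (charMatrix_commute J (Commute.refl x) r t).symm r' t'

theorem charMatrix_zvar_del {N' : ℕ}
    (J : Matrix (Fin N) (Fin N) ℂ) (J' : Matrix (Fin N') (Fin N') ℂ) (a b : Fin N)
    (r t : Fin N') :
    PDO.charMatrix (A := A) PDO.zvar J a b * PDO.charMatrix PDO.del J' r t =
      PDO.charMatrix PDO.del J' r t * PDO.charMatrix PDO.zvar J a b -
        if a = b ∧ r = t then 1 else 0 := by
  have h1 : ∀ f : PDO A, f * PDO.const (J a b) = PDO.const (J a b) * f := fun f =>
    (PDO.const_commute _ f).eq.symm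
  have h2 : ∀ f : PDO A, f * PDO.const (J' r t) = PDO.const (J' r t) * f := fun f =>
    (PDO.const_commute _ f).eq.symm
  simp only [PDO.charMatrix, Matrix.of_apply, mul_sub, sub_mul, h1]
  rw [h2 (if a = b then PDO.zvar else 0), ← h1 (PDO.const (J' r t))]
  have : (if a = b then (PDO.zvar : PDO A) else 0) * (if r = t then PDO.del else 0) =
      (if r = t then PDO.del else 0) * (if a = b then PDO.zvar else 0) -
        if a = b ∧ r = t then 1 else 0 := by
    by_cases h : a = b <;> by_cases h' : r = t <;> simp [h, h', PDO.del_mul_zvar]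
  rw [this]
  abel

/-- The supercommutators of the entries of `oscMatrix` are constants. The assumption on `J` makes the
entries of `∂ - J` even. -/
theorem oscMatrix_centralRel (h : CCR (fun v => s v.1) P Q) (J' : Matrix (Fin d) (Fin d) ℂ)
    {J : Matrix (Fin N) (Fin N) ℂ} (hJ : ∀ r t, J r t ≠ 0 → s r = s t) :
    CentralRel (Sum.elim (fun _ => 0) s) oscForm (oscMatrix s P Q J' J) := by
  have zz := charMatrix_self_commute (A := A) (x := PDO.zvar) J'.transpose
  have tt := charMatrix_self_commute (A := A) (x := PDO.del) J
  have zt := charMatrix_zvar_del (A := A) J'.transpose J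
  have xz := fun a r => charMatrix_commute J'.transpose (oscX_commute_zvar (Q := Q) a r)
  have xt := fun a r => charMatrix_commute J (oscX_commute_del (Q := Q) a r)
  have yz := fun a r => charMatrix_commute J'.transpose (oscY_commute_zvar (s := s) (P := P) a r)
  have yt := fun a r => charMatrix_commute J (oscY_commute_del (s := s) (P := P) a r)
  have ee : ∀ k l : ℕ, sg (k * (l + l)) = 1 ∧ sg ((l + l) * k) = 1 := fun k l => by
    have h : sg (k * (l + l)) = sg 0 := by
      refine sg_congr ?_
      have h2 : (2 : ZMod 2) = 0 := rfl
      push_cast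
      linear_combination (k : ZMod 2) * l * h2
    exact ⟨h, by rw [mul_comm]; exact h⟩
  -- The entries of `∂ - J` are even, so the signs of their supercommutators are trivial.
  have hT : ∀ (e : ℕ) (r t : Fin N) (f : PDO A), Commute f (PDO.charMatrix PDO.del J r t) →
      sg (e * (s r + s t)) • (f * PDO.charMatrix PDO.del J r t) =
        f * PDO.charMatrix PDO.del J r t := fun e r t f _ => by
    by_cases h0 : s r = s t
    · rw [h0, (ee e (s t)).1, one_smul]
    · have h1 : J r t = 0 := by by_contra h1; exact h0 (hJ r t h1)
      have h2 : r ≠ t := fun h2 => h0 (by rw [h2])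
      rw [PDO.charMatrix, Matrix.of_apply, if_neg h2, h1, PDO.const, map_zero, PDO.mono_zero,
        sub_zero, mul_zero, smul_zero]
  rintro (i | i) (j | j) (k | k) (l | l) <;>
    simp only [oscMatrix, Matrix.fromBlocks_apply₁₁, Matrix.fromBlocks_apply₁₂,
      Matrix.fromBlocks_apply₂₁, Matrix.fromBlocks_apply₂₂, oscForm, Sum.elim_inl,
      Sum.elim_inr, add_zero, zero_add, mul_zero, zero_mul, sg_zero, one_smul, zero_smul,
      Sum.inl.injEq, Sum.inr.injEq, reduceCtorEq, false_and, and_false, if_false, one_mul]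
  · exact sub_eq_zero.2 (zz _ _ _ _).eq
  · exact sub_eq_zero.2 (xz _ _ _ _).eq.symm
  · exact sub_eq_zero.2 (yz _ _ _ _).eq.symm
  · rw [zt, sub_sub_cancel_left]
    split_ifs <;> simp
  · exact sub_eq_zero.2 (xz _ _ _ _).eq
  · exact sub_eq_zero.2 (oscX_oscX h _ _ _ _)
  · rw [oscY_oscX h, smul_sub, smul_smul, mul_comm (s k), sg_mul_self, one_smul, sub_sub_cancel]
    by_cases h' : i = l ∧ k = j
    · obtain ⟨rfl, rfl⟩ := h'
      simp only [and_self, if_true, mul_one]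
      congr 1
      refine sg_congr ?_
      push_cast
      exact zmod_two_sq _
    · simp [h']
  · rw [← (xt i j k l).eq, hT _ _ _ _ (xt i j k l), sub_self]
  · exact sub_eq_zero.2 (yz _ _ _ _).eq
  · rw [oscY_oscX h, sub_sub_cancel_left]
    simp only [and_comm (a := k = j)]
    split_ifs <;> simp
  · exact sub_eq_zero.2 (oscY_oscY h _ _ _ _)
  · rw [← (yt j i k l).eq, hT _ _ _ _ (yt j i k l), sub_self]
  · rw [zt, sub_sub_cancel]
    simp only [and_comm (a := k = l)]
    split_ifs <;> simp
  · rw [(xt k l i j).eq, mul_comm (s i + s j), ← (xt k l i j).eq, hT _ _ _ _ (xt k l i j), sub_self]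
  · rw [(yt l k i j).eq, mul_comm (s i + s j), ← (yt l k i j).eq, hT _ _ _ _ (yt l k i j), sub_self]
  · rw [(tt k l i j).eq, mul_comm (s i + s j), ← (tt k l i j).eq, hT _ _ _ _ (tt k l i j), sub_self]

theorem oscMatrix_nearDiagonal (s : Fin N → ℕ) (P Q : Fin N × Fin d → A)
    (J' : Matrix (Fin d) (Fin d) ℂ) (J : Matrix (Fin N) (Fin N) ℂ) :
    PDO.NearDiagonal (oscMatrix s P Q J' J) := by
  refine ⟨Sum.elim (fun _ => PDO.zvar) fun _ => PDO.del, ?_, ?_⟩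
  · rintro (i | i)
    · exact Or.inl rfl
    · exact Or.inr rfl
  · rintro (i | i) (j | j)
    · simp only [oscMatrix, Matrix.fromBlocks_apply₁₁, PDO.charMatrix, Matrix.of_apply,
        Sum.elim_inl, Sum.inl.injEq, sub_sub_cancel_left]
      exact AddSubgroup.neg_mem _ (PDO.mono_mem_fil _)
    · simp only [oscMatrix, Matrix.fromBlocks_apply₁₂, reduceCtorEq, if_false, sub_zero]
      exact PDO.mono_mem_fil _
    · simp only [oscMatrix, Matrix.fromBlocks_apply₂₁, reduceCtorEq, if_false, sub_zero]
      exact AddSubgroup.zsmul_mem _ (PDO.mono_mem_fil _) _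
    · simp only [oscMatrix, Matrix.fromBlocks_apply₂₂, PDO.charMatrix, Matrix.of_apply,
        Sum.elim_inr, Sum.inr.injEq, sub_sub_cancel_left]
      exact AddSubgroup.neg_mem _ (PDO.mono_mem_fil _)

end Oscillators

/-! ### The Manin property of the Schur complement -/

section ManinSchur

/-- For supercommuting families `V` and `Y` with `[Y_{sb}, V_{at}] = -δ_{ab} G_{st}` and
`[z, V] = V G`, the matrix `z - c - V Y` with central `c` is a Manin matrix. -/
theorem isManin_of_oscillators {R α β : Type*} [Ring R] [Fintype β] [DecidableEq α] (s : β → ℕ)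
    {V : Matrix α β R} {Y : Matrix β α R} {G : Matrix β β R} {z : R} {c : Matrix α α R}
    (hc : ∀ a b x, Commute (c a b) x)
    (hV : ∀ a a' r r', V a r * V a' r' = sg (s r * s r') • (V a' r' * V a r))
    (hY : ∀ a a' r r', Y r a * Y r' a' = sg (s r * s r') • (Y r' a' * Y r a))
    (hYV : ∀ a a' r r', Y r a * V a' r' = sg (s r * s r') • (V a' r' * Y r a) -
      if a' = a then G r r' else 0)
    (hzV : ∀ a r, z * V a r = V a r * z + (V * G) a r) (hzY : ∀ a r, Commute z (Y r a)) :
    IsManin (Matrix.of fun a b => (if a = b then z else 0) - c a b - (V * Y) a b) := by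
  set Q := V * G * Y with hQ
  have hQ' : ∀ a b, Q a b = ∑ r, ∑ t, V a r * G r t * Y t b := fun a b => by
    rw [hQ, Matrix.mul_apply, Finset.sum_comm]
    simp only [Matrix.mul_apply, Finset.sum_mul]
  have hz : ∀ a b, z * (V * Y) a b = (V * Y) a b * z + Q a b := fun a b => by
    rw [hQ, Matrix.mul_apply, Matrix.mul_apply, Finset.mul_sum, Finset.sum_mul,
      ← Finset.sum_add_distrib]
    refine Finset.sum_congr rfl fun r _ => ?_
    rw [← mul_assoc, hzV, add_mul, mul_assoc (V a r) z, (hzY b r).eq, mul_assoc]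
  -- The commutators of the entries of `V Y` have the shape of those of `gl`, with `Q` on the right.
  have hH : ∀ a b a' b', (V * Y) a b * (V * Y) a' b' - (V * Y) a' b' * (V * Y) a b =
      (if a = b' then Q a' b else 0) - if a' = b then Q a b' else 0 := by
    intro a b a' b'
    have e1 : ∀ a b a' b' r t, V a r * Y r b * (V a' t * Y t b') =
        sg (s r * s t) • (V a r * V a' t * (Y r b * Y t b')) -
          if a' = b then V a r * G r t * Y t b' else 0 := by
      intro a b a' b' r t
      calc V a r * Y r b * (V a' t * Y t b') = V a r * (Y r b * V a' t) * Y t b' := by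
            simp only [mul_assoc]
        _ = _ := by
            rw [hYV, mul_sub, sub_mul, mul_smul_comm, smul_mul_assoc, mul_ite, mul_zero, ite_mul,
              zero_mul]
            simp only [mul_assoc]
    have e2 : ∀ r t, V a' t * V a r * (Y t b' * Y r b) = V a r * V a' t * (Y r b * Y t b') := by
      intro r t
      rw [hV a' a, hY b' b, smul_mul_smul_comm, sg_mul_self, one_smul]
    have e3 : (V * Y) a b * (V * Y) a' b' = ∑ r, ∑ t, V a r * Y r b * (V a' t * Y t b') := by
      rw [Matrix.mul_apply, Matrix.mul_apply, Finset.sum_mul_sum]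
    have e4 : (V * Y) a' b' * (V * Y) a b = ∑ r, ∑ t, V a' t * Y t b' * (V a r * Y r b) := by
      rw [Matrix.mul_apply, Matrix.mul_apply, Finset.sum_mul_sum, Finset.sum_comm]
    have e5 : ∀ (p : Prop) [Decidable p] (f : β → β → R),
        ∑ r, ∑ t, (if p then f r t else 0) = if p then ∑ r, ∑ t, f r t else 0 := by
      intro p _ f; split_ifs <;> simp
    rw [e3, e4]
    simp only [e1, e2, Finset.sum_sub_distrib, e5]
    rw [← hQ', Finset.sum_comm (f := fun r t => V a' t * G t r * Y r b), ← hQ']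
    have e6 : ∑ r, ∑ t, sg (s r * s t) • (V a r * V a' t * (Y r b * Y t b')) =
        ∑ r, ∑ t, sg (s t * s r) • (V a r * V a' t * (Y r b * Y t b')) := by
      refine Finset.sum_congr rfl fun r _ => Finset.sum_congr rfl fun t _ => ?_
      rw [mul_comm (s r)]
    rw [e6]
    abel
  -- The commutator of two entries is symmetric under the exchange of the row indices.
  have key : ∀ a b a' b', ((if a = b then z else 0) - c a b - (V * Y) a b) *
      ((if a' = b' then z else 0) - c a' b' - (V * Y) a' b') -
      ((if a' = b' then z else 0) - c a' b' - (V * Y) a' b') *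
      ((if a = b then z else 0) - c a b - (V * Y) a b) =
      (if a' = b' then Q a b else 0) - (if a = b then Q a' b' else 0) +
        ((if a = b' then Q a' b else 0) - if a' = b then Q a b' else 0) := by
    intro a b a' b'
    rw [← hH a b a' b']
    have c1 : ∀ x, x * c a b = c a b * x := fun x => (hc a b x).eq.symm
    have c2 : ∀ x, x * c a' b' = c a' b' * x := fun x => (hc a' b' x).eq.symm
    have z1 : (if a = b then z else 0) * (V * Y) a' b' =
        (V * Y) a' b' * (if a = b then z else 0) + if a = b then Q a' b' else 0 := by
      split_ifs
      · exact hz a' b'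
      · simp
    have z2 : (if a' = b' then z else 0) * (V * Y) a b =
        (V * Y) a b * (if a' = b' then z else 0) + if a' = b' then Q a b else 0 := by
      split_ifs
      · exact hz a b
      · simp
    have z3 : (if a = b then z else 0) * (if a' = b' then z else 0) =
        (if a' = b' then z else 0) * (if a = b then z else 0) := by
      split_ifs <;> simp
    simp only [sub_mul, mul_sub, c1]
    simp only [c2, z1, z2, z3]
    rw [c1 (c a' b')]
    abel
  intro i j k l
  simp only [Matrix.of_apply]
  rw [key, key]
  abel

variable {A : Type*} [Ring A] [Algebra ℂ A] {d N : ℕ} {s : Fin N → ℕ} {P Q : Fin N × Fin d → A}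

theorem delResolvent_eq_zero {J : Matrix (Fin N) (Fin N) ℂ} (hJ : ∀ r t, J r t ≠ 0 → s r = s t)
    {r t : Fin N} (h : s r ≠ s t) : PDO.delResolvent A J r t = 0 := by
  have key : ∀ n r t, s r ≠ s t → (J ^ n) r t = 0 := by
    intro n
    induction n with
    | zero =>
      intro r t h
      rw [pow_zero, Matrix.one_apply_ne (fun h' => h (by rw [h']))]
    | succ n ih =>
      intro r t h
      rw [pow_succ, Matrix.mul_apply]
      refine Finset.sum_eq_zero fun x _ => ?_
      by_cases h1 : s r = s x
      · have : J x t = 0 := by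
          by_contra h2
          exact h (h1.trans (hJ x t h2))
        rw [this, mul_zero]
      · rw [ih r x h1, zero_mul]
  ext a b
  rw [PDO.delResolvent, Matrix.of_apply, PDO.coeff_delSeries]
  simp [key _ r t h]

/-- The matrix `z - J'ᵀ - X (∂ - J)⁻¹ Y` is a Manin matrix; here `X (∂ - J)⁻¹` takes the role of `V`
in `isManin_of_oscillators`, and `[z, (∂ - J)⁻¹] = (∂ - J)⁻²`. -/
theorem schur_isManin (h : CCR (fun v => s v.1) P Q) (J' : Matrix (Fin d) (Fin d) ℂ)
    {J : Matrix (Fin N) (Fin N) ℂ} (hJ : ∀ r t, J r t ≠ 0 → s r = s t) :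
    IsManin (PDO.charMatrix PDO.zvar J'.transpose - oscX Q * PDO.delResolvent A J * oscY s P) := by
  set G := PDO.delResolvent A J with hG
  have hXG : ∀ a r t t', Commute (oscX Q a r) (G t t') := fun a r t t' =>
    PDO.mono_commute_delResolvent J _ t t'
  have hYG : ∀ a r t t', Commute (oscY s P r a) (G t t') := fun a r t t' => by
    rw [oscY, Matrix.of_apply]
    exact (PDO.mono_commute_delResolvent J _ t t').smul_left _
  have hs : ∀ (x : Fin N) (r r' : Fin N) (f g : PDO A),
      sg (s x * s r') • (f * G r' r * g) = sg (s x * s r) • (f * G r' r * g) := by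
    intro x r r' f g
    by_cases h0 : s r' = s r
    · rw [h0]
    · rw [hG, delResolvent_eq_zero hJ h0, mul_zero, zero_mul, smul_zero, smul_zero]
  refine isManin_of_oscillators s (V := oscX Q * G) (Y := oscY s P) (G := G) (z := PDO.zvar)
    (c := Matrix.of fun a b => PDO.const (J'.transpose a b))
    (fun a b x => PDO.const_commute _ x) ?_ (fun a a' r r' => oscY_oscY h a a' r r') ?_ ?_
    (fun a r => (oscY_commute_zvar a r).symm)
  · intro a a' r r'
    rw [Matrix.mul_apply, Matrix.mul_apply, Finset.sum_mul_sum, Finset.sum_mul_sum,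
      Finset.sum_comm, Finset.smul_sum]
    refine Finset.sum_congr rfl fun t' _ => ?_
    rw [Finset.smul_sum]
    refine Finset.sum_congr rfl fun t _ => ?_
    have e1 : oscX Q a t * G t r * (oscX Q a' t' * G t' r') =
        oscX Q a t * oscX Q a' t' * G t' r' * G t r := by
      rw [mul_assoc, ← mul_assoc (G t r), ← (hXG a' t' t r).eq, mul_assoc (oscX Q a' t'),
        (show Commute (G t r) (G t' r') from PDO.delResolvent_commute J t r t' r').eq]
      simp only [mul_assoc]
    have e2 : oscX Q a' t' * G t' r' * (oscX Q a t * G t r) =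
        oscX Q a' t' * oscX Q a t * G t' r' * G t r := by
      rw [mul_assoc, ← mul_assoc (G t' r'), ← (hXG a t t' r').eq]
      simp only [mul_assoc]
    rw [e1, e2, oscX_oscX h, smul_mul_assoc, smul_mul_assoc, hs,
      ← mul_one (oscX Q a' t' * oscX Q a t * G t' r' * G t r), mul_comm (s t), hs,
      mul_comm (s r')]
  · intro a a' r r'
    rw [Matrix.mul_apply, Finset.mul_sum, Finset.sum_mul, Finset.smul_sum]
    have e : ∀ t, oscY s P r a * (oscX Q a' t * G t r') =
        sg (s r * s r') • (oscX Q a' t * G t r' * oscY s P r a) -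
          if r = t then (if a' = a then G t r' else 0) else 0 := by
      intro t
      rw [← mul_assoc, oscY_oscX h, sub_mul, smul_mul_assoc, mul_assoc, (hYG a r t r').eq,
        ← mul_assoc, hs]
      congr 1
      by_cases h1 : a' = a <;> by_cases h2 : r = t <;> simp [h1, h2]
    simp only [e, Finset.sum_sub_distrib, Finset.sum_ite_eq, Finset.mem_univ, if_true]
  · intro a r
    rw [Matrix.mul_assoc, Matrix.mul_apply, Matrix.mul_apply, Finset.mul_sum, Finset.sum_mul,
      ← Finset.sum_add_distrib]
    refine Finset.sum_congr rfl fun t _ => ?_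
    rw [← mul_assoc, ← (oscX_commute_zvar a t).eq, mul_assoc, mul_assoc, ← mul_add,
      ← PDO.zvar_delResolvent, add_sub_cancel]

end ManinSchur

/-! ### The images of the Lax matrices -/

section Lax

theorem psi_eq {I : Type} [DecidableEq I] (s : I → ℕ) {l : ℕ} (γ : Fin l → ℕ) (z : Fin l → ℂ)
    (μ : I → I → ℂ) (i j : I) : psi s γ z μ i j =
      PDO.const (μ i j) - PDO.zSeries fun k => evalCurrent s γ z k i j := by
  ext a b
  rw [PDO.coeff_sub, PDO.const, PDO.coeff_mono, PDO.coeff_zSeries]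
  change (if b = 0 then if a = 0 then algebraMap ℂ _ (μ i j) else
    if a < 0 then -evalCurrent s γ z (-a - 1).toNat i j else 0 else 0) = _
  by_cases hb : b = 0
  · rcases lt_trichotomy a 0 with ha | ha | ha
    · simp [hb, ha, ha.ne]
    · simp [hb, ha]
    · simp [hb, ha.not_gt, ha.ne']
  · simp [hb]

/-- The map `ω` sends `z` to `∂` and `∂` to `-z`; no reordering occurs, as the entries have no terms
involving both variables. -/
theorem Lhat_apply {d l : ℕ} (γ : Fin l → ℕ) (z : Fin l → ℂ) (μ : Fin d → Fin d → ℂ)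
    (i j : Fin d) : Lhat γ z μ i j = (if i = j then PDO.zvar else 0) + PDO.const (μ j i) -
      PDO.delSeries fun k => evalCurrent (fun _ : Fin d => 0) γ z k j i := by
  have hd : ∀ a b, (if i = j then (PDO.del : PDO (TakiffU (fun _ : Fin d => 0) γ)) else 0).coeff
      a b = if a = 0 ∧ b = 1 then (if i = j then 1 else 0) else 0 := by
    intro a b
    by_cases h : i = j
    · rw [if_pos h, if_pos h, PDO.del, PDO.coeff_mono]
    · rw [if_neg h, if_neg h]; simp
  have hz : ∀ a b, (if i = j then (PDO.zvar : PDO (TakiffU (fun _ : Fin d => 0) γ)) else 0).coeff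
      a b = if a = 1 ∧ b = 0 then (if i = j then 1 else 0) else 0 := by
    intro a b
    by_cases h : i = j
    · rw [if_pos h, if_pos h, PDO.zvar, PDO.coeff_mono]
    · rw [if_neg h, if_neg h]; simp
  ext a b
  rw [Lhat, Matrix.of_apply, PDO.coeff_neg, PDO.coeff_fourier_of_separate]
  · rw [psi_eq, PDO.coeff_sub, PDO.coeff_sub, PDO.coeff_sub, PDO.coeff_add, hd, hz, PDO.const,
      PDO.coeff_mono, PDO.coeff_mono, PDO.coeff_zSeries, PDO.coeff_delSeries]
    by_cases ha : a = 0
    · subst ha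
      rcases lt_trichotomy b 0 with hb | hb | hb
      · simp [hb, hb.ne]
      · simp [hb]
      · simp [hb.not_gt, hb.ne']
    · by_cases ha : a = 1
      · subst ha
        by_cases hb : b = 0
        · by_cases hij : i = j <;> simp [hb, hij]
        · simp [hb]
      · simp [*]
  · intro a b h
    by_contra! h'
    apply h
    rw [psi_eq, PDO.coeff_sub, PDO.coeff_sub, hd, PDO.const, PDO.coeff_mono, PDO.coeff_zSeries]
    simp [h'.1, h'.2]

section Schur

variable {A : Type*} [Ring A] [Algebra ℂ A] {d N : ℕ}

/-- The Schur complement `z - J'ᵀ - X (∂ - J)⁻¹ Y` of the block `∂ - J` in `oscMatrix`. -/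
def schurZ (s : Fin N → ℕ) (P Q : Fin N × Fin d → A) (J' : Matrix (Fin d) (Fin d) ℂ)
    (J : Matrix (Fin N) (Fin N) ℂ) : Matrix (Fin d) (Fin d) (PDO A) :=
  PDO.charMatrix PDO.zvar J'.transpose - oscX Q * PDO.delResolvent A J * oscY s P

/-- The Schur complement `∂ - J - Y (z - J'ᵀ)⁻¹ X` of the block `z - J'ᵀ` in `oscMatrix`. -/
def schurDel (s : Fin N → ℕ) (P Q : Fin N × Fin d → A) (J' : Matrix (Fin d) (Fin d) ℂ)
    (J : Matrix (Fin N) (Fin N) ℂ) : Matrix (Fin N) (Fin N) (PDO A) :=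
  PDO.charMatrix PDO.del J - oscY s P * PDO.zResolvent A J'.transpose * oscX Q

variable (s : Fin N → ℕ) (P Q : Fin N × Fin d → A) (J' : Matrix (Fin d) (Fin d) ℂ)
    (J : Matrix (Fin N) (Fin N) ℂ)

theorem schurZ_apply (i j : Fin d) : schurZ s P Q J' J i j =
    PDO.charMatrix PDO.zvar J'.transpose i j - PDO.delSeries fun k =>
      ∑ r, ∑ t, (J ^ k) r t • (Q (r, i) * ((-1 : ℂ) ^ s t • P (t, j))) := by
  rw [schurZ, Matrix.sub_apply]
  congr 1
  simp only [Matrix.mul_apply, oscX, oscY, Matrix.of_apply, PDO.delResolvent,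
    PDO.mono_mul_delSeries, ← mono_sg_smul, PDO.delSeries_sum, PDO.delSeries_mul_mono]
  congr 1
  funext k
  rw [Finset.sum_comm' (t' := Finset.univ) (s' := fun _ => Finset.univ) (by simp)]
  refine Finset.sum_congr rfl fun t _ => ?_
  rw [Finset.sum_mul]
  refine Finset.sum_congr rfl fun r _ => ?_
  rw [← Algebra.commutes, ← Algebra.smul_def, smul_mul_assoc]

theorem schurDel_apply (i j : Fin N) : schurDel s P Q J' J i j =
    PDO.charMatrix PDO.del J i j - sg (s i) • PDO.zSeries fun k =>
      ∑ α, ∑ β, (J' ^ k) α β • (P (i, β) * Q (j, α)) := by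
  rw [schurDel, Matrix.sub_apply]
  congr 1
  simp only [Matrix.mul_apply, oscX, oscY, Matrix.of_apply, PDO.zResolvent, smul_mul_assoc,
    PDO.mono_mul_zSeries, PDO.zSeries_sum, PDO.zSeries_mul_mono, ← Finset.smul_sum]
  congr 2
  funext k
  refine Finset.sum_congr rfl fun α _ => ?_
  rw [Finset.sum_mul]
  refine Finset.sum_congr rfl fun β _ => ?_
  rw [← Matrix.transpose_pow, Matrix.transpose_apply, ← Algebra.commutes, ← Algebra.smul_def,
    smul_mul_assoc]

end Schur

/-- Summing against the powers of a Jordan matrix is the expansion in the evaluation maps. -/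
theorem sum_jordan_pow_smul {B : Type*} [AddCommGroup B] [Module ℂ B] {c N : ℕ} {γ : Fin c → ℕ}
    (hN : ∑ i, γ i = N) (z : Fin c → ℂ) (n : ℕ) (F : Fin N → Fin N → B) :
    ∑ r, ∑ t, (jordan γ z ^ n : Matrix (Fin N) (Fin N) ℂ) r t • F r t =
      ∑ i, ∑ k ∈ Finset.range (n + 1), ((n.choose k : ℂ) * z i ^ (n - k)) •
        ∑ r, ∑ t, (shiftMat γ i k : Matrix (Fin N) (Fin N) ℂ) r t • F r t := by
  let L : Matrix (Fin N) (Fin N) ℂ →ₗ[ℂ] B :=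
    ∑ r, ∑ t, (Matrix.entryLinearMap ℂ ℂ r t).smulRight (F r t)
  have hL : ∀ W, L W = ∑ r, ∑ t, W r t • F r t := fun W => by
    simp [L, LinearMap.sum_apply]
  simp only [← hL, jordan_pow hN, map_sum, map_smul]

theorem neg_one_pow_mul_const_sub {A : Type*} [Ring A] [Algebra ℂ A] (k : ℕ) (c : ℂ) (x : PDO A) :
    (-1) ^ k * (PDO.const ((-1) ^ (k + 1) * c) - x) = -PDO.const c - sg k • x := by
  have e : ∀ y : PDO A, (-1) ^ k * y = sg k • y := fun y => by
    rw [zsmul_eq_mul, sg]; push_cast; rfl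
  have h : PDO.const ((-1) ^ (k + 1) * c) = -(sg k • (PDO.const c : PDO A)) := by
    rw [PDO.const, PDO.const, ← mono_sg_smul, ← PDO.constHom_apply, ← PDO.constHom_apply, ← map_neg,
      map_mul, pow_succ, mul_neg_one, map_neg, neg_mul, ← Algebra.smul_def]
  rw [mul_sub, e, e, h, smul_neg, smul_smul, sg_mul_self, one_smul]

theorem Lsuper_apply {p q m n l : ℕ} {c : ℕ} (ξ : Fin l → ℕ) (w : Fin l → ℂ) (γ : Fin c → ℕ)
    (z : Fin c → ℂ) (i j : Fin (p + q + m + n)) :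
    Lsuper ξ w (nuJordan p q m n γ z) i j = PDO.charMatrix PDO.del (jordan γ z) i j -
      sg (parity p q m i) • PDO.zSeries fun k =>
        evalCurrent (fun r : Fin (p + q + m + n) => parity p q m r) ξ w k i j := by
  rw [Lsuper, Matrix.of_apply, psi_eq, nuJordan, neg_one_pow_mul_const_sub, PDO.charMatrix,
    Matrix.of_apply, sub_eq_add_neg (G := PDO _) (ite _ _ _), add_sub_assoc]

variable {d p q m n : ℕ}

section Phi

variable {p' q' m' n' : ℕ} {γ : Fin (p' + q' + m' + n') → ℕ}

theorem BlockSums.sum_eq (hγ : BlockSums p q m n p' q' m' n' γ) :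
    ∑ i, γ i = p + q + m + n := by
  obtain ⟨h1, h2, h3, h4⟩ := hγ
  rw [← h1, ← h2, ← h3, ← h4, ← Finset.sum_add_distrib, ← Finset.sum_add_distrib,
    ← Finset.sum_add_distrib]
  refine Finset.sum_congr rfl fun i _ => ?_
  split_ifs <;> omega

theorem phi_gen (hγ : BlockSums p q m n p' q' m' n' γ) (c : Fin (p' + q' + m' + n')) (k : ℕ)
    (a b : Fin d) : phi hγ (gen (fun _ : Fin d => 0) γ c k a b) = phiGen γ (c, k, a, b) := by
  rw [phi, gen, RingQuot.liftAlgHom_mkAlgHom_apply, FreeAlgebra.lift_ι_apply]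

theorem neg_mul_eq_smul_mul_smul {A : Type*} [Ring A] [Algebra ℂ A] (k : ℕ) (x y : A) :
    -(x * y) = ((-1 : ℂ) ^ (k + 1) • x) * ((-1 : ℂ) ^ k • y) := by
  rw [smul_mul_smul_comm, ← pow_add, neg_one_pow_congr (b := 1), pow_one, neg_smul, one_smul]
  have h2 : (2 : ZMod 2) = 0 := rfl
  push_cast
  linear_combination (k : ZMod 2) * h2

/-- A shift preserves the parity and does not mix the two kinds of variables, so the image of
`e_{ab} ⊗ t^k` is bilinear in the annihilation and the creation operators. -/
theorem phiGen_eq_sum (hγ : BlockSums p q m n p' q' m' n' γ) (c : Fin (p' + q' + m' + n')) (k : ℕ)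
    (a b : Fin d) : (phiGen γ (c, k, a, b) : FockWeyl d p q m n) =
      ∑ r, ∑ t, (shiftMat γ c k : Matrix (Fin (p + q + m + n)) (Fin (p + q + m + n)) ℂ) r t •
        (annihilation d p q m n (r, b) *
          ((-1 : ℂ) ^ parity p q m t • creation d p q m n (t, a))) := by
  rw [phiGen]
  refine Finset.sum_congr rfl fun r _ => Finset.sum_congr rfl fun t _ => ?_
  rw [shiftMat, Matrix.of_apply]
  by_cases h : Shift γ c k r t
  · obtain ⟨h1, h2⟩ := hγ.shift h
    rw [if_pos h, if_pos h, one_smul, annihilation, creation]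
    dsimp only
    by_cases hr : (r : ℕ) < p + q
    · rw [if_pos hr, if_pos hr, if_pos (h1.1 hr), h2]
      exact neg_mul_eq_smul_mul_smul _ _ _
    · rw [if_neg hr, if_neg hr, if_neg (fun h' => hr (h1.2 h')), h2, mul_smul_comm]
  · rw [if_neg h, if_neg h, zero_smul]

theorem phi_evalCurrent (hγ : BlockSums p q m n p' q' m' n' γ) (z : Fin (p' + q' + m' + n') → ℂ)
    (k : ℕ) (a b : Fin d) :
    (phi hγ (evalCurrent (fun _ : Fin d => 0) γ z k a b) : FockWeyl d p q m n) =
      ∑ r, ∑ t, (jordan γ z ^ k : Matrix (Fin (p + q + m + n)) (Fin (p + q + m + n)) ℂ) r t •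
        (annihilation d p q m n (r, b) *
          ((-1 : ℂ) ^ parity p q m t • creation d p q m n (t, a))) := by
  refine Eq.trans ?_ (sum_jordan_pow_smul hγ.sum_eq z k _).symm
  simp only [evalCurrent, map_sum, map_smul, phi_gen, phiGen_eq_sum hγ]

/-- The image of `Lhat` is the Schur complement of the block `∂ - J_γ`. -/
theorem map_phi_Lhat (hγ : BlockSums p q m n p' q' m' n' γ) (z : Fin (p' + q' + m' + n') → ℂ)
    {d' : ℕ} (ξ : Fin d' → ℕ) (w : Fin d' → ℂ) :
    (Lhat (d := d) γ z (muJordan ξ w)).map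
      (PDO.map (phi (d := d) hγ : _ →+* FockWeyl d p q m n)) =
      schurZ (fun r => parity p q m r) (creation d p q m n) (annihilation d p q m n)
        (jordan ξ w) (jordan γ z) := by
  ext1 i j
  rw [Matrix.map_apply, Lhat_apply, map_sub, map_add, PDO.map_const, PDO.map_delSeries,
    schurZ_apply, PDO.charMatrix, Matrix.of_apply]
  congr 1
  · rw [sub_eq_add_neg]
    congr 1
    · split_ifs
      · exact PDO.map_zvar _
      · exact map_zero _
    · rw [muJordan, Matrix.transpose_apply, PDO.const, PDO.const, map_neg, ← PDO.constHom_apply,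
        ← PDO.constHom_apply, map_neg]
  · simp only [RingHom.coe_coe, phi_evalCurrent hγ]

end Phi

section Varphi

variable {d' : ℕ} {ξ : Fin d' → ℕ}

theorem varphi_gen (c : Fin d') (k : ℕ) (i j : Fin (p + q + m + n)) :
    (varphi ξ (gen (fun r : Fin (p + q + m + n) => parity p q m r) ξ c k i j) :
      FockWeyl d p q m n) = varphiGen ξ (c, k, i, j) := by
  rw [varphi, gen, RingQuot.liftAlgHom_mkAlgHom_apply, FreeAlgebra.lift_ι_apply]

theorem varphiGen_eq_sum (c : Fin d') (k : ℕ) (i j : Fin (p + q + m + n)) :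
    (varphiGen ξ (c, k, i, j) : FockWeyl d p q m n) =
      ∑ α, ∑ β, (shiftMat ξ c k : Matrix (Fin d) (Fin d) ℂ) α β •
        (creation d p q m n (i, β) * annihilation d p q m n (j, α)) := by
  rw [varphiGen]
  refine Finset.sum_congr rfl fun α _ => Finset.sum_congr rfl fun β _ => ?_
  rw [shiftMat, Matrix.of_apply, ite_smul, one_smul, zero_smul, creation, annihilation]
  split_ifs <;> simp

theorem varphi_evalCurrent (hξ : ∑ a, ξ a = d) (w : Fin d' → ℂ) (k : ℕ)
    (i j : Fin (p + q + m + n)) :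
    (varphi ξ (evalCurrent (fun r : Fin (p + q + m + n) => parity p q m r) ξ w k i j) :
      FockWeyl d p q m n) =
      ∑ α, ∑ β, (jordan ξ w ^ k : Matrix (Fin d) (Fin d) ℂ) α β •
        (creation d p q m n (i, β) * annihilation d p q m n (j, α)) := by
  refine Eq.trans ?_ (sum_jordan_pow_smul hξ w k _).symm
  simp only [evalCurrent, map_sum, map_smul, varphi_gen, varphiGen_eq_sum]

/-- The image of `Lsuper` is the Schur complement of the block `z - J_ξᵀ`. -/
theorem map_varphi_Lsuper (hξ : ∑ a, ξ a = d) (w : Fin d' → ℂ) {l : ℕ} (γ : Fin l → ℕ)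
    (z : Fin l → ℂ) :
    (Lsuper ξ w (nuJordan p q m n γ z)).map
      (PDO.map (varphi (d := d) (p := p) (q := q) (m := m) (n := n) ξ : _ →+*
        FockWeyl d p q m n)) =
      schurDel (fun r => parity p q m r) (creation d p q m n) (annihilation d p q m n)
        (jordan ξ w) (jordan γ z) := by
  ext1 i j
  rw [Matrix.map_apply, Lsuper_apply, map_sub, map_zsmul, PDO.map_zSeries, schurDel_apply,
    PDO.charMatrix, PDO.charMatrix, Matrix.of_apply, Matrix.of_apply, map_sub, PDO.map_const]
  congr 1
  · congr 1
    split_ifs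
    · exact PDO.map_del _
    · exact map_zero _
  · simp only [RingHom.coe_coe, varphi_evalCurrent hξ]

end Varphi

end Lax

/-! ### The two elimination orders of the oscillator matrix -/

section Duality

theorem principalQuasidet_fromBlocks₁₁ {R α β : Type*} [Ring R] [Fintype α] [DecidableEq α]
    [Fintype β] [DecidableEq β] {Z : Matrix α α R} {X : Matrix α β R} {Y : Matrix β α R}
    {T G : Matrix β β R} (hTG : T * G = 1) (hGT : G * T = 1)
    (h : IsUnit (Matrix.fromBlocks Z X Y T)) (i : α) :
    principalQuasidet (Matrix.fromBlocks Z X Y T) (Sum.inl i) =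
      principalQuasidet (Z - X * G * Y) i := by
  have h1 := Ring.mul_inverse_cancel _ h
  have h2 := Ring.inverse_mul_cancel _ h
  obtain ⟨h3, h4⟩ := schur_complement₁₁ hTG hGT h1 h2
  rw [principalQuasidet_eq h3 h4]
  rfl

theorem principalQuasidet_fromBlocks₂₂ {R α β : Type*} [Ring R] [Fintype α] [DecidableEq α]
    [Fintype β] [DecidableEq β] {Z G : Matrix α α R} {X : Matrix α β R} {Y : Matrix β α R}
    {T : Matrix β β R} (hZG : Z * G = 1) (hGZ : G * Z = 1)
    (h : IsUnit (Matrix.fromBlocks Z X Y T)) (i : β) :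
    principalQuasidet (Matrix.fromBlocks Z X Y T) (Sum.inr i) =
      principalQuasidet (T - Y * G * X) i := by
  have h1 := Ring.mul_inverse_cancel _ h
  have h2 := Ring.inverse_mul_cancel _ h
  obtain ⟨h3, h4⟩ := schur_complement₂₂ hZG hGZ h1 h2
  rw [principalQuasidet_eq h3 h4]
  rfl

theorem _root_.PDO.NearDiagonal.isUnit {A κ : Type*} [Ring A] [Fintype κ] [DecidableEq κ]
    {M : Matrix κ κ (PDO A)} (hM : PDO.NearDiagonal M) : IsUnit M := by
  obtain ⟨N, h1, h2, -⟩ := hM.exists_inverse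
  exact ⟨⟨M, N, h1, h2⟩, rfl⟩

variable {A : Type*} [Ring A] [Algebra ℂ A] {d N : ℕ} (s : Fin N → ℕ) (P Q : Fin N × Fin d → A)
  (J' : Matrix (Fin d) (Fin d) ℂ) (J : Matrix (Fin N) (Fin N) ℂ)

theorem schurZ_sufficientlyInvertible : SufficientlyInvertible (schurZ s P Q J' J) := by
  refine PDO.NearDiagonal.sufficientlyInvertible ⟨fun _ => PDO.zvar, fun _ => Or.inl rfl, ?_⟩
  intro i j
  have e : ∀ a b c : PDO A, a - b - c - a = -(b + c) := fun _ _ _ => by abel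
  rw [schurZ_apply, PDO.charMatrix, Matrix.of_apply]
  dsimp only
  rw [e]
  exact AddSubgroup.neg_mem _ (AddSubgroup.add_mem _ (PDO.mono_mem_fil _) (PDO.delSeries_mem_fil _))

theorem Lsuper_sufficientlyInvertible {p q m n l c : ℕ} (ξ : Fin l → ℕ) (w : Fin l → ℂ)
    (γ : Fin c → ℕ) (z : Fin c → ℂ) :
    SufficientlyInvertible (Lsuper ξ w (nuJordan p q m n γ z)) := by
  refine PDO.NearDiagonal.sufficientlyInvertible ⟨fun _ => PDO.del, fun _ => Or.inr rfl, ?_⟩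
  intro i j
  have e : ∀ a b c : PDO (TakiffU (fun r : Fin (p + q + m + n) => parity p q m r) ξ),
    a - b - c - a = -(b + c) := fun _ _ _ => by abel
  rw [Lsuper_apply, PDO.charMatrix, Matrix.of_apply]
  dsimp only
  rw [e]
  exact AddSubgroup.neg_mem _ (AddSubgroup.add_mem _ (PDO.mono_mem_fil _)
    (AddSubgroup.zsmul_mem _ (PDO.zSeries_mem_fil _) _))

variable [NeZero d] [NeZero N]

theorem gridMap_zero_right_inl {k : ℕ} (hk : k < d) (x : Fin (k + 1)) :
    gridMap d N (k + 1) 0 (Sum.inl x) = Sum.inl (Fin.castLE hk x) := by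
  rw [gridMap_eq hk (Nat.zero_le N)]; rfl

theorem gridMap_zero_left_inr {j : ℕ} (hj : j < N) (x : Fin (j + 1)) :
    gridMap d N 0 (j + 1) (Sum.inr x) = Sum.inr (Fin.castLE hj x) := by
  rw [gridMap_eq (Nat.zero_le d) hj]; rfl

/-- The last column of a leading submatrix of `z - J'ᵀ` vanishes off the diagonal. -/
theorem quasiminorL_zero (hJ' : ∀ r r', r' < r → J' r r' = 0) (k : Fin d) :
    quasiminorL (oscMatrix s P Q J' J) k 0 = PDO.zvar - PDO.const (J' k k) := by
  obtain ⟨N', h1, h2, -, h3⟩ := ((oscMatrix_nearDiagonal s P Q J' J).submatrix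
    (gridMap_injective (k := k + 1) k.isLt (Nat.zero_le N))).exists_inverse
  have e : ∀ x, ((oscMatrix s P Q J' J).submatrix (gridMap d N (k + 1) 0) (gridMap d N (k + 1) 0))
      (Sum.inl x) (Sum.inl (Fin.last k)) =
      PDO.charMatrix PDO.zvar J'.transpose (Fin.castLE k.isLt x) k := fun x => by
    rw [Matrix.submatrix_apply, gridMap_zero_right_inl k.isLt, gridMap_zero_right_inl k.isLt]
    rfl
  rw [quasiminorL, principalQuasidet_of_col h1 h2 (h3 _), e]
  · change PDO.charMatrix PDO.zvar J'.transpose k k = _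
    rw [PDO.charMatrix, Matrix.of_apply, if_pos rfl, Matrix.transpose_apply]
  · rintro (x | x) hx
    · have hlt : x < Fin.last k := lt_of_le_of_ne (Fin.le_last x) fun h => hx (by rw [h])
      have hlt' : Fin.castLE k.isLt x < k := hlt
      rw [e, PDO.charMatrix, Matrix.of_apply, if_neg hlt'.ne, Matrix.transpose_apply,
        hJ' _ _ hlt', PDO.const, map_zero, PDO.mono_zero, sub_zero]
    · exact x.elim0

/-- The last row of a leading submatrix of `∂ - J` vanishes off the diagonal. -/
theorem quasiminorR_zero (hJ : ∀ r r', r' < r → J r r' = 0) (j : Fin N) :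
    quasiminorR (oscMatrix s P Q J' J) 0 j = PDO.del - PDO.const (J j j) := by
  obtain ⟨N', h1, h2, -, h3⟩ := ((oscMatrix_nearDiagonal s P Q J' J).submatrix
    (gridMap_injective (j := j + 1) (Nat.zero_le d) j.isLt)).exists_inverse
  have e : ∀ x, ((oscMatrix s P Q J' J).submatrix (gridMap d N 0 (j + 1)) (gridMap d N 0 (j + 1)))
      (Sum.inr (Fin.last j)) (Sum.inr x) =
      PDO.charMatrix PDO.del J j (Fin.castLE j.isLt x) := fun x => by
    rw [Matrix.submatrix_apply, gridMap_zero_left_inr j.isLt, gridMap_zero_left_inr j.isLt]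
    rfl
  rw [quasiminorR, principalQuasidet_of_row h1 h2 (h3 _), e]
  · change PDO.charMatrix PDO.del J j j = _
    rw [PDO.charMatrix, Matrix.of_apply, if_pos rfl]
  · rintro (x | x) hx
    · exact x.elim0
    · have hlt : x < Fin.last j := lt_of_le_of_ne (Fin.le_last x) fun h => hx (by rw [h])
      have hlt' : Fin.castLE j.isLt x < j := hlt
      rw [e, PDO.charMatrix, Matrix.of_apply, if_neg hlt'.ne', hJ _ _ hlt', PDO.const, map_zero,
        PDO.mono_zero, sub_zero]

theorem quasiminorL_top (k : Fin d) :
    quasiminorL (oscMatrix s P Q J' J) k N = quasiminor (schurZ s P Q J' J) k := by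
  have hu := ((oscMatrix_nearDiagonal s P Q J' J).submatrix
    (gridMap_injective (k := k + 1) k.isLt le_rfl)).isUnit
  rw [gridMap_eq k.isLt le_rfl] at hu
  rw [quasiminorL, gridMap_eq k.isLt le_rfl]
  have e : (oscMatrix s P Q J' J).submatrix (Sum.map (Fin.castLE k.isLt) (Fin.castLE le_rfl))
      (Sum.map (Fin.castLE k.isLt) (Fin.castLE le_rfl)) =
      Matrix.fromBlocks ((PDO.charMatrix PDO.zvar J'.transpose).submatrix (Fin.castLE k.isLt)
        (Fin.castLE k.isLt)) ((oscX Q).submatrix (Fin.castLE k.isLt) id)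
        ((oscY s P).submatrix id (Fin.castLE k.isLt)) (PDO.charMatrix PDO.del J) := by
    ext1 x y
    rcases x with x | x <;> rcases y with y | y <;> rfl
  rw [e] at hu ⊢
  rw [principalQuasidet_fromBlocks₁₁ (PDO.charMatrix_mul_delResolvent J)
    (PDO.delResolvent_mul_charMatrix J) hu]
  rfl

theorem quasiminorR_top (j : Fin N) :
    quasiminorR (oscMatrix s P Q J' J) d j = quasiminor (schurDel s P Q J' J) j := by
  have hu := ((oscMatrix_nearDiagonal s P Q J' J).submatrix
    (gridMap_injective (j := j + 1) le_rfl j.isLt)).isUnit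
  rw [gridMap_eq le_rfl j.isLt] at hu
  rw [quasiminorR, gridMap_eq le_rfl j.isLt]
  have e : (oscMatrix s P Q J' J).submatrix (Sum.map (Fin.castLE le_rfl) (Fin.castLE j.isLt))
      (Sum.map (Fin.castLE le_rfl) (Fin.castLE j.isLt)) =
      Matrix.fromBlocks (PDO.charMatrix PDO.zvar J'.transpose)
        ((oscX Q).submatrix id (Fin.castLE j.isLt))
        ((oscY s P).submatrix (Fin.castLE j.isLt) id)
        ((PDO.charMatrix PDO.del J).submatrix (Fin.castLE j.isLt) (Fin.castLE j.isLt)) := by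
    ext1 x y
    rcases x with x | x <;> rcases y with y | y <;> rfl
  rw [e] at hu ⊢
  rw [principalQuasidet_fromBlocks₂₂ (PDO.charMatrix_mul_zResolvent J'.transpose)
    (PDO.zResolvent_mul_charMatrix J'.transpose) hu]
  rfl

variable {s P Q J' J}

/-- The duality for arbitrary operators satisfying the canonical supercommutation relations and
upper triangular parameters. -/
theorem oscillator_duality (h : CCR (fun v => s v.1) P Q) (hs : ∀ r, s r = 0 ∨ s r = 1)
    (hJ : ∀ r t, J r t ≠ 0 → s r = s t) (hJ' : ∀ r r', r' < r → J' r r' = 0)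
    (hJu : ∀ r r', r' < r → J r r' = 0) :
    (List.ofFn fun j => signedPow (s j) (PDO.del - PDO.const (J j j))).prod *
        cdet (schurZ s P Q J' J) =
      (List.ofFn fun k => PDO.zvar - PDO.const (J' k k)).prod *
        (List.ofFn fun j => signedPow (s j) (quasiminor (schurDel s P Q J' J) j)).prod := by
  have key := quasiminor_prod (oscMatrix_nearDiagonal s P Q J' J) oscForm_antisymm
    (oscMatrix_centralRel h J' hJ) (fun _ => rfl) hs
  simp only [quasiminorL_zero s P Q J' J hJ', quasiminorR_zero s P Q J' J hJu, quasiminorL_top,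
    quasiminorR_top, Sum.elim_inr] at key
  rw [IsManin.cdet_eq_prod_quasiminor (K := schurZ s P Q J' J) (schur_isManin h J' hJ)
    pdo_two_torsion (schurZ_sufficientlyInvertible s P Q J' J)]
  exact key.symm

end Duality

/-! ### Grouping the factors by Jordan blocks -/

section Grouping

variable {c N : ℕ} {γ : Fin c → ℕ}

open scoped IsMulCommutative in
/-- The product takes place in the commutative submonoid generated by the factors. -/
theorem prod_ofFn_blockOf {G : Type*} [Monoid G] (hN : ∑ i, γ i = N) {g : Fin c → G}
    (hg : ∀ i j, Commute (g i) (g j)) :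
    (List.ofFn fun r : Fin N => g (blockOf hN r)).prod = (List.ofFn fun i => g i ^ γ i).prod := by
  have hcomm : ∀ a ∈ Set.range g, ∀ b ∈ Set.range g, a * b = b * a := by
    rintro _ ⟨i, rfl⟩ _ ⟨j, rfl⟩
    exact hg i j
  have := Submonoid.isMulCommutative_closure G hcomm
  let g' : Fin c → Submonoid.closure (Set.range g) := fun i =>
    ⟨g i, Submonoid.subset_closure ⟨i, rfl⟩⟩
  have h1 : (List.ofFn fun r : Fin N => g' (blockOf hN r)).prod =
      (List.ofFn fun i => g' i ^ γ i).prod := by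
    rw [List.prod_ofFn, List.prod_ofFn, ← Finset.prod_fiberwise _ (blockOf hN)]
    refine Finset.prod_congr rfl fun i _ => ?_
    rw [← card_blockOf hN i, ← Finset.prod_const]
    refine Finset.prod_congr rfl fun r hr => ?_
    rw [(Finset.mem_filter.1 hr).2]
  have h2 := congrArg (Submonoid.closure (Set.range g)).subtype h1
  rw [map_list_prod, map_list_prod, List.map_ofFn, List.map_ofFn] at h2
  exact h2

variable {A : Type*} [Ring A] [Algebra ℂ A]

/-- The inverse is the resolvent of a matrix of size one. -/
theorem isUnit_del_sub_const (z : ℂ) : IsUnit (PDO.del - PDO.const z : PDO A) := by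
  have h1 := congrFun (congrFun (PDO.charMatrix_mul_delResolvent (A := A)
    (Matrix.of fun _ _ : Fin 1 => z)) 0) 0
  have h2 := congrFun (congrFun (PDO.delResolvent_mul_charMatrix (A := A)
    (Matrix.of fun _ _ : Fin 1 => z)) 0) 0
  rw [Matrix.mul_apply, Fin.sum_univ_one, Matrix.one_apply_eq] at h1 h2
  exact ⟨⟨_, _, h1, h2⟩, congrArg (fun x => x - PDO.const z) (if_pos rfl)⟩

theorem commute_sub_const {x : PDO A} (z z' : ℂ) :
    Commute (x - PDO.const z) (x - PDO.const z') :=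
  ((Commute.refl x).sub_right (PDO.const_commute z' x).symm).sub_left
    ((PDO.const_commute z _))

theorem signedPow_unit {R : Type*} [Ring R] (e : ℕ) (u : Rˣ) :
    signedPow e (u : R) = ((u ^ (if e = 0 then 1 else -1 : ℤ) : Rˣ) : R) := by
  rw [signedPow]
  split_ifs
  · rw [zpow_one]
  · rw [zpow_neg_one, Ring.inverse_unit]

variable {p q m n p' q' m' n' : ℕ} {γ : Fin (p' + q' + m' + n') → ℕ}

theorem BlockSums.parity_blockOf (hγ : BlockSums p q m n p' q' m' n' γ)
    (r : Fin (p + q + m + n)) : parity p q m r = parity p' q' m' (blockOf hγ.sum_eq r) := by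
  obtain ⟨e1, e2, e3⟩ := hγ.starts
  obtain ⟨h1, h2⟩ := blockOf_spec hγ.sum_eq r
  have key : ∀ a : ℕ, ((r : ℕ) < blockStart γ a ↔ (blockOf hγ.sum_eq r : ℕ) < a) := fun a => by
    rcases Nat.lt_or_ge (blockOf hγ.sum_eq r : ℕ) a with ha | ha
    · have := blockStart_mono γ (show (blockOf hγ.sum_eq r : ℕ) + 1 ≤ a from ha)
      omega
    · have := blockStart_mono γ ha
      omega
  have k1 := key p'
  have k2 := key (p' + q')
  have k3 := key (p' + q' + m')
  rw [e1] at k1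
  rw [e2] at k2
  rw [e3] at k3
  unfold parity
  congr 1
  apply propext
  omega

/-- The ordered product of the diagonal factors of `∂ - J_γ` with signs, grouped by Jordan blocks. -/
theorem prod_signedPow_jordan (hγ : BlockSums p q m n p' q' m' n' γ)
    (z : Fin (p' + q' + m' + n') → ℂ) {u : Fin (p' + q' + m' + n') → (PDO A)ˣ}
    (hu : ∀ i, (u i : PDO A) = PDO.del - PDO.const (z i)) :
    (List.ofFn fun r : Fin (p + q + m + n) => signedPow (parity p q m r)
      (PDO.del - PDO.const (jordan γ z r r) : PDO A)).prod =
      ((List.ofFn fun i => u i ^ signedOrder p' q' m' γ i).prod : (PDO A)ˣ) := by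
  have h1 : ∀ i, u i ^ signedOrder p' q' m' γ i =
      (u i ^ (if parity p' q' m' i = 0 then 1 else -1 : ℤ)) ^ γ i := fun i => by
    rw [← zpow_natCast, ← zpow_mul, signedOrder, parity]
    congr 1
    split_ifs <;> simp_all
  have hc : ∀ i j, Commute (u i) (u j) := fun i j => by
    rw [← Commute.units_val_iff, hu, hu]
    exact commute_sub_const _ _
  simp only [h1]
  rw [← prod_ofFn_blockOf hγ.sum_eq
    (g := fun i => u i ^ (if parity p' q' m' i = 0 then 1 else -1 : ℤ))
    fun i j => (hc i j).zpow_zpow _ _, ← Units.coeHom_apply, map_list_prod, List.map_ofFn]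
  congr 2
  funext r
  rw [Function.comp_apply, Units.coeHom_apply, jordan_diag hγ.sum_eq, ← hu, signedPow_unit,
    hγ.parity_blockOf]

theorem jordan_parity (hγ : BlockSums p q m n p' q' m' n' γ) (z : Fin (p' + q' + m' + n') → ℂ)
    (r t : Fin (p + q + m + n)) (h : jordan γ z r t ≠ 0) : parity p q m r = parity p q m t := by
  rw [jordan_eq, Matrix.sum_apply] at h
  obtain ⟨i, -, hi⟩ := Finset.exists_ne_zero_of_sum_ne_zero h
  by_cases h0 : Shift γ i 0 r t
  · exact (hγ.shift h0).2
  by_cases h1 : Shift γ i 1 r t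
  · exact (hγ.shift h1).2
  · simp [shiftMat, h0, h1] at hi

theorem parity_eq_zero_or_one (p q m i : ℕ) : parity p q m i = 0 ∨ parity p q m i = 1 := by
  unfold parity; split_ifs <;> simp

end Grouping

end Gaudin

theorem theorem4p4
    (d p q m n d' p' q' m' n' : ℕ) (hd' : 0 < d') (hpqmn : 0 < p + q + m + n)
    (ξ : Fin d' → ℕ) (hξ : ∀ a, 0 < ξ a) (hξd : ∑ a, ξ a = d)
    (γ : Fin (p' + q' + m' + n') → ℕ) (hγ : ∀ i, 0 < γ i)
    (hγs : Gaudin.BlockSums p q m n p' q' m' n' γ)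
    (w : Fin d' → ℂ) (z : Fin (p' + q' + m' + n') → ℂ) :
    Gaudin.SufficientlyInvertible (Gaudin.Lsuper ξ w (Gaudin.nuJordan p q m n γ z)) ∧
    ∃ u : Fin (p' + q' + m' + n') → (PDO (Gaudin.FockWeyl d p q m n))ˣ,
      (∀ i, (u i : PDO (Gaudin.FockWeyl d p q m n)) = PDO.del - PDO.const (z i)) ∧
      ((List.ofFn fun i => u i ^ Gaudin.signedOrder p' q' m' γ i).prod :
          (PDO (Gaudin.FockWeyl d p q m n))ˣ) *
        PDO.map (Gaudin.phi (d := d) hγs : _ →+* Gaudin.FockWeyl d p q m n)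
          (Gaudin.cdet (Gaudin.Lhat (d := d) γ z (Gaudin.muJordan ξ w))) =
      (List.ofFn fun a => (PDO.zvar - PDO.const (w a)) ^ ξ a).prod *
        PDO.map (Gaudin.varphi (d := d) (p := p) (q := q) (m := m) (n := n) ξ : _ →+*
              Gaudin.FockWeyl d p q m n)
          (Gaudin.ber (fun i => Gaudin.parity p q m i)
            (Gaudin.Lsuper ξ w (Gaudin.nuJordan p q m n γ z))) := by
  have hd : d ≠ 0 := by
    rw [← hξd]
    have := Finset.single_le_sum (f := ξ) (fun _ _ => Nat.zero_le _) (Finset.mem_univ ⟨0, hd'⟩)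
    have := hξ ⟨0, hd'⟩
    omega
  have : NeZero d := ⟨hd⟩
  have : NeZero (p + q + m + n) := ⟨hpqmn.ne'⟩
  have hS := Gaudin.Lsuper_sufficientlyInvertible (p := p) (q := q) (m := m) (n := n) ξ w γ z
  refine ⟨hS, fun i => (Gaudin.isUnit_del_sub_const (z i)).unit, fun _ => rfl, ?_⟩
  rw [Gaudin.map_cdet, Gaudin.map_phi_Lhat, Gaudin.map_ber _ _ hS, Gaudin.map_varphi_Lsuper hξd,
    ← Gaudin.prod_signedPow_jordan hγs z fun _ => rfl,
    Gaudin.oscillator_duality (Gaudin.fock_ccr d p q m n)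
      (fun r => Gaudin.parity_eq_zero_or_one p q m r) (Gaudin.jordan_parity hγs z)
      (fun _ _ => Gaudin.jordan_upper w) (fun _ _ => Gaudin.jordan_upper z)]
  congr 1
  simp only [Gaudin.jordan_diag hξd]
  exact Gaudin.prod_ofFn_blockOf hξd fun _ _ => Gaudin.commute_sub_const _ _

end
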